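/- Let $A=(a_{ij})_{i,j\in I}$ be a generalized Cartan matrix: an integer matrix with $a_{ii}=2$, $a_{ij}\le 0$ for $i\ne j$, and $a_{ij}=0\Leftrightarrow a_{ji}=0$; if $I$ is infinite, assume also that each row has only finitely many nonzero entries. Let $W(A)$ be its Weyl group, with generators $r_i$ $(i\in I)$ and fundamental relations $r_i^2=1$ and $(r_ir_j)^{m_{ij}}=1$ $(i\neq j)$, where $m_{ij}=2,3,4,6,\infty$ according as $a_{ij}a_{ji}=0,1,2,3,\ge 4$ (no relation if $m_{ij}=\infty$). It acts on the free abelian group $L=\bigoplus_{i\in I}\mathbb Z\Lambda_i$ by $r_i.\Lambda=\Lambda-\langle h_i,\Lambda\rangle\sum_{k\in I}a_{ki}\Lambda_k$, where $\langle h_i,\Lambda_j\rangle=\delta_{ij}$. Let $\mathcal A_0$ be a Poisson algebra over $\mathbb C$ without zero divisors, generated as a Poisson algebra by nonzero elements $\varphi_i$ $(i\in I)$ such that $\mathrm{ad}(\varphi_i)^{1-a_{ij}}(\varphi_j)=0$ for $i\ne j$, where $\mathrm{ad}(f)=\{f,\cdot\}$. Let $\mathcal A=\mathcal A_0[\lambda_i\,(i\in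 I)]$ be the polynomial ring, with the Poisson bracket extended by $\{\lambda_i,\cdot\}=0$, and let $\mathcal K$ be its field of fractions. Let $r_i$ also denote the $\mathcal A_0$-linear automorphism of $\mathcal A$ with $r_i(\lambda_j)=\lambda_j-a_{ji}\lambda_i$, and let $s_i$ be the (unique) automorphism of $\mathcal K$ that is given on $\mathcal A$ by $s_i=\exp\!\big(\tfrac{\lambda_i}{\varphi_i}\mathrm{ad}(\varphi_i)\big)\circ r_i$ (on each element a finite sum). Then the $s_i$ extend uniquely to automorphisms of the ring of Laurent polynomials $\mathcal K[\tau^{\pm1}]=\mathcal K[\tau_i^{\pm1}\,(i\in I)]$ such that $$s_i(\tau_j)=\tau_j\quad(j\ne i),\qquad s_i(\tau_i)=\varphi_i\,\tau_i\prod_{k\in I}\tau_k^{-a_{ki}},$$ and these extended automorphisms satisfy the fundamental relations $s_i^2=1$, $(s_is_j)^{m_{ij}}=1$ $(i\ne j)$; so $W(A)$ acts on $\mathcal K[\tau^{\pm1}]$, preserving $\mathcal K$, with $r_i$ acting as $s_i$. Put $\tau^\Lambda=\prod_{i}\tau_i^{\langle h_i,\Lambda\rangle}$ for $\Lambda\in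 L$. For all $w\in W(A)$ and $\Lambda\in L$ there is a unique $\phi_w(\Lambda)\in\mathcal K$ with $$w(\tau^\Lambda)=\phi_w(\Lambda)\,\tau^{w.\Lambda}.$$ These elements are nonzero, they satisfy $$\phi_w(\Lambda+\Lambda')=\phi_w(\Lambda)\phi_w(\Lambda'),\quad \phi_1(\Lambda)=1,\quad \phi_{r_i}(\Lambda)=\varphi_i^{\langle h_i,\Lambda\rangle},\quad \phi_{ww'}(\Lambda)=w(\phi_{w'}(\Lambda))\,\phi_w(w'.\Lambda)$$ for all $w,w'\in W(A)$, $\Lambda,\Lambda'\in L$, $i\in I$, and they are determined by these conditions. -/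

import Mathlib

universe u v

/-- A locally finite generalized Cartan matrix `(a i j)`. The index set `I` is arbitrary; for a
finite `I` the last condition holds automatically. -/
structure GCM (I : Type u) where
  a : Matrix I I ℤ
  diag : ∀ i, a i i = 2
  off_diag : ∀ i j, i ≠ j → a i j ≤ 0
  zero_iff : ∀ i j, a i j = 0 ↔ a j i = 0
  locally_finite : ∀ i, {j | a i j ≠ 0}.Finite

namespace GCM

variable {I : Type u} (A : GCM I)

theorem column_finite (i : I) : (Function.support fun k => A.a k i).Finite := by
  refine (A.locally_finite i).subset fun k hk h => hk ?_
  exact (A.zero_iff i k).1 h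

open Classical in
/-- The Coxeter matrix of the Weyl group: `m i j = 2, 3, 4, 6, ∞` according as
`a i j * a j i = 0, 1, 2, 3, ≥ 4`. Following the convention of `CoxeterMatrix`, the value `0`
stands for `∞` (no relation). -/
noncomputable def coxeterMatrix : CoxeterMatrix I where
  M := Matrix.of fun i j =>
    if i = j then 1
    else if A.a i j * A.a j i = 0 then 2
    else if A.a i j * A.a j i = 1 then 3
    else if A.a i j * A.a j i = 2 then 4
    else if A.a i j * A.a j i = 3 then 6
    else 0
  isSymm := by
    ext i j
    simp only [Matrix.transpose_apply, Matrix.of_apply, mul_comm (A.a j i), eq_comm (a := j)]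
  diagonal := by simp
  off_diagonal := by
    intro i j h
    simp only [Matrix.of_apply, if_neg h]
    split_ifs <;> decide

/-- The Weyl group `W(A)`, given by its generators and fundamental relations. -/
abbrev WeylGroup : Type u := A.coxeterMatrix.Group

/-- The generator `r i` of the Weyl group. -/
noncomputable abbrev r (i : I) : A.WeylGroup := A.coxeterMatrix.simple i

/-- The lattice `L = ⨁ ℤ Λ i` spanned by the fundamental weights; an element is written by its
coordinates, `Λ i = ⟨h i, Λ⟩`. -/
abbrev WeightLattice (_A : GCM I) : Type u := I →₀ ℤ

/-- The image `∑ k, a k i • Λ k` of the simple root `α i` in `L`. -/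
noncomputable def root (i : I) : A.WeightLattice :=
  Finsupp.ofSupportFinite (fun k => A.a k i) (A.column_finite i)

/-- The simple coroot `h i`, as a functional on `L`. -/
noncomputable def coroot (i : I) : Module.Dual ℤ A.WeightLattice := Finsupp.lapply i

theorem coroot_root (i j : I) : A.coroot i (A.root j) = A.a i j := rfl

/-- The simple reflection `Λ ↦ Λ - ⟨h i, Λ⟩ α i` of `L`. -/
noncomputable def simpleReflection (i : I) : A.WeightLattice ≃ₗ[ℤ] A.WeightLattice :=
  Module.reflection (x := A.root i) (f := A.coroot i) ((A.coroot_root i i).trans (A.diag i))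

theorem simpleReflection_pow_apply (i j : I) (m : ℕ) (t : ℤ) (ht : A.a i j * A.a j i - 2 = t)
    (z : A.WeightLattice) :
    ((A.simpleReflection i * A.simpleReflection j) ^ m) z =
      z + ((Polynomial.Chebyshev.S ℤ ((m - 2) / 2)).eval t *
          ((Polynomial.Chebyshev.S ℤ ((m - 1) / 2)).eval t +
            (Polynomial.Chebyshev.S ℤ ((m - 3) / 2)).eval t)) •
          ((A.a j i * z i - z j) • A.root j - z i • A.root i) +
        ((Polynomial.Chebyshev.S ℤ ((m - 1) / 2)).eval t *
          ((Polynomial.Chebyshev.S ℤ (m / 2)).eval t +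
            (Polynomial.Chebyshev.S ℤ ((m - 2) / 2)).eval t)) •
          ((A.a i j * z j - z i) • A.root i - z j • A.root j) :=
  Module.reflection_mul_reflection_pow_apply
    ((A.coroot_root i i).trans (A.diag i)) ((A.coroot_root j j).trans (A.diag j)) m z t ht.symm

theorem simpleReflection_isLiftable : A.coxeterMatrix.IsLiftable A.simpleReflection := by
  intro i j
  by_cases hij : i = j
  · subst hij
    ext1 z
    rw [A.coxeterMatrix.diagonal, pow_one]
    exact Module.involutive_reflection ((A.coroot_root i i).trans (A.diag i)) z
  ext1 z
  simp only [coxeterMatrix, Matrix.of_apply, if_neg hij]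
  split_ifs with h0 h1 h2 h3
  · have hx : A.a i j = 0 := by
      rcases mul_eq_zero.1 h0 with h | h
      · exact h
      · exact (A.zero_iff i j).2 h
    have hy : A.a j i = 0 := (A.zero_iff i j).1 hx
    rw [A.simpleReflection_pow_apply i j 2 (-2) (by rw [h0]; norm_num)]
    norm_num [hx, hy]
    abel
  · rw [A.simpleReflection_pow_apply i j 3 (-1) (by rw [h1]; norm_num)]
    norm_num
  · rw [A.simpleReflection_pow_apply i j 4 0 (by rw [h2]; norm_num)]
    norm_num
  · rw [A.simpleReflection_pow_apply i j 6 1 (by rw [h3]; norm_num)]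
    norm_num [Polynomial.Chebyshev.S_two]
  · rw [pow_zero]

/-- The action of the Weyl group on `L`. -/
noncomputable def weylAction : A.WeylGroup →* (A.WeightLattice ≃ₗ[ℤ] A.WeightLattice) :=
  A.coxeterMatrix.toCoxeterSystem.lift ⟨A.simpleReflection, A.simpleReflection_isLiftable⟩

theorem weylAction_r (i : I) (l : A.WeightLattice) :
    A.weylAction (A.r i) l = l - l i • A.root i := by
  have h : A.weylAction (A.r i) = A.simpleReflection i :=
    A.coxeterMatrix.toCoxeterSystem.lift_apply_simple A.simpleReflection_isLiftable i
  rw [h]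
  exact Module.reflection_apply _ _

end GCM

/-- A Poisson bracket on a commutative `ℂ`-algebra. -/
structure PoissonBracket (A₀ : Type v) [CommRing A₀] [Algebra ℂ A₀] where
  bracket : A₀ →ₗ[ℂ] A₀ →ₗ[ℂ] A₀
  skew : ∀ f g, bracket f g = -bracket g f
  mul_left : ∀ f g h, bracket (f * g) h = bracket f h * g + f * bracket g h
  mul_right : ∀ f g h, bracket f (g * h) = bracket f g * h + g * bracket f h
  jacobi : ∀ f g h,
    bracket f (bracket g h) + bracket g (bracket h f) + bracket h (bracket f g) = 0

/-- The set `s` generates the Poisson algebra: the only `ℂ`-subalgebra that contains `s` and is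
closed under the bracket is the whole algebra. -/
def PoissonBracket.IsGeneratedBy {A₀ : Type v} [CommRing A₀] [Algebra ℂ A₀]
    (P : PoissonBracket A₀) (s : Set A₀) : Prop :=
  ∀ B : Subalgebra ℂ A₀, s ⊆ B → (∀ f ∈ B, ∀ g ∈ B, P.bracket f g ∈ B) → B = ⊤

namespace GCM

variable {I : Type u} (A : GCM I) {A₀ : Type v} [CommRing A₀]

/-- The field of fractions of `A₀[λ] = A₀[λ i (i ∈ I)]`. -/
abbrev FunctionField (_A : GCM I) (A₀ : Type v) [CommRing A₀] : Type (max u v) :=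
  FractionRing (MvPolynomial I A₀)

/-- The element `φ i` of the function field. -/
noncomputable def phiK (φ : I → A₀) (i : I) : A.FunctionField A₀ :=
  algebraMap (MvPolynomial I A₀) (A.FunctionField A₀) (MvPolynomial.C (φ i))

/-- The `A₀`-linear endomorphism `r i` of `A₀[λ]`, with `r i (λ j) = λ j - a j i λ i`. -/
noncomputable def lambdaReflection (A₀ : Type v) [CommRing A₀] (i : I) :
    MvPolynomial I A₀ →ₐ[A₀] MvPolynomial I A₀ :=
  MvPolynomial.aeval fun j => MvPolynomial.X j - A.a j i • MvPolynomial.X i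

/-- The map `{f, ·}` on `A₀[λ]`, for `f` in `A₀` and the extension of the Poisson bracket with
`{f, λ i} = 0`: it acts on the coefficients. -/
noncomputable def adPoly [Algebra ℂ A₀] (P : PoissonBracket A₀) (f : A₀) (p : MvPolynomial I A₀) :
    MvPolynomial I A₀ :=
  ∑ m ∈ p.support, MvPolynomial.monomial m (P.bracket f (p.coeff m))

variable [IsDomain A₀] [Algebra ℂ A₀]

/-- `s i` is an automorphism of the field of fractions of `A₀[λ]` which on `A₀[λ]` is given by
`exp ((λ i / φ i) {φ i, ·}) ∘ r i`; for each element of `A₀[λ]` the exponential series is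
required to terminate. -/
def IsBirationalReflection (P : PoissonBracket A₀) (φ : I → A₀)
    (s : I → (A.FunctionField A₀ ≃ₐ[ℂ] A.FunctionField A₀)) : Prop :=
  ∀ (i : I) (p : MvPolynomial I A₀), ∃ N : ℕ,
    (adPoly P (φ i))^[N] (A.lambdaReflection A₀ i p) = 0 ∧
    s i (algebraMap (MvPolynomial I A₀) (A.FunctionField A₀) p) =
      ∑ n ∈ Finset.range N, ((n.factorial : A.FunctionField A₀))⁻¹ *
        (algebraMap (MvPolynomial I A₀) (A.FunctionField A₀) (MvPolynomial.X i) /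
          A.phiK φ i) ^ n *
        algebraMap (MvPolynomial I A₀) (A.FunctionField A₀)
          ((adPoly P (φ i))^[n] (A.lambdaReflection A₀ i p))

/-- The Laurent polynomial ring `K[τ^{±1}]` over the field `K` of fractions of `A₀[λ]`, as the ring
of exponents in `I →₀ ℤ`. -/
abbrev LaurentRing (A : GCM I) (A₀ : Type v) [CommRing A₀] [IsDomain A₀] : Type (max u v) :=
  AddMonoidAlgebra (A.FunctionField A₀) (I →₀ ℤ)

/-- The variable `τ i`, a unit of the Laurent polynomial ring. -/
noncomputable def tau (A₀ : Type v) [CommRing A₀] [IsDomain A₀] (i : I) : (A.LaurentRing A₀)ˣ where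
  val := AddMonoidAlgebra.single (Finsupp.single i 1) 1
  inv := AddMonoidAlgebra.single (Finsupp.single i (-1)) 1
  val_inv := by
    rw [AddMonoidAlgebra.single_mul_single, ← Finsupp.single_add]
    simp [AddMonoidAlgebra.one_def]
  inv_val := by
    rw [AddMonoidAlgebra.single_mul_single, ← Finsupp.single_add]
    simp [AddMonoidAlgebra.one_def]

/-- The formal exponential `τ^Λ = ∏ i, τ i ^ ⟨h i, Λ⟩`. -/
noncomputable def tauPow (A₀ : Type v) [CommRing A₀] [IsDomain A₀] (l : A.WeightLattice) :
    (A.LaurentRing A₀)ˣ :=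
  l.prod fun i n => A.tau A₀ i ^ n

/-- `S i` is an automorphism of `K[τ^{±1}]` which extends `s i`, fixes `τ j` for `j ≠ i`, and maps
`τ i` to `φ i * τ i * ∏ k, τ k ^ (- a k i)`. (The product has finitely many factors `≠ 1`, the
`k` with `a k i ≠ 0`.) -/
def IsTauExtension (φ : I → A₀) (s : I → (A.FunctionField A₀ ≃ₐ[ℂ] A.FunctionField A₀))
    (S : I → (A.LaurentRing A₀ ≃ₐ[ℂ] A.LaurentRing A₀)) : Prop :=
  ∀ i : I,
    (∀ x, S i (algebraMap (A.FunctionField A₀) (A.LaurentRing A₀) x) =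
      algebraMap (A.FunctionField A₀) (A.LaurentRing A₀) (s i x)) ∧
    (∀ j, j ≠ i → S i (A.tau A₀ j) = A.tau A₀ j) ∧
    S i (A.tau A₀ i) =
      algebraMap (A.FunctionField A₀) (A.LaurentRing A₀) (A.phiK φ i) * A.tau A₀ i *
        ((∏ k ∈ (A.column_finite i).toFinset, A.tau A₀ k ^ (-A.a k i) : (A.LaurentRing A₀)ˣ) :
          A.LaurentRing A₀)

/-- The defining conditions of the `τ`-cocycle, for an action `σ` of the Weyl group on `K`:
`c w` is a homomorphism from `L` to the multiplicative group of `K`, with the given values for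
`w = 1` and `w = r i`, and `c` is a `1`-cocycle. -/
structure IsTauCocycle (φ : I → A₀)
    (σ : A.WeylGroup →* (A.FunctionField A₀ ≃ₐ[ℂ] A.FunctionField A₀))
    (c : A.WeylGroup → A.WeightLattice → A.FunctionField A₀) : Prop where
  ne_zero : ∀ w l, c w l ≠ 0
  add : ∀ w l l', c w (l + l') = c w l * c w l'
  one : ∀ l, c 1 l = 1
  simple : ∀ i l, c (A.r i) l = A.phiK φ i ^ (l i)
  mul : ∀ w w' l, c (w * w') l = σ w (c w' l) * c w (A.weylAction w' l)

end GCM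

/-!
On `A₀`, a composite of the birational reflections `s i` is a product of exponentials
`exp (u · {φ i, ·})`, in the order of the word, with parameters `u` in the function field that
are treated as constants (`wordPoly`, `wordParams`). The product of the corresponding power
series `exp (u z D)` solves a differential equation `z dV/dz = L V` with `L` in the span of the
iterated brackets of the derivations, so whether it is trivial depends only on the linear
relations between these brackets (`PowerSeries.prod_expMul_eq_one`). For two indices joined by
at most three edges, the Serre relations bound that span by the nilpotent Lie algebra of type
`A₂`, `B₂` or `G₂`. A braid relation may hence be checked for the root vectors in one small
matrix representation (`prod_expMul_eq_one_of_serre`).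

There it holds without any computation of the parameters. A lower triangular Lax matrix `X`,
with combinations of the `λ i` on its diagonal and the `φ i` and their brackets below, satisfies
`s i (X) = g X g⁻¹` for `g = exp (λ i / φ i · e i)`. Hence a composite `w` of reflections
satisfies `w (X) g = g X` with `g` upper unitriangular, and if `w` fixes all `λ i`, then `w (X)`
and `X` are lower triangular with the same distinct diagonal entries, which forces `g = 1`
(`LaxMatrix.prod_apply_eq_self`).

The extended reflections map monomials to monomials, `τ^Λ` to `φ i ^ ⟨h i, Λ⟩ τ^(r i Λ)`. For
the short index `i`, the braid relation on `τ i` amounts to the invariance of a product of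
images of the `φ i`, or equivalently of the images of the parameters `λ i / φ i`, under one
reflection. This last product is, up to a constant, the upper right corner entry of such a
matrix `g`, and it is invariant because the first row of `g` is a left eigenvector of `X` for
the last diagonal entry (`LaxMatrix.corner_invariant`). The relation on `τ j` follows since
`s i (τ i)` has degree one in `τ j`.

The exponential of the locally nilpotent derivation `{φ i, ·}` is an injective homomorphism on
`A₀[λ]`, since a leading term survives (`GCM.expK_injective`); so `s i` extends to the field of
fractions. Finally, the coefficients in `w (τ^Λ) = c · τ^(w Λ)` are unique, and both directions
of their characterization as a cocycle are inductions on the length of `w`.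
-/

/-! ### Exponential series over a noncommutative ring -/

open PowerSeries in
/-- The Euler operator `z d/dz` on power series over a ring that need not be commutative. -/
noncomputable def PowerSeries.euler {B : Type*} [Ring B] (F : B⟦X⟧) : B⟦X⟧ :=
  PowerSeries.mk fun n => (n : B) * coeff n F

/-- The power series `exp (u z e)` in the variable `z`, for `e` in an algebra over a field of
characteristic zero and a scalar `u`. -/
noncomputable def PowerSeries.expMul {K B : Type*} [Field K] [Ring B] [Algebra K B] (u : K)
    (e : B) : PowerSeries B :=
  PowerSeries.mk fun n => (u ^ n / (n.factorial : K)) • e ^ n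

namespace PowerSeries

section Euler

variable {B : Type*} [Ring B]

@[simp] theorem coeff_euler (F : B⟦X⟧) (n : ℕ) : coeff n (euler F) = (n : B) * coeff n F := by
  simp [euler]

theorem euler_mul (F G : B⟦X⟧) : euler (F * G) = euler F * G + F * euler G := by
  ext n
  simp only [coeff_euler, coeff_mul, map_add, Finset.mul_sum, ← Finset.sum_add_distrib]
  refine Finset.sum_congr rfl fun p hp => ?_
  rw [← Finset.HasAntidiagonal.mem_antidiagonal.1 hp, Nat.cast_add, ← mul_assoc (coeff p.1 F),
    ← (Nat.cast_commute p.2 (coeff p.1 F)).eq]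
  noncomm_ring

@[simp] theorem euler_C (b : B) : euler (C b) = 0 := by
  ext n
  rcases n with _ | n <;> simp [coeff_C]

@[simp] theorem euler_one : euler (1 : B⟦X⟧) = 0 := by
  rw [← map_one (C (R := B)), euler_C]

end Euler

section ExpMul

variable {K B : Type*} [Field K] [Ring B] [Algebra K B]

@[simp] theorem coeff_expMul (u : K) (e : B) (n : ℕ) :
    coeff n (expMul u e) = (u ^ n / (n.factorial : K)) • e ^ n := by
  simp [expMul]

theorem X_mul_C_mul_expMul (u : K) (e : B) :
    X * C (u • e) * expMul u e = expMul u e * (X * C (u • e)) := by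
  ext n
  rcases n with _ | n
  · simp [mul_assoc]
  · rw [mul_assoc, coeff_succ_X_mul, coeff_C_mul, ← mul_assoc, (commute_X (expMul u e)).eq,
      mul_assoc, coeff_succ_X_mul, coeff_mul_C, coeff_expMul]
    simp only [smul_mul_smul_comm, ← pow_succ, ← pow_succ', mul_comm u]

variable [CharZero K]

theorem eq_C_of_euler_eq_zero (K : Type*) {B : Type*} [Field K] [CharZero K] [Ring B]
    [Algebra K B] {F : B⟦X⟧} (h : euler F = 0) : F = C (coeff 0 F) := by
  ext n
  rcases n with _ | n
  · simp
  · have := congrArg (coeff (n + 1)) h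
    rw [coeff_euler, map_zero, ← nsmul_eq_mul, ← Nat.cast_smul_eq_nsmul K, smul_eq_zero] at this
    rw [coeff_C, if_neg n.succ_ne_zero]
    exact this.resolve_left (Nat.cast_ne_zero.2 n.succ_ne_zero)

theorem euler_expMul (u : K) (e : B) :
    euler (expMul u e) = X * C (u • e) * expMul u e := by
  ext n
  rcases n with _ | n
  · simp [mul_assoc]
  · rw [coeff_euler, mul_assoc, coeff_succ_X_mul, coeff_C_mul, coeff_expMul, coeff_expMul,
      ← nsmul_eq_mul, ← Nat.cast_smul_eq_nsmul K, smul_smul, smul_mul_smul_comm, ← pow_succ']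
    congr 1
    rw [Nat.factorial_succ, Nat.cast_mul]
    have h1 : ((n + 1 : ℕ) : K) ≠ 0 := Nat.cast_ne_zero.2 n.succ_ne_zero
    have h2 : ((n.factorial : ℕ) : K) ≠ 0 := Nat.cast_ne_zero.2 n.factorial_ne_zero
    field_simp
    ring

theorem expMul_mul_expMul_neg (u : K) (e : B) : expMul u e * expMul (-u) e = 1 := by
  have h : euler (expMul u e * expMul (-u) e) = 0 := by
    rw [euler_mul, euler_expMul, euler_expMul, X_mul_C_mul_expMul, neg_smul, map_neg]
    noncomm_ring
  rw [eq_C_of_euler_eq_zero K h]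
  simp [coeff_mul]

/-- `exp (u z e)` as a unit. -/
noncomputable def expMulUnit (u : K) (e : B) : (B⟦X⟧)ˣ where
  val := expMul u e
  inv := expMul (-u) e
  val_inv := expMul_mul_expMul_neg u e
  inv_val := by simpa using expMul_mul_expMul_neg (-u) e

/-- A subspace `S` closed under commutators is stable under conjugation by a solution `V` of a
linear differential equation `z dV/dz = L V` whose coefficients lie in `S`: the conjugate `Z` of an
element of `S` solves `z dZ/dz = [L, Z]`, which determines its coefficients recursively. -/
theorem coeff_conj_mem (S : Submodule K B)
    (hS : ∀ x ∈ S, ∀ y ∈ S, x * y - y * x ∈ S) (V : (B⟦X⟧)ˣ) (L : B⟦X⟧)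
    (hL : ∀ n, coeff n L ∈ S) (hL0 : coeff 0 L = 0)
    (hV0 : coeff 0 (V : B⟦X⟧) = 1)
    (hV : euler (V : B⟦X⟧) = L * V) {y : B} (hy : y ∈ S) (n : ℕ) :
    coeff n ((V : B⟦X⟧) * C y * (↑V⁻¹ : B⟦X⟧)) ∈ S := by
  obtain ⟨Z, hZ⟩ : ∃ Z, Z = (V : B⟦X⟧) * C y * (↑V⁻¹ : B⟦X⟧) := ⟨_, rfl⟩
  rw [← hZ]
  have hinv : euler (↑V⁻¹ : B⟦X⟧) = -(↑V⁻¹ : B⟦X⟧) * L := by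
    have h : euler ((V : B⟦X⟧) * (↑V⁻¹ : B⟦X⟧)) = 0 := by rw [V.mul_inv, euler_one]
    rw [euler_mul, hV, mul_assoc, V.mul_inv, mul_one] at h
    have h' := congrArg (fun F => (↑V⁻¹ : B⟦X⟧) * F) h
    simp only [mul_add, mul_zero, ← mul_assoc, V.inv_mul, one_mul] at h'
    rw [neg_mul]
    exact eq_neg_of_add_eq_zero_right h'
  have hθ : euler Z = L * Z - Z * L := by
    rw [hZ, euler_mul, euler_mul, euler_C, hV, hinv]
    noncomm_ring
  have hV0' : coeff 0 (↑V⁻¹ : B⟦X⟧) = 1 := by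
    have h := congrArg (coeff 0) V.mul_inv
    rw [coeff_mul, Finset.Nat.antidiagonal_zero, Finset.sum_singleton, hV0, one_mul] at h
    simpa using h
  induction n using Nat.strong_induction_on with
  | _ n ih =>
    rcases n with _ | n
    · have : coeff 0 Z = y := by
        rw [hZ, coeff_mul, Finset.Nat.antidiagonal_zero, Finset.sum_singleton, coeff_mul_C,
          hV0, hV0', one_mul, mul_one]
      rwa [this]
    · have h := congrArg (coeff (n + 1)) hθ
      rw [coeff_euler, map_sub, coeff_mul, coeff_mul,
        ← Finset.Nat.sum_antidiagonal_swap (f := fun p => coeff p.1 Z * coeff p.2 L),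
        ← Finset.sum_sub_distrib, ← nsmul_eq_mul, ← Nat.cast_smul_eq_nsmul K] at h
      have h1 : ((n + 1 : ℕ) : K) ≠ 0 := Nat.cast_ne_zero.2 n.succ_ne_zero
      rw [← inv_smul_smul₀ h1 (coeff (n + 1) Z), h]
      refine S.smul_mem _ (sum_mem fun p hp => ?_)
      rcases Nat.eq_zero_or_pos p.1 with h0 | h0
      · simp [h0, hL0]
      · rw [Prod.fst_swap, Prod.snd_swap]
        have := Finset.HasAntidiagonal.mem_antidiagonal.1 hp
        exact hS _ (hL _) _ (ih _ (by omega))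

/-- A product of exponentials of elements of a subspace `S` closed under commutators solves a
differential equation `z dV/dz = L V` with coefficients in `S`. -/
theorem exists_euler_prod_expMul (S : Submodule K B)
    (hS : ∀ x ∈ S, ∀ y ∈ S, x * y - y * x ∈ S) (l : List (K × B))
    (hl : ∀ p ∈ l, p.2 ∈ S) :
    ∃ V : (B⟦X⟧)ˣ, (V : B⟦X⟧) = (l.map fun p => expMul p.1 p.2).prod ∧
      coeff 0 (V : B⟦X⟧) = 1 ∧
      ∃ L : B⟦X⟧, (∀ n, coeff n L ∈ S) ∧ coeff 0 L = 0 ∧ euler (V : B⟦X⟧) = L * V := by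
  induction l using List.reverseRecOn with
  | nil => exact ⟨1, by simp, by simp, 0, by simp, by simp, by simp⟩
  | append_singleton l p ih =>
    obtain ⟨V, hVl, hV0, L, hL, hL0, hV⟩ := ih fun q hq => hl q (by simp [hq])
    have hp : p.1 • p.2 ∈ S := S.smul_mem _ (hl p (by simp))
    refine ⟨V * expMulUnit p.1 p.2, ?_, ?_,
      L + X * ((V : B⟦X⟧) * C (p.1 • p.2) * (↑V⁻¹ : B⟦X⟧)), ?_, ?_, ?_⟩
    · rw [Units.val_mul, hVl, List.map_append, List.prod_append]
      simp [expMulUnit]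
    · rw [Units.val_mul, coeff_mul, Finset.Nat.antidiagonal_zero, Finset.sum_singleton, hV0]
      simp [expMulUnit]
    · intro n
      rw [map_add]
      refine S.add_mem (hL n) ?_
      rcases n with _ | n
      · simp
      · rw [coeff_succ_X_mul]
        exact coeff_conj_mem S hS V L hL hL0 hV0 hV hp n
    · rw [map_add, hL0, coeff_zero_X_mul, add_zero]
    · rw [Units.val_mul, euler_mul, hV]
      change _ + (V : B⟦X⟧) * euler (expMul p.1 p.2) = _ * ((V : B⟦X⟧) * expMul p.1 p.2)
      rw [euler_expMul, add_mul, mul_assoc L]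
      congr 1
      have hX := (commute_X (V : B⟦X⟧)).eq
      calc (V : B⟦X⟧) * (X * C (p.1 • p.2) * expMul p.1 p.2)
          = ((V : B⟦X⟧) * X) * (C (p.1 • p.2) * expMul p.1 p.2) := by noncomm_ring
        _ = X * (V : B⟦X⟧) * C (p.1 • p.2) * ((↑V⁻¹ : B⟦X⟧) * (V : B⟦X⟧)) * expMul p.1 p.2 := by
            rw [hX, V.inv_mul]; noncomm_ring
        _ = _ := by noncomm_ring

theorem map_prod_expMul {K B B' : Type*} [Field K] [Ring B] [Algebra K B] [Ring B'] [Algebra K B']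
    (π : B →ₐ[K] B') (l : List (K × B)) :
    map (π : B →+* B') (l.map fun p => expMul p.1 p.2).prod =
      (l.map fun p => expMul p.1 (π p.2)).prod := by
  rw [map_list_prod, List.map_map]
  congr 1
  refine List.map_congr_left fun p _ => ?_
  ext n
  simp

/-- A relation between exponentials of elements of a subspace `S` closed under commutators can be
checked in any algebra to which `S` maps injectively. -/
theorem prod_expMul_eq_one {B' : Type*} [Ring B'] [Algebra K B'] (π : B →ₐ[K] B')
    (S : Submodule K B) (hS : ∀ x ∈ S, ∀ y ∈ S, x * y - y * x ∈ S)
    (hπ : ∀ x ∈ S, π x = 0 → x = 0) (l : List (K × B))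
    (hl : ∀ p ∈ l, p.2 ∈ S) (h : (l.map fun p => expMul p.1 (π p.2)).prod = 1) :
    (l.map fun p => expMul p.1 p.2).prod = 1 := by
  obtain ⟨V, hVl, hV0, L, hL, -, hV⟩ := exists_euler_prod_expMul S hS l hl
  have hmap : map (π : B →+* B') (V : B⟦X⟧) = 1 := by rw [hVl, map_prod_expMul, h]
  have heul : ∀ F : B⟦X⟧, map (π : B →+* B') (euler F) = euler (map (π : B →+* B') F) := by
    intro F
    ext n
    simp
  have hL0 : L = 0 := by
    have h1 := congrArg (map (π : B →+* B')) hV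
    rw [heul, hmap, euler_one, map_mul, hmap, mul_one] at h1
    ext n
    refine hπ _ (hL n) ?_
    simpa using (congrArg (coeff n) h1).symm
  rw [hL0, zero_mul] at hV
  rw [← hVl, eq_C_of_euler_eq_zero K hV, hV0, map_one]

end ExpMul

end PowerSeries

/-! ### Serre relations of rank two, and unitriangular matrices -/

section Serre

variable {k V : Type*} [Field k] [AddCommGroup V] [Module k V]

/-- The elements of an associative algebra which, together with their commutators with a subspace
`S`, lie in `S`; a subspace closed under commutators by the Jacobi identity. -/
def commutatorCore {B : Type*} [Ring B] [Algebra k B] (S : Submodule k B) : Submodule k B where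
  carrier := {x | x ∈ S ∧ ∀ y ∈ S, x * y - y * x ∈ S}
  zero_mem' := ⟨S.zero_mem, fun y _ => by simp⟩
  add_mem' {a b} ha hb := ⟨S.add_mem ha.1 hb.1, fun y hy => by
    have : (a + b) * y - y * (a + b) = (a * y - y * a) + (b * y - y * b) := by noncomm_ring
    rw [this]
    exact S.add_mem (ha.2 y hy) (hb.2 y hy)⟩
  smul_mem' c a ha := ⟨S.smul_mem c ha.1, fun y hy => by
    rw [smul_mul_assoc, mul_smul_comm, ← smul_sub]
    exact S.smul_mem c (ha.2 y hy)⟩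

theorem commutatorCore_closed {B : Type*} [Ring B] [Algebra k B] (S : Submodule k B) :
    ∀ x ∈ commutatorCore S, ∀ y ∈ commutatorCore S, x * y - y * x ∈ commutatorCore S := by
  intro x hx y hy
  refine ⟨hx.2 y hy.1, fun z hz => ?_⟩
  have : (x * y - y * x) * z - z * (x * y - y * x) =
      (x * (y * z - z * y) - (y * z - z * y) * x) -
        (y * (x * z - z * x) - (x * z - z * x) * y) := by noncomm_ring
  rw [this]
  exact S.sub_mem (hx.2 _ (hy.2 z hz)) (hy.2 _ (hx.2 z hz))

/-- The commutator of an associative algebra, as a bilinear map. -/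
def commutator₂ (k B : Type*) [Field k] [Ring B] [Algebra k B] : B →ₗ[k] B →ₗ[k] B :=
  LinearMap.mul k B - (LinearMap.mul k B).flip

theorem commutator₂_apply {B : Type*} [Ring B] [Algebra k B] (x y : B) :
    commutator₂ k B x y = x * y - y * x := rfl

theorem commutator₂_skew {B : Type*} [Ring B] [Algebra k B] (x y : B) :
    commutator₂ k B x y = -commutator₂ k B y x := by
  simp [commutator₂_apply]

theorem commutator₂_jacobi {B : Type*} [Ring B] [Algebra k B] (x y z : B) :
    commutator₂ k B x (commutator₂ k B y z) =
      commutator₂ k B (commutator₂ k B x y) z + commutator₂ k B y (commutator₂ k B x z) := by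
  simp only [commutator₂_apply]
  noncomm_ring

/-- Two elements `e` and `f` of an associative algebra satisfy the Serre relations of type `G₂`,
with `e` for the short simple root. -/
def IsSerrePair (k : Type*) {B : Type*} [Field k] [Ring B] [Algebra k B] (e f : B) : Prop :=
  let β := commutator₂ k B
  β f (β f e) = 0 ∧ β e (β e (β e (β e f))) = 0

theorem IsSerrePair.prodMk {B₁ B₂ : Type*} [Ring B₁] [Algebra k B₁] [Ring B₂] [Algebra k B₂]
    {e₁ f₁ : B₁} {e₂ f₂ : B₂} (h₁ : IsSerrePair k e₁ f₁) (h₂ : IsSerrePair k e₂ f₂) :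
    IsSerrePair k (e₁, e₂) (f₁, f₂) :=
  ⟨Prod.ext h₁.1 h₂.1, Prod.ext h₁.2 h₂.2⟩

/-- The linear span of the root vectors of the positive part of a Lie algebra of type `G₂`. -/
def serreSpan {B : Type*} [Ring B] [Algebra k B] (e f : B) : Submodule k B :=
  let β := commutator₂ k B
  Submodule.span k {e, f, β e f, β e (β e f), β e (β e (β e f)), β f (β e (β e (β e f)))}

/-- A linear combination of the six spanning vectors of `serreSpan`. -/
def serreComb {B : Type*} [Ring B] [Algebra k B] (c : Fin 6 → k) (e f : B) : B :=
  let β := commutator₂ k B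
  c 0 • e + c 1 • f + c 2 • β e f + c 3 • β e (β e f) + c 4 • β e (β e (β e f)) +
    c 5 • β f (β e (β e (β e f)))

theorem map_commutator₂ {B B' : Type*} [Ring B] [Algebra k B] [Ring B'] [Algebra k B']
    (π : B →ₐ[k] B') (x y : B) :
    π (commutator₂ k B x y) = commutator₂ k B' (π x) (π y) := by
  simp [commutator₂_apply]

theorem map_serreComb {B B' : Type*} [Ring B] [Algebra k B] [Ring B'] [Algebra k B']
    (π : B →ₐ[k] B') (c : Fin 6 → k) (e f : B) :
    π (serreComb c e f) = serreComb c (π e) (π f) := by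
  simp only [serreComb, map_add, map_smul, map_commutator₂]

theorem exists_of_mem_serreSpan {B : Type*} [Ring B] [Algebra k B] {e f x : B}
    (hx : x ∈ serreSpan (k := k) e f) : ∃ c : Fin 6 → k, x = serreComb c e f := by
  simp only [serreSpan, Submodule.mem_span_insert, Submodule.mem_span_singleton] at hx
  obtain ⟨c0, _, ⟨c1, _, ⟨c2, _, ⟨c3, _, ⟨c4, _, ⟨c5, rfl⟩, rfl⟩, rfl⟩, rfl⟩, rfl⟩, rfl⟩ := hx
  refine ⟨![c0, c1, c2, c3, c4, c5], ?_⟩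
  simp [serreComb, add_assoc]

variable [CharZero k]

/-- In a Lie algebra, given by a bilinear bracket `β`, let `e` and `f` satisfy the Serre relations
`ad(f)² e = 0` and `ad(e)⁴ f = 0` of type `G₂`. Then `e`, `f`, `[e,f]`, `[e,[e,f]]`,
`[e,[e,[e,f]]]` and `[f,[e,[e,[e,f]]]]` span a subspace that is stable under `ad(e)` and
`ad(f)`: the brackets that are not already in this list vanish. -/
theorem bracket_eq_zero_of_serre (β : V →ₗ[k] V →ₗ[k] V) (hskew : ∀ x y, β x y = -β y x)
    (hjac : ∀ x y z, β x (β y z) = β (β x y) z + β y (β x z)) {e f : V}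
    (hf : β f (β f e) = 0) (he : β e (β e (β e (β e f))) = 0) :
    β f (β e f) = 0 ∧ β f (β e (β e f)) = 0 ∧ β e (β f (β e (β e (β e f)))) = 0 ∧
      β f (β f (β e (β e (β e f)))) = 0 := by
  have h2 : ∀ x : V, x = -x → x = 0 := fun x hx => by
    have h : (2 : k) • x = 0 := by rw [two_smul]; nth_rewrite 1 [hx]; exact neg_add_cancel x
    exact (smul_eq_zero.1 h).resolve_left two_ne_zero
  have halt : ∀ x, β x x = 0 := fun x => h2 _ (hskew x x)
  have h1 : β f (β e f) = 0 := by rw [hskew e f, map_neg, hf, neg_zero]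
  have hfe : β f e = -β e f := hskew f e
  have h3 : β f (β e (β e f)) = 0 := by
    rw [hjac f e, h1, hfe, map_zero, map_neg, LinearMap.neg_apply, halt]
    simp
  have h5 : β f (β e (β e (β e f))) = -β (β e f) (β e (β e f)) := by
    rw [hjac f e, h3, hfe, map_zero, map_neg, LinearMap.neg_apply, add_zero]
  refine ⟨h1, h3, h2 _ ?_, ?_⟩
  · have ha : β e (β f (β e (β e (β e f)))) = β (β e f) (β e (β e (β e f))) := by
      rw [hjac e f, he, map_zero, add_zero]
    have hb : β e (β f (β e (β e (β e f)))) = -β (β e f) (β e (β e (β e f))) := by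
      rw [h5, map_neg, hjac e (β e f), halt, zero_add]
    rw [← ha] at hb
    exact hb
  · rw [h5, map_neg, hjac f (β e f), h1, h3]
    simp

theorem mem_commutatorCore_serreSpan {B : Type*} [Ring B] [Algebra k B] {e f : B}
    (h : IsSerrePair k e f) :
    e ∈ commutatorCore (serreSpan (k := k) e f) ∧ f ∈ commutatorCore (serreSpan (k := k) e f) := by
  obtain ⟨h1, h2, h3, h4⟩ := bracket_eq_zero_of_serre (commutator₂ k B) commutator₂_skew
    commutator₂_jacobi h.1 h.2
  have hmem : ∀ y ∈ ({e, f, commutator₂ k B e f, commutator₂ k B e (commutator₂ k B e f),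
      commutator₂ k B e (commutator₂ k B e (commutator₂ k B e f)),
      commutator₂ k B f (commutator₂ k B e (commutator₂ k B e (commutator₂ k B e f)))} : Set B),
      y ∈ serreSpan (k := k) e f := fun y hy => Submodule.subset_span hy
  have key : ∀ x : B, (serreSpan (k := k) e f) ≤
      (serreSpan (k := k) e f).comap (commutator₂ k B x) ↔ ∀ y ∈ serreSpan (k := k) e f,
      x * y - y * x ∈ serreSpan (k := k) e f := fun x => Iff.rfl
  refine ⟨⟨hmem _ (by simp), (key e).1 ?_⟩, ⟨hmem _ (by simp), (key f).1 ?_⟩⟩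
  · refine Submodule.span_le.2 ?_
    rintro y (rfl | rfl | rfl | rfl | rfl | rfl) <;>
      simp only [SetLike.mem_coe, Submodule.mem_comap]
    · simp [commutator₂_apply]
    · exact hmem _ (by simp)
    · exact hmem _ (by simp)
    · exact hmem _ (by simp)
    · rw [h.2]; exact Submodule.zero_mem _
    · rw [h3]; exact Submodule.zero_mem _
  · refine Submodule.span_le.2 ?_
    rintro y (rfl | rfl | rfl | rfl | rfl | rfl) <;>
      simp only [SetLike.mem_coe, Submodule.mem_comap]
    · rw [commutator₂_skew]; exact Submodule.neg_mem _ (hmem _ (by simp))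
    · simp [commutator₂_apply]
    · rw [h1]; exact Submodule.zero_mem _
    · rw [h2]; exact Submodule.zero_mem _
    · exact hmem _ (by simp)
    · rw [h4]; exact Submodule.zero_mem _

/-- A relation between exponentials of elements `e` and `f` that satisfy the Serre relations of
type `G₂` carries over from one algebra to another one if all linear relations between the six
root vectors do. -/
theorem prod_expMul_eq_one_of_serre {B₁ B₂ : Type*} [Ring B₁] [Algebra k B₁] [Ring B₂]
    [Algebra k B₂] (d₁ : Bool → B₁) (d₂ : Bool → B₂)
    (h₁ : IsSerrePair k (d₁ true) (d₁ false)) (h₂ : IsSerrePair k (d₂ true) (d₂ false))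
    (hc : ∀ c : Fin 6 → k, serreComb c (d₁ true) (d₁ false) = 0 →
      serreComb c (d₂ true) (d₂ false) = 0) (l : List (k × Bool))
    (hl : (l.map fun p => PowerSeries.expMul p.1 (d₁ p.2)).prod = 1) :
    (l.map fun p => PowerSeries.expMul p.1 (d₂ p.2)).prod = 1 := by
  let π₁ : B₁ × B₂ →ₐ[k] B₁ := AlgHom.fst k _ _
  let π₂ : B₁ × B₂ →ₐ[k] B₂ := AlgHom.snd k _ _
  let p : Bool → B₁ × B₂ := fun j => (d₁ j, d₂ j)
  have hext : ∀ x : B₁ × B₂, π₁ x = 0 → π₂ x = 0 → x = 0 := fun x h1 h2 => Prod.ext h1 h2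
  obtain ⟨he, hf⟩ := mem_commutatorCore_serreSpan (h₁.prodMk h₂)
  have key := PowerSeries.prod_expMul_eq_one π₁
    (commutatorCore (serreSpan (k := k) (p true) (p false))) (commutatorCore_closed _)
    (fun x hx h0 => by
      obtain ⟨c, rfl⟩ := exists_of_mem_serreSpan hx.1
      refine hext _ h0 ?_
      rw [map_serreComb] at h0 ⊢
      exact hc c h0)
    (l.map fun q => (q.1, p q.2)) (by
      simp only [List.mem_map]
      rintro _ ⟨⟨u, j⟩, -, rfl⟩
      cases j
      · exact hf
      · exact he) (by
      rw [List.map_map]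
      exact hl)
  have h2 := congrArg (PowerSeries.map (π₂ : B₁ × B₂ →+* B₂)) key
  rw [PowerSeries.map_prod_expMul, List.map_map, map_one] at h2
  exact h2

end Serre

namespace Matrix

variable {K : Type*} [Field K] {N : ℕ}

/-- An upper unitriangular matrix that intertwines two lower triangular matrices with the same
diagonal is the identity if the diagonal entries are distinct: the entries above the diagonal
vanish by descending induction on the distance to the diagonal. -/
theorem eq_one_of_intertwines_lower {G X Y : Matrix (Fin N) (Fin N) K}
    (hG : ∀ i j, j < i → G i j = 0) (hG1 : ∀ i, G i i = 1)
    (hX : ∀ i j, i < j → X i j = 0) (hY : ∀ i j, i < j → Y i j = 0)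
    (hXY : ∀ i, X i i = Y i i) (hinj : ∀ i j, i < j → X i i ≠ X j j) (h : G * X = Y * G) :
    G = 1 := by
  have key : ∀ n : ℕ, ∀ i j : Fin N, i < j → N - (j - i : ℕ) = n → G i j = 0 := by
    intro n
    induction n using Nat.strong_induction_on with
    | _ n ih =>
      intro i j hij hn
      have hzero : ∀ p q : Fin N, p < q → (j - i : ℕ) < (q - p : ℕ) → G p q = 0 := by
        intro p q hpq hlt
        have := q.2
        exact ih (N - (q - p : ℕ)) (by omega) p q hpq rfl
      have h1 : (G * X) i j = G i j * X j j := by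
        rw [Matrix.mul_apply]
        refine Finset.sum_eq_single j (fun p _ hp => ?_) (by simp)
        rcases lt_or_gt_of_ne hp with hp | hp
        · rw [hX p j hp, mul_zero]
        · rw [hzero i p (hij.trans hp) (by simp only [Fin.lt_def] at *; omega), zero_mul]
      have h2 : (Y * G) i j = Y i i * G i j := by
        rw [Matrix.mul_apply]
        refine Finset.sum_eq_single i (fun p _ hp => ?_) (by simp)
        rcases lt_or_gt_of_ne hp with hp | hp
        · rw [hzero p j (hp.trans hij) (by simp only [Fin.lt_def] at *; omega), mul_zero]
        · rw [hY i p hp, zero_mul]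
      have h3 : G i j * (X j j - X i i) = 0 := by
        rw [mul_sub, ← h1, h, h2, hXY i]
        ring
      exact (mul_eq_zero.1 h3).resolve_right (sub_ne_zero.2 (hinj i j hij).symm)
  ext i j
  rcases lt_trichotomy i j with hij | rfl | hij
  · rw [key _ i j hij rfl, one_apply_ne hij.ne]
  · rw [hG1, one_apply_eq]
  · rw [hG i j hij, one_apply_ne hij.ne']

/-- A left eigenvector of a lower triangular matrix for its last diagonal entry vanishes if its
last coordinate does and the last diagonal entry differs from the others. -/
theorem eq_zero_of_vecMul_eq_last {X : Matrix (Fin (N + 1)) (Fin (N + 1)) K}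
    (hX : ∀ i j, i < j → X i j = 0)
    (hlast : ∀ i, i ≠ Fin.last N → X i i ≠ X (Fin.last N) (Fin.last N))
    {v : Fin (N + 1) → K} (hv : v ᵥ* X = X (Fin.last N) (Fin.last N) • v)
    (h0 : v (Fin.last N) = 0) : v = 0 := by
  have key : ∀ n : ℕ, ∀ i : Fin (N + 1), N - (i : ℕ) = n → v i = 0 := by
    intro n
    induction n using Nat.strong_induction_on with
    | _ n ih =>
      intro i hn
      by_cases hi : i = Fin.last N
      · rw [hi, h0]
      have h1 : (v ᵥ* X) i = v i * X i i := by
        rw [Matrix.vecMul, dotProduct]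
        refine Finset.sum_eq_single i (fun p _ hp => ?_) (by simp)
        rcases lt_or_gt_of_ne hp with hp | hp
        · rw [hX p i hp, mul_zero]
        · rw [ih (N - (p : ℕ)) (by simp only [Fin.lt_def] at *; have := p.2; omega) p rfl, zero_mul]
      rw [hv, Pi.smul_apply, smul_eq_mul, mul_comm] at h1
      have h2 : v i * (X i i - X (Fin.last N) (Fin.last N)) = 0 := by rw [mul_sub, ← h1, sub_self]
      exact (mul_eq_zero.1 h2).resolve_right (sub_ne_zero.2 (hlast i hi))
  ext i
  exact key _ i rfl

/-- All nonzero entries lie on the first diagonal above the main one. -/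
def IsSuperdiagonal (e : Matrix (Fin N) (Fin N) K) : Prop :=
  ∀ p q : Fin N, (q : ℕ) ≠ p + 1 → e p q = 0

theorem IsSuperdiagonal.pow_apply {e : Matrix (Fin N) (Fin N) K} (he : e.IsSuperdiagonal) (n : ℕ)
    (p q : Fin N) (h : (q : ℕ) ≠ p + n) : (e ^ n) p q = 0 := by
  induction n generalizing q with
  | zero => rw [pow_zero, one_apply_ne fun hpq => h (by simp [hpq])]
  | succ n ih =>
    rw [pow_succ, mul_apply]
    refine Finset.sum_eq_zero fun r _ => ?_
    by_cases hr : (r : ℕ) = p + n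
    · rw [he r q (by omega), mul_zero]
    · rw [ih r hr, zero_mul]

/-- The exponential `exp (u e)` of a nilpotent matrix. -/
def expNil (u : K) (e : Matrix (Fin N) (Fin N) K) : Matrix (Fin N) (Fin N) K :=
  ∑ n ∈ Finset.range N, (u ^ n / (n.factorial : K)) • e ^ n

/-- The homogeneous decomposition of an upper triangular matrix, as a power series: the `n`-th
coefficient is the part of `G` on the `n`-th diagonal above the main one. -/
noncomputable def gradedSeries (G : Matrix (Fin N) (Fin N) K) :
    PowerSeries (Matrix (Fin N) (Fin N) K) :=
  PowerSeries.mk fun n => of fun p q => if (q : ℕ) = p + n then G p q else 0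

theorem gradedSeries_expNil {e : Matrix (Fin N) (Fin N) K} (he : e.IsSuperdiagonal) (u : K) :
    gradedSeries (expNil u e) = PowerSeries.expMul u e := by
  ext n p q
  rw [gradedSeries, PowerSeries.coeff_mk, PowerSeries.coeff_expMul, of_apply, expNil, sum_apply,
    smul_apply]
  split_ifs with h
  · have hn : n ∈ Finset.range N := Finset.mem_range.2 (by have := q.2; omega)
    rw [Finset.sum_eq_single_of_mem n hn, smul_apply]
    intro r _ hr
    rw [smul_apply, he.pow_apply r p q (by omega), smul_zero]
  · rw [he.pow_apply n p q h, smul_zero]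

theorem gradedSeries_one : gradedSeries (1 : Matrix (Fin N) (Fin N) K) = 1 := by
  ext n p q
  rw [gradedSeries, PowerSeries.coeff_mk, PowerSeries.coeff_one, of_apply]
  rcases n with _ | n
  · by_cases hpq : p = q
    · simp [hpq]
    · simp [one_apply_ne hpq]
  · rw [if_neg n.succ_ne_zero, zero_apply]
    split_ifs with h
    · rw [one_apply_ne]
      rintro rfl
      omega
    · rfl

theorem gradedSeries_mul {G H : Matrix (Fin N) (Fin N) K} (hG : ∀ i j, j < i → G i j = 0)
    (hH : ∀ i j, j < i → H i j = 0) :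
    gradedSeries (G * H) = gradedSeries G * gradedSeries H := by
  ext n p q
  rw [PowerSeries.coeff_mul, sum_apply]
  simp only [gradedSeries, PowerSeries.coeff_mk, mul_apply, of_apply]
  rw [Finset.sum_comm]
  split_ifs with h
  · refine Finset.sum_congr rfl fun r _ => ?_
    by_cases hr : p ≤ r ∧ r ≤ q
    · obtain ⟨h1, h2⟩ := hr
      rw [Fin.le_def] at h1 h2
      rw [Finset.sum_eq_single ((r - p : ℕ), (q - r : ℕ))]
      · rw [if_pos (by simp only; omega), if_pos (by simp only; omega)]
      · intro b _ hb
        by_cases hb1 : (r : ℕ) = p + b.1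
        · by_cases hb2 : (q : ℕ) = r + b.2
          · exact absurd (Prod.ext (by simp only; omega) (by simp only; omega)) hb
          · rw [if_neg hb2, mul_zero]
        · rw [if_neg hb1, zero_mul]
      · intro hn
        exact absurd (Finset.HasAntidiagonal.mem_antidiagonal.2 (by simp only; omega)) hn
    · have : G p r * H r q = 0 := by
        rcases not_and_or.1 hr with h1 | h1
        · rw [hG p r (not_le.1 h1), zero_mul]
        · rw [hH r q (not_le.1 h1), mul_zero]
      rw [this]
      refine (Finset.sum_eq_zero fun b _ => ?_).symm
      split_ifs <;> simp [this]
  · refine (Finset.sum_eq_zero fun r _ => Finset.sum_eq_zero fun b hb => ?_).symm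
    have := Finset.HasAntidiagonal.mem_antidiagonal.1 hb
    by_cases hb1 : (r : ℕ) = p + b.1
    · rw [if_neg (show ¬ (q : ℕ) = r + b.2 by omega), mul_zero]
    · rw [if_neg hb1, zero_mul]

theorem expNil_lower {e : Matrix (Fin N) (Fin N) K} (he : e.IsSuperdiagonal) (u : K)
    (i j : Fin N) (hij : j < i) : expNil u e i j = 0 := by
  rw [expNil, sum_apply]
  refine Finset.sum_eq_zero fun n _ => ?_
  rw [smul_apply, he.pow_apply n i j (by simp only [Fin.lt_def] at hij; omega), smul_zero]

theorem expNil_diag {e : Matrix (Fin N) (Fin N) K} (he : e.IsSuperdiagonal) (u : K)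
    (i : Fin N) : expNil u e i i = 1 := by
  have h0 : 0 ∈ Finset.range N := Finset.mem_range.2 i.pos
  rw [expNil, sum_apply, Finset.sum_eq_single_of_mem 0 h0]
  · simp
  · intro n _ hn
    rw [smul_apply, he.pow_apply n i i (by omega), smul_zero]

/-- A product of exponentials of superdiagonal matrices is upper unitriangular, and its homogeneous
decomposition is the product of the exponential series. -/
theorem prod_expNil (l : List (K × Matrix (Fin N) (Fin N) K))
    (hl : ∀ p ∈ l, p.2.IsSuperdiagonal) :
    (∀ i j, j < i → (l.map fun p => expNil p.1 p.2).prod i j = 0) ∧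
      (∀ i, (l.map fun p => expNil p.1 p.2).prod i i = 1) ∧
      gradedSeries (l.map fun p => expNil p.1 p.2).prod =
        (l.map fun p => PowerSeries.expMul p.1 p.2).prod := by
  induction l with
  | nil => exact ⟨fun i j h => by simp [one_apply_ne h.ne'], by simp, by simp [gradedSeries_one]⟩
  | cons p l ih =>
    obtain ⟨h1, h2, h3⟩ := ih fun q hq => hl q (by simp [hq])
    have hp := hl p (by simp)
    simp only [List.map_cons, List.prod_cons]
    refine ⟨fun i j hij => ?_, fun i => ?_, ?_⟩
    · rw [mul_apply]
      refine Finset.sum_eq_zero fun r _ => ?_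
      rcases lt_or_ge r i with hr | hr
      · rw [expNil_lower hp _ i r hr, zero_mul]
      · rw [h1 r j (hij.trans_le hr), mul_zero]
    · rw [mul_apply, Finset.sum_eq_single i, expNil_diag hp, h2, one_mul]
      · intro r _ hr
        rcases lt_or_gt_of_ne hr with hr | hr
        · rw [expNil_lower hp _ i r hr, zero_mul]
        · rw [h1 r i hr, mul_zero]
      · simp
    · rw [gradedSeries_mul (expNil_lower hp _) h1, h3, gradedSeries_expNil hp]

end Matrix

/-! ### Exponentials of locally nilpotent derivations -/

section ExpDerivation

variable {k R : Type*} [Field k] [CommRing R] [Algebra k R]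

theorem Derivation.iterate_mul (D : Derivation k R R) (n : ℕ) (a b : R) :
    D^[n] (a * b) =
      ∑ ij ∈ Finset.HasAntidiagonal.antidiagonal n, n.choose ij.1 • (D^[ij.1] a * D^[ij.2] b) := by
  induction n with
  | zero => simp
  | succ n ih =>
    rw [Finset.sum_antidiagonal_choose_succ_nsmul (M := R) (fun i j => D^[i] a * D^[j] b) n]
    simp only [Function.iterate_succ_apply', ih, map_sum, map_nsmul, Derivation.leibniz, smul_add,
      Finset.sum_add_distrib, smul_eq_mul]
    congr 1
    refine Finset.sum_congr rfl fun ij hij => ?_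
    rw [mul_comm, Nat.choose_symm_of_eq_add (Finset.HasAntidiagonal.mem_antidiagonal.1 hij).symm]

/-- A derivation is locally nilpotent if a power of it kills any given element. -/
def Derivation.IsLocallyNilpotent (D : Derivation k R R) : Prop := ∀ f, ∃ n, D^[n] f = 0

open Polynomial

open Classical in
/-- The polynomial `exp (X D) f`, for a locally nilpotent derivation `D`. -/
noncomputable def Derivation.expPoly (D : Derivation k R R) (hD : D.IsLocallyNilpotent) (f : R) :
    R[X] :=
  ∑ n ∈ Finset.range (Nat.find (hD f)), monomial n ((n.factorial : k)⁻¹ • D^[n] f)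

theorem Derivation.iterate_eq_zero {D : Derivation k R R} {f : R} {m n : ℕ} (h : D^[m] f = 0)
    (hmn : m ≤ n) : D^[n] f = 0 := by
  obtain ⟨r, rfl⟩ := Nat.exists_eq_add_of_le hmn
  rw [add_comm, Function.iterate_add_apply, h, iterate_map_zero]

theorem Derivation.coeff_expPoly (D : Derivation k R R) (hD : D.IsLocallyNilpotent) (f : R)
    (n : ℕ) : (D.expPoly hD f).coeff n = (n.factorial : k)⁻¹ • D^[n] f := by
  classical
  rw [Derivation.expPoly, finsetSum_coeff]
  simp only [coeff_monomial]
  rw [Finset.sum_ite_eq' (Finset.range (Nat.find (hD f)))]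
  split_ifs with h
  · rfl
  · rw [D.iterate_eq_zero (Nat.find_spec (hD f)) (by simpa using h), smul_zero]

variable [CharZero k]

/-- The algebra homomorphism `f ↦ exp (X D) f`, for a locally nilpotent derivation `D`. -/
noncomputable def Derivation.expHom (D : Derivation k R R) (hD : D.IsLocallyNilpotent) :
    R →ₐ[k] R[X] where
  toFun := D.expPoly hD
  map_one' := by
    ext n
    rw [D.coeff_expPoly, coeff_one]
    rcases n with _ | n
    · simp
    · rw [Function.iterate_succ_apply, D.map_one_eq_zero, iterate_map_zero]
      simp
  map_mul' f g := by
    ext n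
    rw [coeff_mul, D.coeff_expPoly, D.iterate_mul, Finset.smul_sum]
    refine Finset.sum_congr rfl fun p hp => ?_
    rw [D.coeff_expPoly, D.coeff_expPoly, smul_mul_smul_comm, ← Nat.cast_smul_eq_nsmul k, smul_smul]
    congr 1
    have h := Nat.add_choose_mul_factorial_mul_factorial p.1 p.2
    rw [Finset.HasAntidiagonal.mem_antidiagonal.1 hp] at h
    rw [Nat.choose_symm_of_eq_add (Finset.HasAntidiagonal.mem_antidiagonal.1 hp).symm, ← h]
    have h1 : ((p.1.factorial : ℕ) : k) ≠ 0 := Nat.cast_ne_zero.2 p.1.factorial_ne_zero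
    have h2 : ((p.2.factorial : ℕ) : k) ≠ 0 := Nat.cast_ne_zero.2 p.2.factorial_ne_zero
    have h3 : ((n.choose p.2 : ℕ) : k) ≠ 0 :=
      Nat.cast_ne_zero.2 (Nat.choose_pos (by
        have := Finset.HasAntidiagonal.mem_antidiagonal.1 hp
        omega)).ne'
    push_cast
    field_simp
  map_zero' := by
    ext n
    rw [D.coeff_expPoly, iterate_map_zero]
    simp
  map_add' f g := by
    ext n
    rw [coeff_add]
    simp only [D.coeff_expPoly, iterate_map_add, smul_add]
  commutes' c := by
    ext n
    rw [D.coeff_expPoly, Polynomial.algebraMap_apply, coeff_C]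
    rcases n with _ | n
    · simp
    · rw [Function.iterate_succ_apply, D.map_algebraMap, iterate_map_zero]
      simp

theorem Derivation.coeff_expHom (D : Derivation k R R) (hD : D.IsLocallyNilpotent) (f : R)
    (n : ℕ) : (D.expHom hD f).coeff n = (n.factorial : k)⁻¹ • D^[n] f :=
  D.coeff_expPoly hD f n

/-- The exponential may be computed with any sufficiently long partial sum. -/
theorem Derivation.eval₂_expHom {S : Type*} [CommRing S] (D : Derivation k R R)
    (hD : D.IsLocallyNilpotent) (ι : R →+* S) (t : S) {f : R} {N : ℕ} (hN : D^[N] f = 0) :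
    (D.expHom hD f).eval₂ ι t =
      ∑ n ∈ Finset.range N, ι ((n.factorial : k)⁻¹ • D^[n] f) * t ^ n := by
  have h : (D.expHom hD f).natDegree < N ∨ D.expHom hD f = 0 := by
    by_contra! h
    refine h.2 (leadingCoeff_eq_zero.1 ?_)
    rw [leadingCoeff, D.coeff_expHom, D.iterate_eq_zero hN h.1, smul_zero]
  rcases h with h | h
  · rw [eval₂_eq_sum_range' _ h]
    simp only [D.coeff_expHom]
  · rw [h, eval₂_zero]
    refine (Finset.sum_eq_zero fun n _ => ?_).symm
    rw [← D.coeff_expHom hD, h, coeff_zero, map_zero, zero_mul]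

end ExpDerivation

section Words

open Polynomial

variable {k R K J : Type*} [Field k] [CommRing R] [Algebra k R] [Field K] [Algebra k K]

/-- Precomposition with a derivation, on the space of linear maps from `R` to a field `K`. -/
def Derivation.precomp (K : Type*) [Field K] [Algebra k K] (D : Derivation k R R) :
    Module.End K (R →ₗ[k] K) where
  toFun h := h ∘ₗ (D : R →ₗ[k] R)
  map_add' _ _ := rfl
  map_smul' _ _ := rfl

theorem Derivation.precomp_pow_apply (D : Derivation k R R) (n : ℕ) (h : R →ₗ[k] K) (f : R) :
    (D.precomp K ^ n) h f = h (D^[n] f) := by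
  induction n generalizing h with
  | zero => rfl
  | succ n ih => rw [pow_succ, Module.End.mul_apply, ih, Function.iterate_succ_apply']; rfl

variable [CharZero k]

/-- For `l = [(u₁, j₁), …, (uᵣ, jᵣ)]`, the polynomial
`ι (exp (uᵣ z D jᵣ) ⋯ exp (u₁ z D j₁) f)`, in which the scalars `u` of `K` are
treated as constants for the derivations. -/
noncomputable def wordPoly (D : J → Derivation k R R) (hD : ∀ j, (D j).IsLocallyNilpotent)
    (ι : R →ₐ[k] K) : List (K × J) → (R →ₗ[k] K[X])
  | [] => (CAlgHom (R := k) (A := K)).toLinearMap ∘ₗ ι.toLinearMap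
  | (u, j) :: l =>
    (lsum fun n => (LinearMap.mulLeft k (C (u ^ n) * X ^ n)) ∘ₗ wordPoly D hD ι l) ∘ₗ
      ((D j).expHom (hD j)).toLinearMap

variable (D : J → Derivation k R R) (hD : ∀ j, (D j).IsLocallyNilpotent) (ι : R →ₐ[k] K)

theorem wordPoly_nil (f : R) : wordPoly D hD ι [] f = C (ι f) := rfl

theorem wordPoly_cons (u : K) (j : J) (l : List (K × J)) (f : R) :
    wordPoly D hD ι ((u, j) :: l) f =
      ((D j).expHom (hD j) f).sum fun n g => C (u ^ n) * X ^ n * wordPoly D hD ι l g := rfl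

/-- The coefficients of `wordPoly` are those of a product of exponential series in the algebra of
endomorphisms of the space of linear maps from `R` to `K`. -/
theorem coeff_wordPoly (l : List (K × J)) (f : R) (n : ℕ) :
    (wordPoly D hD ι l f).coeff n = PowerSeries.coeff n
      (l.map fun p => PowerSeries.expMul p.1 ((D p.2).precomp K)).prod ι.toLinearMap f := by
  induction l generalizing f n with
  | nil =>
    rw [wordPoly_nil, coeff_C, List.map_nil, List.prod_nil, PowerSeries.coeff_one]
    split_ifs <;> rfl
  | cons p l ih =>
    obtain ⟨u, j⟩ := p
    rw [wordPoly_cons, List.map_cons, List.prod_cons, PowerSeries.coeff_mul, Polynomial.sum_def,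
      finsetSum_coeff, LinearMap.sum_apply, LinearMap.sum_apply,
      Finset.Nat.sum_antidiagonal_eq_sum_range_succ_mk]
    have h : ∀ m, (C (u ^ m) * X ^ m * wordPoly D hD ι l (((D j).expHom (hD j) f).coeff m)).coeff n
        = if m ≤ n then u ^ m * (wordPoly D hD ι l (((D j).expHom (hD j) f).coeff m)).coeff (n - m)
          else 0 := by
      intro m
      rw [mul_assoc, coeff_C_mul, coeff_X_pow_mul']
      split_ifs <;> simp
    simp only [h]
    rw [← Finset.sum_filter]
    have h1 : ∀ m, ((PowerSeries.coeff m (PowerSeries.expMul u ((D j).precomp K)) *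
        PowerSeries.coeff (n - m)
          (l.map fun p => PowerSeries.expMul p.1 ((D p.2).precomp K)).prod) ι.toLinearMap) f =
        u ^ m * (wordPoly D hD ι l (((D j).expHom (hD j) f).coeff m)).coeff (n - m) := by
      intro m
      rw [show PowerSeries.coeff m (PowerSeries.expMul u ((D j).precomp K)) = _ from
        PowerSeries.coeff_expMul u ((D j).precomp K) m, Module.End.mul_apply, LinearMap.smul_apply,
        LinearMap.smul_apply, (D j).precomp_pow_apply, ← ih, (D j).coeff_expHom, map_smul,
        coeff_smul, smul_eq_mul, Algebra.smul_def, map_inv₀, map_natCast]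
      ring
    simp only [h1]
    refine Finset.sum_subset_zero_on_sdiff (fun m hm => ?_) (fun m hm => ?_) (fun _ _ => rfl)
    · rw [Finset.mem_filter] at hm
      exact Finset.mem_range.2 (Nat.lt_succ_of_le hm.2)
    · rw [Finset.mem_sdiff, Finset.mem_filter, not_and', Finset.mem_range] at hm
      rw [notMem_support_iff.1 (hm.2 (Nat.le_of_lt_succ hm.1)), map_zero, coeff_zero, mul_zero]

theorem map_eval_wordPoly {s : K →+* K} {v : K} {j : J}
    (hs : ∀ f, s (ι f) = ((D j).expHom (hD j) f).eval₂ (ι : R →+* K) v)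
    (l : List (K × J)) (f : R) :
    s ((wordPoly D hD ι l f).eval 1) =
      (wordPoly D hD ι (l.map (fun p => (s p.1, p.2)) ++ [(v, j)]) f).eval 1 := by
  induction l generalizing f with
  | nil =>
    rw [wordPoly_nil, eval_C, hs, List.map_nil, List.nil_append, wordPoly_cons, Polynomial.sum_def,
      eval_finsetSum, eval₂_eq_sum, Polynomial.sum_def]
    refine Finset.sum_congr rfl fun n _ => ?_
    simp [wordPoly_nil, mul_comm]
  | cons p l ih =>
    rw [List.map_cons, List.cons_append, wordPoly_cons, wordPoly_cons, Polynomial.sum_def,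
      Polynomial.sum_def, eval_finsetSum, eval_finsetSum, map_sum]
    refine Finset.sum_congr rfl fun n _ => ?_
    simp [ih]

theorem wordPoly_eq_C {l : List (K × J)}
    (h : (l.map fun p => PowerSeries.expMul p.1 ((D p.2).precomp K)).prod = 1) (f : R) :
    wordPoly D hD ι l f = C (ι f) := by
  ext n
  rw [coeff_wordPoly, h, PowerSeries.coeff_one, coeff_C]
  split_ifs <;> rfl

variable (σ : J → K ≃ₐ[k] K) (t : J → K)

/-- The parameters of the composite `σ j₁ ∘ ⋯ ∘ σ jᵣ` of the automorphisms
`σ j = exp (t j · D j)`, written as a product of exponentials: the `i`-th factor from the right has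
the parameter `σ j₁ (⋯ (σ jᵢ₋₁ (t jᵢ)))`. -/
def wordParams : List J → List (K × J)
  | [] => []
  | j :: js => (wordParams js).map (fun p => (σ j p.1, p.2)) ++ [(t j, j)]

theorem prod_apply_eq_eval_wordPoly
    (hσ : ∀ j f, σ j (ι f) = ((D j).expHom (hD j) f).eval₂ (ι : R →+* K) (t j)) (js : List J)
    (f : R) : (js.map σ).prod (ι f) = (wordPoly D hD ι (wordParams σ t js) f).eval 1 := by
  induction js with
  | nil => simp [wordParams, wordPoly_nil]
  | cons j js ih =>
    rw [List.map_cons, List.prod_cons, AlgEquiv.mul_apply, ih, wordParams]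
    exact map_eval_wordPoly D hD ι (s := (σ j : K →+* K)) (hσ j) _ f

/-- If the product of the exponential series of a word is trivial, then so is the composite of the
automorphisms on the image of `R`. -/
theorem prod_apply_eq_self
    (hσ : ∀ j f, σ j (ι f) = ((D j).expHom (hD j) f).eval₂ (ι : R →+* K) (t j)) (js : List J)
    (h : ((wordParams σ t js).map fun p => PowerSeries.expMul p.1 ((D p.2).precomp K)).prod = 1)
    (f : R) : (js.map σ).prod (ι f) = ι f := by
  rw [prod_apply_eq_eval_wordPoly D hD ι σ t hσ, wordPoly_eq_C D hD ι h, eval_C]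

end Words

/-! ### Lax matrices -/

section Lax

open Matrix

variable {k K J : Type*} [Field k] [Field K] [Algebra k K] {N : ℕ}

/-- A Lax matrix for automorphisms `σ j` of a field `K`: a lower triangular matrix `X` with distinct
diagonal entries such that `σ j` acts on the entries of `X` by conjugation with
`exp (t j · e j)`, for superdiagonal matrices `e j` with invariant entries. -/
structure LaxMatrix (σ : J → K ≃ₐ[k] K) (t : J → K) (N : ℕ) where
  e : J → Matrix (Fin N) (Fin N) K
  X : Matrix (Fin N) (Fin N) K
  superdiagonal : ∀ j, (e j).IsSuperdiagonal
  invariant : ∀ i j, (e j).map (σ i) = e j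
  lower : ∀ p q, p < q → X p q = 0
  diag_ne : ∀ p q, p < q → X p p ≠ X q q
  lax : ∀ j, X.map (σ j) * expNil (t j) (e j) = expNil (t j) (e j) * X

theorem Matrix.expNil_map (s : K ≃ₐ[k] K) (u : K) (e : Matrix (Fin N) (Fin N) K) :
    (expNil u e).map s = expNil (s u) (e.map s) := by
  have h : ∀ M : Matrix (Fin N) (Fin N) K, M.map s = (s : K →+* K).mapMatrix M := fun _ => rfl
  rw [h, h, expNil, expNil, map_sum]
  refine Finset.sum_congr rfl fun n _ => ?_
  rw [← map_pow]
  ext p q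
  simp only [RingHom.mapMatrix_apply, map_apply, smul_apply, smul_eq_mul, map_mul, map_div₀,
    map_pow, map_natCast, RingHom.coe_coe]
  congr 1
  exact congrFun (congrFun (map_pow (s : K →+* K).mapMatrix e n) p) q

namespace LaxMatrix

variable {σ : J → K ≃ₐ[k] K} {t : J → K} (L : LaxMatrix σ t N)

/-- The product of exponentials by which a composite of the automorphisms `σ j` acts on the Lax
matrix. -/
def dressing (js : List J) : Matrix (Fin N) (Fin N) K :=
  ((wordParams σ t js).map fun p => expNil p.1 (L.e p.2)).prod

theorem dressing_nil : L.dressing [] = 1 := rfl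

theorem dressing_cons (j : J) (js : List J) :
    L.dressing (j :: js) = (L.dressing js).map (σ j) * expNil (t j) (L.e j) := by
  have h : ∀ M : Matrix (Fin N) (Fin N) K, M.map (σ j) = (σ j : K →+* K).mapMatrix M :=
    fun _ => rfl
  rw [dressing, dressing, wordParams, List.map_append, List.prod_append, h, map_list_prod,
    List.map_map, List.map_map]
  congr 2
  · refine List.map_congr_left fun p _ => ?_
    simp only [Function.comp_apply]
    rw [← h, expNil_map, L.invariant]
  · simp

theorem map_mul_dressing (js : List J) :
    L.X.map (js.map σ).prod * L.dressing js = L.dressing js * L.X := by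
  induction js with
  | nil =>
    rw [dressing_nil, one_mul, mul_one]
    rfl
  | cons j js ih =>
    have h : ∀ M : Matrix (Fin N) (Fin N) K, M.map (σ j) = (σ j : K →+* K).mapMatrix M :=
      fun _ => rfl
    have h1 : L.X.map ((j :: js).map σ).prod = (L.X.map (js.map σ).prod).map (σ j) := by
      ext p q
      rw [List.map_cons, List.prod_cons]
      rfl
    rw [h1, dressing_cons, ← mul_assoc, h, h, ← map_mul, ih, map_mul, mul_assoc, ← h, ← h, L.lax,
      mul_assoc]

theorem dressing_lower (js : List J) (p q : Fin N) (h : q < p) : L.dressing js p q = 0 := by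
  have := (prod_expNil ((wordParams σ t js).map fun p => (p.1, L.e p.2)) (by
    simp only [List.mem_map]
    rintro _ ⟨p, -, rfl⟩
    exact L.superdiagonal _)).1 p q h
  rwa [List.map_map] at this

theorem dressing_diag (js : List J) (p : Fin N) : L.dressing js p p = 1 := by
  have := (prod_expNil ((wordParams σ t js).map fun p => (p.1, L.e p.2)) (by
    simp only [List.mem_map]
    rintro _ ⟨p, -, rfl⟩
    exact L.superdiagonal _)).2.1 p
  rwa [List.map_map] at this

/-- If a composite of the automorphisms `σ j` fixes the diagonal of the Lax matrix, then the
corresponding product of exponentials is trivial. -/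
theorem prod_expMul_eq_one {js : List J}
    (hdiag : ∀ p, (js.map σ).prod (L.X p p) = L.X p p) :
    ((wordParams σ t js).map fun p => PowerSeries.expMul p.1 (L.e p.2)).prod = 1 := by
  have h1 : L.dressing js = 1 := by
    refine eq_one_of_intertwines_lower (L.dressing_lower js) (L.dressing_diag js) L.lower
      (fun p q hpq => ?_) (fun p => (hdiag p).symm) L.diag_ne (L.map_mul_dressing js).symm
    rw [map_apply, L.lower p q hpq, map_zero]
  have := (prod_expNil ((wordParams σ t js).map fun p => (p.1, L.e p.2)) (by
    simp only [List.mem_map]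
    rintro _ ⟨p, -, rfl⟩
    exact L.superdiagonal _)).2.2
  rw [List.map_map, List.map_map] at this
  refine this.symm.trans ?_
  rw [← gradedSeries_one, ← h1]
  rfl

/-- The corner entry of a product of exponentials is invariant under `σ j` if the
corresponding composite maps the first diagonal entry of the Lax matrix to the last one, `σ j`
fixes the last one, and the last column of `e j` vanishes: the first row is the left eigenvector of
`X` for the last diagonal entry, normalized by its first coordinate. -/
theorem corner_invariant {N : ℕ} {σ : J → K ≃ₐ[k] K} {t : J → K} (L : LaxMatrix σ t (N + 1))
    {js : List J} (hjs : (js.map σ).prod (L.X 0 0) = L.X (Fin.last N) (Fin.last N)) {j : J}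
    (hj : σ j (L.X (Fin.last N) (Fin.last N)) = L.X (Fin.last N) (Fin.last N))
    (hcol : ∀ p, L.e j p (Fin.last N) = 0) :
    σ j (L.dressing js 0 (Fin.last N)) = L.dressing js 0 (Fin.last N) := by
  set d := L.X (Fin.last N) (Fin.last N) with hd
  set v : Fin (N + 1) → K := L.dressing js 0 with hv
  set m := expNil (t j) (L.e j) with hm
  set w : Fin (N + 1) → K := (σ j ∘ v) ᵥ* m with hw
  have hrow : ∀ (A B : Matrix (Fin (N + 1)) (Fin (N + 1)) K), (A * B) 0 = A 0 ᵥ* B := by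
    intro A B
    ext q
    rfl
  have hvX : v ᵥ* L.X = d • v := by
    rw [hv, ← hrow, ← L.map_mul_dressing, hrow]
    ext q
    rw [Matrix.vecMul, dotProduct, Finset.sum_eq_single 0 _ (by simp), map_apply, hjs]
    · rfl
    · intro p _ hp
      rw [map_apply, L.lower 0 p (Fin.pos_iff_ne_zero.2 hp), map_zero, zero_mul]
  have hwX : w ᵥ* L.X = d • w := by
    have h1 : (σ j ∘ v) ᵥ* L.X.map (σ j) = d • (σ j ∘ v) := by
      ext q
      have := congrArg (σ j) (congrFun hvX q)
      rw [Pi.smul_apply, smul_eq_mul, map_mul, hj, Matrix.vecMul, dotProduct, map_sum] at this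
      rw [Matrix.vecMul, dotProduct, Pi.smul_apply, smul_eq_mul, Function.comp_apply, ← this]
      exact Finset.sum_congr rfl fun p _ => (map_mul (σ j) _ _).symm
    rw [hw, vecMul_vecMul, ← L.lax, ← vecMul_vecMul, h1, smul_vecMul]
  have hv0 : v 0 = 1 := L.dressing_diag js 0
  have hw0 : w 0 = 1 := by
    rw [hw, Matrix.vecMul, dotProduct, Finset.sum_eq_single 0 _ (by simp), hm,
      expNil_diag (L.superdiagonal j), Function.comp_apply, hv0, map_one, mul_one]
    intro p _ hp
    rw [hm, expNil_lower (L.superdiagonal j) _ p 0 (Fin.pos_iff_ne_zero.2 hp), mul_zero]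
  have hwl : w (Fin.last N) = σ j (v (Fin.last N)) := by
    rw [hw, Matrix.vecMul, dotProduct, Finset.sum_eq_single (Fin.last N) _ (by simp), hm,
      expNil_diag (L.superdiagonal j), Function.comp_apply, mul_one]
    intro p _ hp
    rw [hm, expNil, Matrix.sum_apply, Finset.sum_eq_zero, mul_zero]
    intro n _
    rcases n with _ | n
    · rw [pow_zero, pow_zero, Matrix.smul_apply, one_apply_ne hp, smul_zero]
    · rw [Matrix.smul_apply, pow_succ (L.e j), mul_apply]
      simp [hcol]
  have h0 := eq_zero_of_vecMul_eq_last L.lower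
    (fun p hp => L.diag_ne p _ (Fin.lt_last_iff_ne_last.2 hp))
    (v := v (Fin.last N) • w - w (Fin.last N) • v)
    (by rw [sub_vecMul, smul_vecMul, smul_vecMul, hvX, hwX, smul_sub, smul_comm d, smul_comm d])
    (by simp [mul_comm])
  have h1 := congrFun h0 0
  simp only [Pi.sub_apply, Pi.smul_apply, smul_eq_mul, hv0, hw0, mul_one, Pi.zero_apply] at h1
  rw [← hwl, sub_eq_zero.1 h1]

end LaxMatrix

/-- A composite of automorphisms of the form `exp (t j · D j)`, for `j` in a set of two elements, is
trivial on `R` if it fixes the diagonal of a Lax matrix. The derivations and the matrices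
of the Lax representation have to satisfy the Serre relations of type `G₂`, and the derivations all
linear relations of the matrices between the corresponding six root vectors. -/
theorem LaxMatrix.prod_apply_eq_self {R : Type*} [CharZero k] [CommRing R] [Algebra k R]
    {σ : Bool → K ≃ₐ[k] K} {t : Bool → K} (L : LaxMatrix σ t N)
    (D : Bool → Derivation k R R) (hD : ∀ j, (D j).IsLocallyNilpotent) (ι : R →ₐ[k] K)
    (hσ : ∀ j f, σ j (ι f) = ((D j).expHom (hD j) f).eval₂ (ι : R →+* K) (t j))
    (hL : IsSerrePair K (L.e true) (L.e false))
    (hDs : IsSerrePair K ((D true).precomp K) ((D false).precomp K))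
    (hinj : ∀ c : Fin 6 → K, serreComb c (L.e true) (L.e false) = 0 →
      serreComb c ((D true).precomp K) ((D false).precomp K) = 0)
    {js : List Bool} (hdiag : ∀ p, (js.map σ).prod (L.X p p) = L.X p p) (f : R) :
    (js.map σ).prod (ι f) = ι f := by
  have : CharZero K := charZero_of_injective_algebraMap (algebraMap k K).injective
  refine _root_.prod_apply_eq_self D hD ι σ t hσ js ?_ f
  exact prod_expMul_eq_one_of_serre L.e (fun j => (D j).precomp K) hL hDs hinj _
    (L.prod_expMul_eq_one hdiag)

end Lax

/-! ### Rank two actions -/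

section Explicit

open Matrix

variable {k K : Type*} [Field k] [Field K] [Algebra k K]

/-- The action of the two automorphisms `σ true = exp (t true · {φs, ·})` and
`σ false = exp (t false · {φl, ·})` on `φs`, `φl`, `y₁ = {φs, φl}`, `y₂ = {φs, y₁}`,
`y₃ = {φs, y₂}`, `y₄ = {φl, y₃}`, and on the parameters `ls`, `ll`. Here `c` is the
number of edges of the Dynkin diagram, and `true` stands for the short root. -/
structure RankTwoAction (σ : Bool → K ≃ₐ[k] K) (t : Bool → K) (c : ℤ)
    (φs φl y₁ y₂ y₃ y₄ ls ll : K) : Prop where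
  short_φs : σ true φs = φs
  short_φl : σ true φl = φl + t true * y₁ + t true ^ 2 / 2 * y₂ + t true ^ 3 / 6 * y₃
  short_y₁ : σ true y₁ = y₁ + t true * y₂ + t true ^ 2 / 2 * y₃
  short_y₂ : σ true y₂ = y₂ + t true * y₃
  short_y₃ : σ true y₃ = y₃
  short_y₄ : σ true y₄ = y₄
  short_ls : σ true ls = -ls
  short_ll : σ true ll = ll + ls
  long_φs : σ false φs = φs - t false * y₁
  long_φl : σ false φl = φl
  long_y₁ : σ false y₁ = y₁
  long_y₂ : σ false y₂ = y₂
  long_y₃ : σ false y₃ = y₃ + t false * y₄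
  long_y₄ : σ false y₄ = y₄
  long_ls : σ false ls = ls + c * ll
  long_ll : σ false ll = -ll
  t_short : t true * φs = ls
  t_long : t false * φl = ll
  ne_zero : ∀ a b : ℤ, (a ≠ 0 ∨ b ≠ 0) → (a : K) * ls + b * ll ≠ 0

variable {σ : Bool → K ≃ₐ[k] K} {t : Bool → K} {φs φl y₁ y₂ y₃ y₄ ls ll : K}

theorem RankTwoAction.diag_ne {c : ℤ} (h : RankTwoAction σ t c φs φl y₁ y₂ y₃ y₄ ls ll) {N : ℕ}
    {X : Matrix (Fin N) (Fin N) K} (m : ℤ) (α β : Fin N → ℤ)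
    (hX : ∀ p, (m : K) * X p p = α p * ls + β p * ll)
    (hαβ : ∀ p q, p < q → α p - α q ≠ 0 ∨ β p - β q ≠ 0) (p q : Fin N) (hpq : p < q) :
    X p p ≠ X q q := by
  intro h0
  refine h.ne_zero _ _ (hαβ p q hpq) ?_
  push_cast
  have h1 := hX p
  rw [h0, hX q] at h1
  linear_combination -h1

theorem Matrix.expNil_of_pow_three_eq_zero {N : ℕ} {e : Matrix (Fin (N + 3)) (Fin (N + 3)) K}
    (he : e ^ 3 = 0) (u : K) : expNil u e = 1 + u • e + (u ^ 2 / 2) • e ^ 2 := by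
  rw [expNil, ← Finset.sum_subset (Finset.range_mono (Nat.le_add_left 3 N))]
  · simp [Finset.sum_range_succ]
  · intro n _ hn
    rw [← Nat.add_sub_of_le (not_lt.1 fun h => hn (Finset.mem_range.2 h)), pow_add e, he, zero_mul,
      smul_zero]

/-- An integral matrix with entries in `K`. -/
def Matrix.castTo (K : Type*) [Field K] {N : ℕ} (M : Matrix (Fin N) (Fin N) ℤ) :
    Matrix (Fin N) (Fin N) K :=
  (Int.castRingHom K).mapMatrix M

theorem Matrix.castTo_apply {N : ℕ} (M : Matrix (Fin N) (Fin N) ℤ) (p q : Fin N) :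
    M.castTo K p q = (M p q : K) := rfl

theorem Matrix.castTo_map {N : ℕ} (M : Matrix (Fin N) (Fin N) ℤ) (s : K ≃ₐ[k] K) :
    (M.castTo K).map s = M.castTo K := by
  ext p q
  rw [map_apply, castTo_apply, map_intCast]

theorem Matrix.castTo_pow {N : ℕ} (M : Matrix (Fin N) (Fin N) ℤ) (n : ℕ) :
    M.castTo K ^ n = (M ^ n).castTo K :=
  (map_pow (Int.castRingHom K).mapMatrix M n).symm

theorem Matrix.castTo_zero {N : ℕ} : (0 : Matrix (Fin N) (Fin N) ℤ).castTo K = 0 :=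
  map_zero (Int.castRingHom K).mapMatrix

theorem commutator₂_castTo {N : ℕ} (M M' : Matrix (Fin N) (Fin N) ℤ) :
    commutator₂ K _ (M.castTo K) (M'.castTo K) = (M * M' - M' * M).castTo K := by
  have h := map_sub (Int.castRingHom K).mapMatrix (M * M') (M' * M)
  rw [map_mul, map_mul] at h
  exact h.symm

/-- The brackets of two integral matrices `e` and `f` that satisfy the Serre relations of type
`G₂`, with entries in `K`. -/
theorem brackets_castTo {N : ℕ} {e f b₁ b₂ b₃ b₅ : Matrix (Fin N) (Fin N) ℤ}
    (h₁ : e * f - f * e = b₁) (h₂ : e * b₁ - b₁ * e = b₂) (h₃ : e * b₂ - b₂ * e = b₃)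
    (h₅ : f * b₃ - b₃ * f = b₅) (hf : f * b₁ - b₁ * f = 0) (he : e * b₃ - b₃ * e = 0) :
    IsSerrePair K (e.castTo K) (f.castTo K) ∧
    ∀ (c : Fin 6 → K) (p q : Fin N), serreComb c (e.castTo K) (f.castTo K) p q =
      c 0 * e p q + c 1 * f p q + c 2 * b₁ p q + c 3 * b₂ p q + c 4 * b₃ p q + c 5 * b₅ p q := by
  refine ⟨⟨?_, ?_⟩, fun c p q => ?_⟩
  · rw [commutator₂_skew (f.castTo K) (e.castTo K), map_neg, commutator₂_castTo,
      commutator₂_castTo, h₁, hf, castTo_zero, neg_zero]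
  · simp only [commutator₂_castTo, h₁, h₂, h₃, he, castTo_zero]
  · simp only [serreComb, commutator₂_castTo, h₁, h₂, h₃, h₅, Matrix.add_apply, Matrix.smul_apply,
      smul_eq_mul, castTo_apply]

theorem fix_diag {N : ℕ}
    {X : Matrix (Fin N) (Fin N) K} (m : ℤ) (α β : Fin N → ℤ) (hm : (m : K) ≠ 0)
    (hX : ∀ p, (m : K) * X p p = α p * ls + β p * ll) {s : K ≃ₐ[k] K} (hs : s ls = ls)
    (hl : s ll = ll) (p : Fin N) : s (X p p) = X p p := by
  have h1 := congrArg s (hX p)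
  rw [map_mul, map_add, map_mul, map_mul, map_intCast, map_intCast, map_intCast, hs, hl, ← hX] at h1
  exact mul_left_cancel₀ hm h1

end Explicit

/-! ### Type `A₂` -/

section Explicit

open Matrix

variable {k K : Type*} [Field k] [Field K] [Algebra k K]
variable {σ : Bool → K ≃ₐ[k] K} {t : Bool → K} {φs φl y₁ y₂ y₃ y₄ ls ll : K}

/-- The short and the long root vector of type `A₂`, for `true` and `false`, in a representation of
dimension `3`. -/
def A₂.root : Bool → Matrix (Fin 3) (Fin 3) ℤ
  | true => !![0, 1, 0; 0, 0, 0; 0, 0, 0]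
  | false => !![0, 0, 0; 0, 0, 1; 0, 0, 0]

theorem A₂.expNil_short [CharZero K] (u : K) : expNil u (Matrix.castTo K (A₂.root true)) =
    !![1, u, 0; 0, 1, 0; 0, 0, 1] := by
  have h2 : A₂.root true ^ 2 = !![0, 0, 0; 0, 0, 0; 0, 0, 0] := by decide
  have h3 : A₂.root true ^ 3 = 0 := by rw [pow_succ, h2]; decide
  rw [expNil_of_pow_three_eq_zero (by rw [castTo_pow, h3, castTo_zero]), castTo_pow, h2, A₂.root]
  ext i j
  fin_cases i <;> fin_cases j <;> simp [castTo_apply]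

theorem A₂.expNil_long [CharZero K] (u : K) : expNil u (Matrix.castTo K (A₂.root false)) =
    !![1, 0, 0; 0, 1, u; 0, 0, 1] := by
  have h2 : A₂.root false ^ 2 = 0 := by decide
  rw [expNil_of_pow_three_eq_zero (by rw [castTo_pow, pow_succ, h2, zero_mul, castTo_zero]),
    castTo_pow, h2, A₂.root]
  ext i j
  fin_cases i <;> fin_cases j <;> simp [castTo_apply]

/-- The Lax matrix of type `A₂`: the diagonal entries are linear combinations of `ls` and `ll`,
given by the weights of the representation; below them are `φs`, `φl` and their brackets. -/
def A₂.lax (φs φl y₁ ls ll : K) : Matrix (Fin 3) (Fin 3) K :=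
  !![-(2 * ls + ll) / 3, 0, 0; φs, (ls - ll) / 3, 0; -y₁, φl, (ls + 2 * ll) / 3]

theorem A₂.map_lax (s : K ≃ₐ[k] K) : (A₂.lax φs φl y₁ ls ll).map s =
    A₂.lax (s φs) (s φl) (s y₁) (s ls) (s ll) := by
  rw [A₂.lax, A₂.lax]
  ext i j
  fin_cases i <;> fin_cases j <;> simp [map_ofNat, add_comm]

theorem A₂.lax_short [CharZero K] (h : RankTwoAction σ t 1 φs φl y₁ 0 0 0 ls ll) :
    (A₂.lax φs φl y₁ ls ll).map (σ true) * expNil (t true) (Matrix.castTo K (A₂.root true)) =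
      expNil (t true) (Matrix.castTo K (A₂.root true)) * A₂.lax φs φl y₁ ls ll := by
  rw [A₂.map_lax, h.short_φs, h.short_φl, h.short_y₁, h.short_ls,
    h.short_ll, A₂.expNil_short, ← h.t_short]
  generalize t true = u
  rw [A₂.lax, A₂.lax]
  ext i j
  fin_cases i <;> fin_cases j <;> simp [Matrix.mul_apply, Fin.sum_univ_succ] <;> ring

theorem A₂.lax_long [CharZero K] (h : RankTwoAction σ t 1 φs φl y₁ 0 0 0 ls ll) :
    (A₂.lax φs φl y₁ ls ll).map (σ false) * expNil (t false) (Matrix.castTo K (A₂.root false)) =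
      expNil (t false) (Matrix.castTo K (A₂.root false)) * A₂.lax φs φl y₁ ls ll := by
  rw [A₂.map_lax, h.long_φs, h.long_φl, h.long_y₁, h.long_ls,
    h.long_ll, A₂.expNil_long, ← h.t_long]
  generalize t false = u
  rw [A₂.lax, A₂.lax]
  ext i j
  fin_cases i <;> fin_cases j <;> simp [Matrix.mul_apply, Fin.sum_univ_succ] <;> ring

theorem A₂.lax_diag [CharZero K] (p : Fin 3) : ((3 : ℤ) : K) * A₂.lax φs φl y₁ ls ll p p =
    ((![-2, 1, 1] : Fin 3 → ℤ) p : K) * ls + ((![-1, -1, 2] : Fin 3 → ℤ) p : K) * ll := by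
  rw [A₂.lax]
  fin_cases p <;> simp <;> ring

/-- The matrix `A₂.lax` is a Lax matrix for every rank two action of type `A₂`. -/
def A₂.laxMatrix [CharZero K] (h : RankTwoAction σ t 1 φs φl y₁ 0 0 0 ls ll) :
    LaxMatrix σ t 3 where
  e j := Matrix.castTo K (A₂.root j)
  X := A₂.lax φs φl y₁ ls ll
  superdiagonal j p q hpq := by
    have h0 : A₂.root j p q = 0 := by
      cases j <;> fin_cases p <;> fin_cases q <;> first | rfl | exact absurd rfl hpq
    rw [castTo_apply, h0, Int.cast_zero]
  invariant _ _ := castTo_map _ _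
  lower p q hpq := by
    rw [A₂.lax]
    fin_cases p <;> fin_cases q <;> first | rfl | exact absurd hpq (by decide)
  diag_ne := h.diag_ne 3 ![-2, 1, 1] ![-1, -1, 2] A₂.lax_diag (by decide)
  lax := by
    rintro (_ | _)
    · exact A₂.lax_long h
    · exact A₂.lax_short h

theorem A₂.serre (K : Type*) [Field K] :
    IsSerrePair K (Matrix.castTo K (A₂.root true)) (Matrix.castTo K (A₂.root false)) ∧
    ∀ (c : Fin 6 → K) (p q : Fin 3),
      serreComb c (Matrix.castTo K (A₂.root true)) (Matrix.castTo K (A₂.root false)) p q =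
      c 0 * A₂.root true p q + c 1 * A₂.root false p q +
      c 2 * ((!![0, 0, 1; 0, 0, 0; 0, 0, 0] : Matrix (Fin 3) (Fin 3) ℤ) p q : ℤ) +
      c 3 * ((!![0, 0, 0; 0, 0, 0; 0, 0, 0] : Matrix (Fin 3) (Fin 3) ℤ) p q : ℤ) +
      c 4 * ((!![0, 0, 0; 0, 0, 0; 0, 0, 0] : Matrix (Fin 3) (Fin 3) ℤ) p q : ℤ) +
      c 5 * ((!![0, 0, 0; 0, 0, 0; 0, 0, 0] : Matrix (Fin 3) (Fin 3) ℤ) p q : ℤ) :=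
  brackets_castTo (by decide) (by decide) (by decide) (by decide) (by decide) (by decide)

theorem A₂.root_independent [CharZero K] {c : Fin 6 → K} (hc : serreComb c
    (Matrix.castTo K (A₂.root true)) (Matrix.castTo K (A₂.root false)) = 0) :
    c 0 = 0 ∧ c 1 = 0 ∧ c 2 = 0 := by
  have h : ∀ p q, _ = (0 : K) := fun p q =>
    ((A₂.serre K).2 c p q).symm.trans (congrFun (congrFun hc p) q)
  refine ⟨?_, ?_, ?_⟩
  · simpa [A₂.root] using h 0 1
  · simpa [A₂.root] using h 1 2
  · simpa [A₂.root] using h 0 2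

end Explicit

/-! ### Type `B₂` -/

section Explicit

open Matrix

variable {k K : Type*} [Field k] [Field K] [Algebra k K]
variable {σ : Bool → K ≃ₐ[k] K} {t : Bool → K} {φs φl y₁ y₂ y₃ y₄ ls ll : K}

/-- The short and the long root vector of type `B₂`, for `true` and `false`, in a representation of
dimension `4`. -/
def B₂.root : Bool → Matrix (Fin 4) (Fin 4) ℤ
  | true => !![0, 1, 0, 0; 0, 0, 0, 0; 0, 0, 0, 1; 0, 0, 0, 0]
  | false => !![0, 0, 0, 0; 0, 0, 1, 0; 0, 0, 0, 0; 0, 0, 0, 0]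

theorem B₂.expNil_short [CharZero K] (u : K) : expNil u (Matrix.castTo K (B₂.root true)) =
    !![1, u, 0, 0; 0, 1, 0, 0; 0, 0, 1, u; 0, 0, 0, 1] := by
  have h2 : B₂.root true ^ 2 = !![0, 0, 0, 0; 0, 0, 0, 0; 0, 0, 0, 0; 0, 0, 0, 0] := by decide
  have h3 : B₂.root true ^ 3 = 0 := by rw [pow_succ, h2]; decide
  rw [expNil_of_pow_three_eq_zero (by rw [castTo_pow, h3, castTo_zero]), castTo_pow, h2, B₂.root]
  ext i j
  fin_cases i <;> fin_cases j <;> simp [castTo_apply]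

theorem B₂.expNil_long [CharZero K] (u : K) : expNil u (Matrix.castTo K (B₂.root false)) =
    !![1, 0, 0, 0; 0, 1, u, 0; 0, 0, 1, 0; 0, 0, 0, 1] := by
  have h2 : B₂.root false ^ 2 = 0 := by decide
  rw [expNil_of_pow_three_eq_zero (by rw [castTo_pow, pow_succ, h2, zero_mul, castTo_zero]),
    castTo_pow, h2, B₂.root]
  ext i j
  fin_cases i <;> fin_cases j <;> simp [castTo_apply]

/-- The Lax matrix of type `B₂`: the diagonal entries are linear combinations of `ls` and `ll`,
given by the weights of the representation; below them are `φs`, `φl` and their brackets. -/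
def B₂.lax (φs φl y₁ y₂ ls ll : K) : Matrix (Fin 4) (Fin 4) K :=
  !![-(ls + ll), 0, 0, 0; φs, -ll, 0, 0; -y₁, 2 * φl, ll, 0; -y₂, y₁, φs, ls + ll]

theorem B₂.map_lax (s : K ≃ₐ[k] K) : (B₂.lax φs φl y₁ y₂ ls ll).map s =
    B₂.lax (s φs) (s φl) (s y₁) (s y₂) (s ls) (s ll) := by
  rw [B₂.lax, B₂.lax]
  ext i j
  fin_cases i <;> fin_cases j <;> simp [map_ofNat, add_comm]

theorem B₂.lax_short [CharZero K] (h : RankTwoAction σ t 2 φs φl y₁ y₂ 0 0 ls ll) :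
    (B₂.lax φs φl y₁ y₂ ls ll).map (σ true) * expNil (t true) (Matrix.castTo K (B₂.root true)) =
      expNil (t true) (Matrix.castTo K (B₂.root true)) * B₂.lax φs φl y₁ y₂ ls ll := by
  rw [B₂.map_lax, h.short_φs, h.short_φl, h.short_y₁, h.short_y₂, h.short_ls,
    h.short_ll, B₂.expNil_short, ← h.t_short]
  generalize t true = u
  rw [B₂.lax, B₂.lax]
  ext i j
  fin_cases i <;> fin_cases j <;> simp [Matrix.mul_apply, Fin.sum_univ_succ] <;> ring

theorem B₂.lax_long [CharZero K] (h : RankTwoAction σ t 2 φs φl y₁ y₂ 0 0 ls ll) :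
    (B₂.lax φs φl y₁ y₂ ls ll).map (σ false) * expNil (t false) (Matrix.castTo K (B₂.root false)) =
      expNil (t false) (Matrix.castTo K (B₂.root false)) * B₂.lax φs φl y₁ y₂ ls ll := by
  rw [B₂.map_lax, h.long_φs, h.long_φl, h.long_y₁, h.long_y₂, h.long_ls,
    h.long_ll, B₂.expNil_long, ← h.t_long]
  generalize t false = u
  rw [B₂.lax, B₂.lax]
  ext i j
  fin_cases i <;> fin_cases j <;> simp [Matrix.mul_apply, Fin.sum_univ_succ] <;> ring

theorem B₂.lax_diag [CharZero K] (p : Fin 4) : ((1 : ℤ) : K) * B₂.lax φs φl y₁ y₂ ls ll p p =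
    ((![-1, 0, 0, 1] : Fin 4 → ℤ) p : K) * ls + ((![-1, -1, 1, 1] : Fin 4 → ℤ) p : K) * ll := by
  rw [B₂.lax]
  fin_cases p <;> simp
  ring

/-- The matrix `B₂.lax` is a Lax matrix for every rank two action of type `B₂`. -/
def B₂.laxMatrix [CharZero K] (h : RankTwoAction σ t 2 φs φl y₁ y₂ 0 0 ls ll) :
    LaxMatrix σ t 4 where
  e j := Matrix.castTo K (B₂.root j)
  X := B₂.lax φs φl y₁ y₂ ls ll
  superdiagonal j p q hpq := by
    have h0 : B₂.root j p q = 0 := by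
      cases j <;> fin_cases p <;> fin_cases q <;> first | rfl | exact absurd rfl hpq
    rw [castTo_apply, h0, Int.cast_zero]
  invariant _ _ := castTo_map _ _
  lower p q hpq := by
    rw [B₂.lax]
    fin_cases p <;> fin_cases q <;> first | rfl | exact absurd hpq (by decide)
  diag_ne := h.diag_ne 1 ![-1, 0, 0, 1] ![-1, -1, 1, 1] B₂.lax_diag (by decide)
  lax := by
    rintro (_ | _)
    · exact B₂.lax_long h
    · exact B₂.lax_short h

theorem B₂.serre (K : Type*) [Field K] :
    IsSerrePair K (Matrix.castTo K (B₂.root true)) (Matrix.castTo K (B₂.root false)) ∧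
    ∀ (c : Fin 6 → K) (p q : Fin 4),
      serreComb c (Matrix.castTo K (B₂.root true)) (Matrix.castTo K (B₂.root false)) p q =
      c 0 * B₂.root true p q + c 1 * B₂.root false p q +
      c 2 * ((!![0, 0, 1, 0; 0, 0, 0, -1; 0, 0, 0, 0; 0, 0, 0, 0] :
        Matrix (Fin 4) (Fin 4) ℤ) p q : ℤ) +
      c 3 * ((!![0, 0, 0, -2; 0, 0, 0, 0; 0, 0, 0, 0; 0, 0, 0, 0] :
        Matrix (Fin 4) (Fin 4) ℤ) p q : ℤ) +
      c 4 * ((!![0, 0, 0, 0; 0, 0, 0, 0; 0, 0, 0, 0; 0, 0, 0, 0] :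
        Matrix (Fin 4) (Fin 4) ℤ) p q : ℤ) +
      c 5 * ((!![0, 0, 0, 0; 0, 0, 0, 0; 0, 0, 0, 0; 0, 0, 0, 0] :
        Matrix (Fin 4) (Fin 4) ℤ) p q : ℤ) :=
  brackets_castTo (by decide) (by decide) (by decide) (by decide) (by decide) (by decide)

theorem B₂.root_independent [CharZero K] {c : Fin 6 → K} (hc : serreComb c
    (Matrix.castTo K (B₂.root true)) (Matrix.castTo K (B₂.root false)) = 0) :
    c 0 = 0 ∧ c 1 = 0 ∧ c 2 = 0 ∧ c 3 = 0 := by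
  have h : ∀ p q, _ = (0 : K) := fun p q =>
    ((B₂.serre K).2 c p q).symm.trans (congrFun (congrFun hc p) q)
  refine ⟨?_, ?_, ?_, ?_⟩
  · simpa [B₂.root] using h 0 1
  · simpa [B₂.root] using h 1 2
  · simpa [B₂.root] using h 0 2
  · simpa [B₂.root] using h 0 3

end Explicit

/-! ### Type `G₂` -/

section Explicit

open Matrix

variable {k K : Type*} [Field k] [Field K] [Algebra k K]
variable {σ : Bool → K ≃ₐ[k] K} {t : Bool → K} {φs φl y₁ y₂ y₃ y₄ ls ll : K}

/-- The short and the long root vector of type `G₂`, for `true` and `false`, in a representation of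
dimension `7`. -/
def G₂.root : Bool → Matrix (Fin 7) (Fin 7) ℤ
  | true => !![0, 1, 0, 0, 0, 0, 0; 0, 0, 0, 0, 0, 0, 0; 0, 0, 0, 1, 0, 0, 0; 0, 0, 0, 0, 1, 0, 0;
               0, 0, 0, 0, 0, 0, 0; 0, 0, 0, 0, 0, 0, 1; 0, 0, 0, 0, 0, 0, 0]
  | false => !![0, 0, 0, 0, 0, 0, 0; 0, 0, 1, 0, 0, 0, 0; 0, 0, 0, 0, 0, 0, 0;
                0, 0, 0, 0, 0, 0, 0; 0, 0, 0, 0, 0, 1, 0; 0, 0, 0, 0, 0, 0, 0;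
                0, 0, 0, 0, 0, 0, 0]

theorem G₂.expNil_short [CharZero K] (u : K) : expNil u (Matrix.castTo K (G₂.root true)) =
    !![1, u, 0, 0, 0, 0, 0; 0, 1, 0, 0, 0, 0, 0; 0, 0, 1, u, u ^ 2 / 2, 0, 0; 0, 0, 0, 1, u, 0, 0;
       0, 0, 0, 0, 1, 0, 0; 0, 0, 0, 0, 0, 1, u; 0, 0, 0, 0, 0, 0, 1] := by
  have h2 : G₂.root true ^ 2 = !![0, 0, 0, 0, 0, 0, 0; 0, 0, 0, 0, 0, 0, 0; 0, 0, 0, 0, 1, 0, 0;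
                                  0, 0, 0, 0, 0, 0, 0; 0, 0, 0, 0, 0, 0, 0; 0, 0, 0, 0, 0, 0, 0;
                                  0, 0, 0, 0, 0, 0, 0] := by decide
  have h3 : G₂.root true ^ 3 = 0 := by rw [pow_succ, h2]; decide
  rw [expNil_of_pow_three_eq_zero (by rw [castTo_pow, h3, castTo_zero]), castTo_pow, h2, G₂.root]
  ext i j
  fin_cases i <;> fin_cases j <;> simp [castTo_apply]

theorem G₂.expNil_long [CharZero K] (u : K) : expNil u (Matrix.castTo K (G₂.root false)) =
    !![1, 0, 0, 0, 0, 0, 0; 0, 1, u, 0, 0, 0, 0; 0, 0, 1, 0, 0, 0, 0; 0, 0, 0, 1, 0, 0, 0;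
       0, 0, 0, 0, 1, u, 0; 0, 0, 0, 0, 0, 1, 0; 0, 0, 0, 0, 0, 0, 1] := by
  have h2 : G₂.root false ^ 2 = 0 := by decide
  rw [expNil_of_pow_three_eq_zero (by rw [castTo_pow, pow_succ, h2, zero_mul, castTo_zero]),
    castTo_pow, h2, G₂.root]
  ext i j
  fin_cases i <;> fin_cases j <;> simp [castTo_apply]

/-- The Lax matrix of type `G₂`: the diagonal entries are linear combinations of `ls` and `ll`,
given by the weights of the representation; below them are `φs`, `φl` and their brackets. -/
def G₂.lax (φs φl y₁ y₂ y₃ y₄ ls ll : K) : Matrix (Fin 7) (Fin 7) K :=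
  !![-(2 * ls + 3 * ll), 0, 0, 0, 0, 0, 0; φs, -(ls + 3 * ll), 0, 0, 0, 0, 0;
     -y₁, 3 * φl, -ls, 0, 0, 0, 0; -y₂, 2 * y₁, 2 * φs, 0, 0, 0, 0; -y₃, y₂, 0, 2 * φs, ls, 0, 0;
     -y₄, 0, y₂, -2 * y₁, 3 * φl, ls + 3 * ll, 0; 0, -y₄, y₃, -y₂, y₁, φs, 2 * ls + 3 * ll]

theorem G₂.map_lax (s : K ≃ₐ[k] K) : (G₂.lax φs φl y₁ y₂ y₃ y₄ ls ll).map s =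
    G₂.lax (s φs) (s φl) (s y₁) (s y₂) (s y₃) (s y₄) (s ls) (s ll) := by
  rw [G₂.lax, G₂.lax]
  ext i j
  fin_cases i <;> fin_cases j <;> simp [map_ofNat, add_comm]

theorem G₂.lax_short [CharZero K] (h : RankTwoAction σ t 3 φs φl y₁ y₂ y₃ y₄ ls ll) :
    (G₂.lax φs φl y₁ y₂ y₃ y₄ ls ll).map (σ true) * expNil (t true)
        (Matrix.castTo K (G₂.root true)) =
      expNil (t true) (Matrix.castTo K (G₂.root true)) * G₂.lax φs φl y₁ y₂ y₃ y₄ ls ll := by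
  rw [G₂.map_lax, h.short_φs, h.short_φl, h.short_y₁, h.short_y₂, h.short_y₃, h.short_y₄,
    h.short_ls, h.short_ll, G₂.expNil_short, ← h.t_short]
  generalize t true = u
  rw [G₂.lax, G₂.lax]
  ext i j
  fin_cases i <;> fin_cases j <;> simp [Matrix.mul_apply, Fin.sum_univ_succ] <;> ring

theorem G₂.lax_long [CharZero K] (h : RankTwoAction σ t 3 φs φl y₁ y₂ y₃ y₄ ls ll) :
    (G₂.lax φs φl y₁ y₂ y₃ y₄ ls ll).map (σ false) * expNil (t false)
        (Matrix.castTo K (G₂.root false)) =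
      expNil (t false) (Matrix.castTo K (G₂.root false)) * G₂.lax φs φl y₁ y₂ y₃ y₄ ls ll := by
  rw [G₂.map_lax, h.long_φs, h.long_φl, h.long_y₁, h.long_y₂, h.long_y₃, h.long_y₄, h.long_ls,
    h.long_ll, G₂.expNil_long, ← h.t_long]
  generalize t false = u
  rw [G₂.lax, G₂.lax]
  ext i j
  fin_cases i <;> fin_cases j <;> simp [Matrix.mul_apply, Fin.sum_univ_succ] <;> ring

theorem G₂.lax_diag [CharZero K] (p : Fin 7) : ((1 : ℤ) : K) * G₂.lax φs φl y₁ y₂ y₃ y₄ ls ll p p =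
    ((![-2, -1, -1, 0, 1, 1, 2] : Fin 7 → ℤ) p : K) * ls +
      ((![-3, -3, 0, 0, 0, 3, 3] : Fin 7 → ℤ) p : K) * ll := by
  rw [G₂.lax]
  fin_cases p <;> simp <;> ring

/-- The matrix `G₂.lax` is a Lax matrix for every rank two action of type `G₂`. -/
def G₂.laxMatrix [CharZero K] (h : RankTwoAction σ t 3 φs φl y₁ y₂ y₃ y₄ ls ll) :
    LaxMatrix σ t 7 where
  e j := Matrix.castTo K (G₂.root j)
  X := G₂.lax φs φl y₁ y₂ y₃ y₄ ls ll
  superdiagonal j p q hpq := by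
    have h0 : G₂.root j p q = 0 := by
      cases j <;> fin_cases p <;> fin_cases q <;> first | rfl | exact absurd rfl hpq
    rw [castTo_apply, h0, Int.cast_zero]
  invariant _ _ := castTo_map _ _
  lower p q hpq := by
    rw [G₂.lax]
    fin_cases p <;> fin_cases q <;> first | rfl | exact absurd hpq (by decide)
  diag_ne := h.diag_ne 1 ![-2, -1, -1, 0, 1, 1, 2] ![-3, -3, 0, 0, 0, 3, 3] G₂.lax_diag (by decide)
  lax := by
    rintro (_ | _)
    · exact G₂.lax_long h
    · exact G₂.lax_short h

theorem G₂.serre (K : Type*) [Field K] :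
    IsSerrePair K (Matrix.castTo K (G₂.root true)) (Matrix.castTo K (G₂.root false)) ∧
    ∀ (c : Fin 6 → K) (p q : Fin 7),
      serreComb c (Matrix.castTo K (G₂.root true)) (Matrix.castTo K (G₂.root false)) p q =
      c 0 * G₂.root true p q + c 1 * G₂.root false p q +
      c 2 * ((!![0, 0, 1, 0, 0, 0, 0; 0, 0, 0, -1, 0, 0, 0; 0, 0, 0, 0, 0, 0, 0;
                 0, 0, 0, 0, 0, 1, 0; 0, 0, 0, 0, 0, 0, -1; 0, 0, 0, 0, 0, 0, 0;
                 0, 0, 0, 0, 0, 0, 0] : Matrix (Fin 7) (Fin 7) ℤ) p q : ℤ) +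
      c 3 * ((!![0, 0, 0, -2, 0, 0, 0; 0, 0, 0, 0, 1, 0, 0; 0, 0, 0, 0, 0, 1, 0;
                 0, 0, 0, 0, 0, 0, -2; 0, 0, 0, 0, 0, 0, 0; 0, 0, 0, 0, 0, 0, 0;
                 0, 0, 0, 0, 0, 0, 0] : Matrix (Fin 7) (Fin 7) ℤ) p q : ℤ) +
      c 4 * ((!![0, 0, 0, 0, 3, 0, 0; 0, 0, 0, 0, 0, 0, 0; 0, 0, 0, 0, 0, 0, -3;
                 0, 0, 0, 0, 0, 0, 0; 0, 0, 0, 0, 0, 0, 0; 0, 0, 0, 0, 0, 0, 0;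
                 0, 0, 0, 0, 0, 0, 0] : Matrix (Fin 7) (Fin 7) ℤ) p q : ℤ) +
      c 5 * ((!![0, 0, 0, 0, 0, -3, 0; 0, 0, 0, 0, 0, 0, -3; 0, 0, 0, 0, 0, 0, 0;
                 0, 0, 0, 0, 0, 0, 0; 0, 0, 0, 0, 0, 0, 0; 0, 0, 0, 0, 0, 0, 0;
                 0, 0, 0, 0, 0, 0, 0] : Matrix (Fin 7) (Fin 7) ℤ) p q : ℤ) :=
  brackets_castTo (by decide) (by decide) (by decide) (by decide) (by decide) (by decide)

theorem G₂.root_independent [CharZero K] {c : Fin 6 → K} (hc : serreComb c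
    (Matrix.castTo K (G₂.root true)) (Matrix.castTo K (G₂.root false)) = 0) :
    c 0 = 0 ∧ c 1 = 0 ∧ c 2 = 0 ∧ c 3 = 0 ∧ c 4 = 0 ∧ c 5 = 0 := by
  have h : ∀ p q, _ = (0 : K) := fun p q =>
    ((G₂.serre K).2 c p q).symm.trans (congrFun (congrFun hc p) q)
  refine ⟨?_, ?_, ?_, ?_, ?_, ?_⟩
  · simpa [G₂.root] using h 0 1
  · simpa [G₂.root] using h 1 2
  · simpa [G₂.root] using h 0 2
  · simpa [G₂.root] using h 0 3
  · simpa [G₂.root] using h 0 4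
  · simpa [G₂.root] using h 0 5

end Explicit

/-! ### Braid relations and corner entries in rank two -/

section RankTwo

open Matrix

variable {k K R : Type*} [Field k] [CharZero k] [Field K] [Algebra k K] [CommRing R] [Algebra k R]
variable {σ : Bool → K ≃ₐ[k] K} {t : Bool → K} {φs φl y₁ y₂ y₃ y₄ ls ll : K}
  {D : Bool → Derivation k R R} {hD : ∀ j, (D j).IsLocallyNilpotent} {ι : R →ₐ[k] K}

/-- The braid relation of type `A₂`, on the image of `R`. -/
theorem A₂.pow_apply_eq_self (h : RankTwoAction σ t 1 φs φl y₁ 0 0 0 ls ll)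
    (hσ : ∀ j f, σ j (ι f) = ((D j).expHom (hD j) f).eval₂ (ι : R →+* K) (t j))
    (hDs : IsSerrePair K ((D true).precomp K) ((D false).precomp K))
    (hβ : let β := commutator₂ K (Module.End K (R →ₗ[k] K))
      β ((D true).precomp K) (β ((D true).precomp K) ((D false).precomp K)) = 0) (f : R) :
    ((σ false * σ true) ^ 3) (ι f) = ι f := by
  have : CharZero K := charZero_of_injective_algebraMap (algebraMap k K).injective
  have hprod : (([false, true, false, true, false, true] : List Bool).map σ).prod =
      (σ false * σ true) ^ 3 := by
    simp only [List.map_cons, List.map_nil, List.prod_cons, List.prod_nil, mul_one, pow_succ,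
      pow_zero, one_mul, mul_assoc]
  rw [← hprod]
  refine (A₂.laxMatrix h).prod_apply_eq_self D hD ι hσ (A₂.serre K).1 hDs (fun c hc => ?_)
    (fix_diag 3 ![-2, 1, 1] ![-1, -1, 2] (by norm_num) A₂.lax_diag ?_ ?_) f
  · obtain ⟨h0, h1, h2⟩ := A₂.root_independent hc
    simp only [serreComb, h0, h1, h2, hβ, map_zero, zero_smul, smul_zero, add_zero]
  all_goals
    simp only [List.map_cons, List.map_nil, List.prod_cons, List.prod_nil, mul_one,
      AlgEquiv.mul_apply, h.short_ls, h.short_ll, h.long_ls, h.long_ll, map_add, map_neg, map_mul,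
      map_intCast]
    push_cast
    ring

/-- The corner entry of the product of exponentials for the word `long, short`: this composite maps
the first diagonal entry of the Lax matrix to the last one, which `σ true` fixes. -/
theorem A₂.corner_invariant (h : RankTwoAction σ t 1 φs φl y₁ 0 0 0 ls ll) :
    σ true (σ false (t true) * t false) = σ false (t true) * t false := by
  have : CharZero K := charZero_of_injective_algebraMap (algebraMap k K).injective
  have hG : (A₂.laxMatrix h).dressing [false, true] 0 (Fin.last 2) =
      σ false (t true) * t false := by
    simp only [LaxMatrix.dressing, wordParams, A₂.laxMatrix, List.map_cons, List.map_nil,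
      List.nil_append, List.cons_append, List.prod_cons, List.prod_nil, mul_one,
      A₂.expNil_short, A₂.expNil_long]
    simp [Matrix.mul_apply, Fin.sum_univ_succ, Fin.last]
  have key := (A₂.laxMatrix h).corner_invariant (js := [false, true]) (j := true) ?_ ?_ ?_
  · rwa [hG] at key
  · change (List.map σ _).prod (A₂.lax φs φl y₁ ls ll 0 0) = A₂.lax φs φl y₁ ls ll _ _
    simp [A₂.lax, Fin.last, h.short_ls, h.short_ll, h.long_ls, h.long_ll, map_ofNat]
    ring
  · change σ _ (A₂.lax φs φl y₁ ls ll _ _) = A₂.lax φs φl y₁ ls ll _ _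
    simp [A₂.lax, Fin.last, h.short_ls, h.short_ll, map_ofNat]
    ring
  · intro p
    change Matrix.castTo K (A₂.root true) p _ = 0
    fin_cases p <;> simp [castTo_apply, A₂.root, Fin.last]

/-- The braid relation of type `B₂`, on the image of `R`. -/
theorem B₂.pow_apply_eq_self (h : RankTwoAction σ t 2 φs φl y₁ y₂ 0 0 ls ll)
    (hσ : ∀ j f, σ j (ι f) = ((D j).expHom (hD j) f).eval₂ (ι : R →+* K) (t j))
    (hDs : IsSerrePair K ((D true).precomp K) ((D false).precomp K))
    (hβ : let β := commutator₂ K (Module.End K (R →ₗ[k] K))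
      β ((D true).precomp K) (β ((D true).precomp K) (β ((D true).precomp K)
        ((D false).precomp K))) = 0) (f : R) :
    ((σ false * σ true) ^ 4) (ι f) = ι f := by
  have : CharZero K := charZero_of_injective_algebraMap (algebraMap k K).injective
  have hprod : (([false, true, false, true, false, true, false, true] : List Bool).map σ).prod =
      (σ false * σ true) ^ 4 := by
    simp only [List.map_cons, List.map_nil, List.prod_cons, List.prod_nil, mul_one, pow_succ,
      pow_zero, one_mul, mul_assoc]
  rw [← hprod]
  refine (B₂.laxMatrix h).prod_apply_eq_self D hD ι hσ (B₂.serre K).1 hDs (fun c hc => ?_)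
    (fix_diag 1 ![-1, 0, 0, 1] ![-1, -1, 1, 1] (by norm_num) B₂.lax_diag ?_ ?_) f
  · obtain ⟨h0, h1, h2, h3⟩ := B₂.root_independent hc
    simp only [serreComb, h0, h1, h2, h3, hβ, map_zero, zero_smul, smul_zero, add_zero]
  all_goals
    simp only [List.map_cons, List.map_nil, List.prod_cons, List.prod_nil, mul_one,
      AlgEquiv.mul_apply, h.short_ls, h.short_ll, h.long_ls, h.long_ll, map_add, map_neg, map_mul,
      map_intCast]
    push_cast
    ring

/-- The corner entry of the product of exponentials for the word `short, long, short`: this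
composite maps the first diagonal entry of the Lax matrix to the last one, which `σ false` fixes. -/
theorem B₂.corner_invariant (h : RankTwoAction σ t 2 φs φl y₁ y₂ 0 0 ls ll) :
    σ false (σ true (σ false (t true)) * σ true (t false) * t true) =
      σ true (σ false (t true)) * σ true (t false) * t true := by
  have : CharZero K := charZero_of_injective_algebraMap (algebraMap k K).injective
  have hG : (B₂.laxMatrix h).dressing [true, false, true] 0 (Fin.last 3) =
      σ true (σ false (t true)) * σ true (t false) * t true := by
    simp only [LaxMatrix.dressing, wordParams, B₂.laxMatrix, List.map_cons, List.map_nil,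
      List.nil_append, List.cons_append, List.prod_cons, List.prod_nil, mul_one,
      B₂.expNil_short, B₂.expNil_long]
    simp [Matrix.mul_apply, Fin.sum_univ_succ, Fin.last]
    ring
  have key := (B₂.laxMatrix h).corner_invariant (js := [true, false, true]) (j := false) ?_ ?_ ?_
  · rwa [hG] at key
  · change (List.map σ _).prod (B₂.lax φs φl y₁ y₂ ls ll 0 0) = B₂.lax φs φl y₁ y₂ ls ll _ _
    simp [B₂.lax, Fin.last, h.short_ls, h.short_ll, h.long_ll]
    ring
  · change σ _ (B₂.lax φs φl y₁ y₂ ls ll _ _) = B₂.lax φs φl y₁ y₂ ls ll _ _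
    simp [B₂.lax, Fin.last, h.long_ls, h.long_ll]
    ring
  · intro p
    change Matrix.castTo K (B₂.root false) p _ = 0
    fin_cases p <;> simp [castTo_apply, B₂.root, Fin.last]

/-- The braid relation of type `G₂`, on the image of `R`. -/
theorem G₂.pow_apply_eq_self (h : RankTwoAction σ t 3 φs φl y₁ y₂ y₃ y₄ ls ll)
    (hσ : ∀ j f, σ j (ι f) = ((D j).expHom (hD j) f).eval₂ (ι : R →+* K) (t j))
    (hDs : IsSerrePair K ((D true).precomp K) ((D false).precomp K)) (f : R) :
    ((σ false * σ true) ^ 6) (ι f) = ι f := by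
  have : CharZero K := charZero_of_injective_algebraMap (algebraMap k K).injective
  have hprod : (([false, true, false, true, false, true, false, true, false, true, false, true] :
      List Bool).map σ).prod = (σ false * σ true) ^ 6 := by
    simp only [List.map_cons, List.map_nil, List.prod_cons, List.prod_nil, mul_one, pow_succ,
      pow_zero, one_mul, mul_assoc]
  rw [← hprod]
  refine (G₂.laxMatrix h).prod_apply_eq_self D hD ι hσ (G₂.serre K).1 hDs (fun c hc => ?_)
    (fix_diag 1 ![-2, -1, -1, 0, 1, 1, 2] ![-3, -3, 0, 0, 0, 3, 3] (by norm_num) G₂.lax_diag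
      ?_ ?_) f
  · obtain ⟨h0, h1, h2, h3, h4, h5⟩ := G₂.root_independent hc
    simp only [serreComb, h0, h1, h2, h3, h4, h5, zero_smul, add_zero]
  all_goals
    simp only [List.map_cons, List.map_nil, List.prod_cons, List.prod_nil, mul_one,
      AlgEquiv.mul_apply, h.short_ls, h.short_ll, h.long_ls, h.long_ll, map_add, map_neg, map_mul,
      map_intCast]
    push_cast
    ring

/-- The corner entry of the product of exponentials for the word
`short, long, short, long, short`: this composite maps the first diagonal entry of the Lax matrix to
the last one, which `σ false` fixes. -/
theorem G₂.corner_invariant (h : RankTwoAction σ t 3 φs φl y₁ y₂ y₃ y₄ ls ll) :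
    σ false (σ true (σ false (σ true (σ false (t true)))) * σ true (σ false (σ true (t false))) *
        σ true (σ false (t true)) ^ 2 * σ true (t false) * t true) =
      σ true (σ false (σ true (σ false (t true)))) * σ true (σ false (σ true (t false))) *
        σ true (σ false (t true)) ^ 2 * σ true (t false) * t true := by
  have : CharZero K := charZero_of_injective_algebraMap (algebraMap k K).injective
  have hG : (G₂.laxMatrix h).dressing [true, false, true, false, true] 0 (Fin.last 6) =
      (σ true (σ false (σ true (σ false (t true)))) * σ true (σ false (σ true (t false))) *
        σ true (σ false (t true)) ^ 2 * σ true (t false) * t true) / 2 := by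
    simp only [LaxMatrix.dressing, wordParams, G₂.laxMatrix, List.map_cons, List.map_nil,
      List.nil_append, List.cons_append, List.prod_cons, List.prod_nil, mul_one,
      G₂.expNil_short, G₂.expNil_long]
    simp [Matrix.mul_apply, Fin.sum_univ_succ, Fin.last]
    ring
  have key := (G₂.laxMatrix h).corner_invariant (js := [true, false, true, false, true])
    (j := false) ?_ ?_ ?_
  · rw [hG, map_div₀, map_ofNat] at key
    exact (div_left_inj' two_ne_zero).1 key
  · change (List.map σ _).prod (G₂.lax φs φl y₁ y₂ y₃ y₄ ls ll 0 0) =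
      G₂.lax φs φl y₁ y₂ y₃ y₄ ls ll _ _
    simp [G₂.lax, Fin.last, h.short_ls, h.short_ll, h.long_ls, h.long_ll, map_ofNat]
    ring
  · change σ _ (G₂.lax φs φl y₁ y₂ y₃ y₄ ls ll _ _) = G₂.lax φs φl y₁ y₂ y₃ y₄ ls ll _ _
    simp [G₂.lax, Fin.last, h.long_ls, h.long_ll, map_ofNat]
    ring
  · intro p
    change Matrix.castTo K (G₂.root false) p _ = 0
    fin_cases p <;> simp [castTo_apply, G₂.root, Fin.last]

end RankTwo

/-! ### Hamiltonian derivations and their exponentials -/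

namespace PoissonBracket

variable {A₀ : Type v} [CommRing A₀] [Algebra ℂ A₀] (P : PoissonBracket A₀)

/-- The Hamiltonian derivation `{f, ·}`. -/
def ad (f : A₀) : Derivation ℂ A₀ A₀ :=
  Derivation.mk' (P.bracket f) fun g h => by
    rw [P.mul_right, smul_eq_mul, smul_eq_mul, add_comm, mul_comm h]

theorem bracket_self (f : A₀) : P.bracket f f = 0 := by
  have h2 : (2 : ℂ) • P.bracket f f = 0 := by
    rw [two_smul]
    nth_rewrite 1 [P.skew f f]
    exact neg_add_cancel _
  exact (smul_eq_zero.1 h2).resolve_left two_ne_zero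

theorem leibniz_bracket (f g h : A₀) :
    P.bracket f (P.bracket g h) = P.bracket (P.bracket f g) h + P.bracket g (P.bracket f h) := by
  have := P.jacobi f g h
  rw [P.skew h f, map_neg, P.skew h (P.bracket f g)] at this
  linear_combination this

theorem iterate_bilinear_eq_zero {D : A₀ →ₗ[ℂ] A₀} {β : A₀ →ₗ[ℂ] A₀ →ₗ[ℂ] A₀}
    (hβ : ∀ f g, D (β f g) = β (D f) g + β f (D g)) (n : ℕ) {f g : A₀} {a b : ℕ}
    (hf : D^[a] f = 0) (hg : D^[b] g = 0) (hn : a + b ≤ n) : D^[n] (β f g) = 0 := by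
  induction n generalizing f g a b with
  | zero =>
    obtain rfl : a = 0 := by omega
    rw [Function.iterate_zero_apply] at hf
    simp [hf]
  | succ n ih =>
    rcases a with _ | a
    · rw [Function.iterate_zero_apply] at hf
      rw [hf, map_zero, LinearMap.zero_apply, iterate_map_zero]
    rcases b with _ | b
    · rw [Function.iterate_zero_apply] at hg
      rw [hg, map_zero, iterate_map_zero]
    rw [Function.iterate_succ_apply, hβ, iterate_map_add, ih (a := a) (b := b + 1) hf hg (by omega),
      ih (a := a + 1) (b := b) hf hg (by omega), add_zero]

/-- The elements on which `{f, ·}` acts nilpotently form a Poisson subalgebra, so that it suffices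
to test local nilpotency on generators. -/
theorem ad_isLocallyNilpotent {s : Set A₀} (hs : P.IsGeneratedBy s) (f : A₀)
    (h : ∀ g ∈ s, ∃ n, (P.bracket f)^[n] g = 0) : (P.ad f).IsLocallyNilpotent := by
  let B : Subalgebra ℂ A₀ :=
    { carrier := {g | ∃ n, (P.bracket f)^[n] g = 0}
      mul_mem' := fun {g h} ⟨m, hm⟩ ⟨n, hn⟩ =>
        ⟨m + n, iterate_bilinear_eq_zero (β := LinearMap.mul ℂ A₀)
          (fun f' g' => P.mul_right f f' g') _ hm hn le_rfl⟩
      add_mem' := fun {g h} ⟨m, hm⟩ ⟨n, hn⟩ => ⟨m + n, by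
        have hg : (P.bracket f)^[m + n] g = 0 := (P.ad f).iterate_eq_zero hm (Nat.le_add_right m n)
        have hh : (P.bracket f)^[m + n] h = 0 := (P.ad f).iterate_eq_zero hn (Nat.le_add_left n m)
        rw [iterate_map_add, hg, hh, add_zero]⟩
      algebraMap_mem' := fun c => ⟨1, (P.ad f).map_algebraMap c⟩ }
  have hB : B = ⊤ := hs B h fun g ⟨m, hm⟩ h ⟨n, hn⟩ =>
    ⟨m + n, iterate_bilinear_eq_zero (β := P.bracket) (fun f' g' => P.leibniz_bracket f f' g')
      _ hm hn le_rfl⟩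
  intro g
  have hg : g ∈ B := hB ▸ Algebra.mem_top
  exact hg

theorem bracket_bracket_self (f g : A₀) :
    P.bracket (P.bracket g f) f = P.bracket f (P.bracket f g) := by
  rw [P.skew (P.bracket g f), P.skew g f, map_neg, neg_neg]

theorem precomp_ad_zero (K : Type*) [Field K] [Algebra ℂ K] : (P.ad 0).precomp K = 0 := by
  ext h x
  change h (P.bracket 0 x) = 0
  rw [map_zero, LinearMap.zero_apply, map_zero]

/-- Precomposition reverses the order of composition. -/
theorem commutator₂_precomp_ad (K : Type*) [Field K] [Algebra ℂ K] (f g : A₀) :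
    commutator₂ K _ ((P.ad f).precomp K) ((P.ad g).precomp K) =
      (P.ad (P.bracket g f)).precomp K := by
  ext h x
  change h (P.bracket g (P.bracket f x)) - h (P.bracket f (P.bracket g x)) =
    h (P.bracket (P.bracket g f) x)
  rw [P.leibniz_bracket g f x, map_add, add_sub_cancel_right]

end PoissonBracket

namespace GCM

section adPoly

variable {I : Type u} {A₀ : Type v} [CommRing A₀] [Algebra ℂ A₀] (P : PoissonBracket A₀)

open MvPolynomial

theorem coeff_adPoly (f : A₀) (p : MvPolynomial I A₀) (m : I →₀ ℕ) :
    (adPoly P f p).coeff m = P.bracket f (p.coeff m) := by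
  classical
  rw [adPoly, coeff_sum]
  simp only [coeff_monomial]
  rw [Finset.sum_ite_eq']
  split_ifs with h
  · rfl
  · rw [notMem_support_iff.1 h, map_zero]

theorem coeff_iterate_adPoly (f : A₀) (n : ℕ) (p : MvPolynomial I A₀) (m : I →₀ ℕ) :
    ((adPoly P f)^[n] p).coeff m = (P.bracket f)^[n] (p.coeff m) := by
  induction n generalizing p with
  | zero => rfl
  | succ n ih => rw [Function.iterate_succ_apply, ih, coeff_adPoly, Function.iterate_succ_apply]

theorem exists_iterate_adPoly_eq_zero {f : A₀} (hf : (P.ad f).IsLocallyNilpotent)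
    (p : MvPolynomial I A₀) : ∃ N, (adPoly P f)^[N] p = 0 := by
  choose n hn using hf
  refine ⟨p.support.sup fun m => n (p.coeff m), ?_⟩
  ext m
  rw [coeff_iterate_adPoly, coeff_zero]
  by_cases h : m ∈ p.support
  · exact (P.ad f).iterate_eq_zero (hn (p.coeff m)) (Finset.le_sup (f := fun m => n (p.coeff m)) h)
  · rw [notMem_support_iff.1 h, iterate_map_zero]

/-- The derivation `{f, ·}` of `A₀[λ]`, as a linear map. -/
noncomputable def adPolyLinear (f : A₀) : MvPolynomial I A₀ →ₗ[ℂ] MvPolynomial I A₀ where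
  toFun := adPoly P f
  map_add' p q := by ext m; simp only [coeff_adPoly, coeff_add, map_add]
  map_smul' c p := by ext m; simp only [coeff_adPoly, coeff_smul, map_smul, RingHom.id_apply]

theorem adPolyLinear_C_mul {f g : A₀} (h : P.bracket f g = 0) (p : MvPolynomial I A₀) :
    adPolyLinear P f (C g * p) = C g * adPolyLinear P f p := by
  ext m
  change coeff m (adPoly P f _) = coeff m (C g * adPoly P f p)
  rw [coeff_adPoly, coeff_C_mul, coeff_C_mul, coeff_adPoly, P.mul_right, h, zero_mul, zero_add]

theorem adPolyLinear_X_mul (f : A₀) (i : I) (p : MvPolynomial I A₀) :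
    adPolyLinear P f (X i * p) = X i * adPolyLinear P f p := by
  classical
  ext m
  change coeff m (adPoly P f _) = coeff m (X i * adPoly P f p)
  rw [coeff_adPoly, coeff_X_mul', coeff_X_mul']
  split_ifs
  · rw [coeff_adPoly]
  · rw [map_zero]

end adPoly

variable {I : Type u} (A : GCM I) {A₀ : Type v} [CommRing A₀]

variable (A₀) in
/-- The variable `λ i` in the function field. -/
noncomputable def lam (i : I) : A.FunctionField A₀ :=
  algebraMap (MvPolynomial I A₀) (A.FunctionField A₀) (MvPolynomial.X i)

theorem phiK_ne_zero [IsDomain A₀] {φ : I → A₀} (hφ : ∀ i, φ i ≠ 0) (i : I) :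
    A.phiK φ i ≠ 0 := by
  rw [phiK, Ne, IsFractionRing.to_map_eq_zero_iff, MvPolynomial.C_eq_zero]
  exact hφ i

theorem _root_.MvPolynomial.map_eq_sum {S : Type*} [CommRing S] (g : MvPolynomial I A₀ →+* S)
    (p : MvPolynomial I A₀) {s : Finset (I →₀ ℕ)} (hs : p.support ⊆ s) :
    g p = ∑ m ∈ s, g (MvPolynomial.C (p.coeff m)) * g (MvPolynomial.monomial m 1) := by
  have h : p = ∑ m ∈ s, MvPolynomial.C (p.coeff m) * MvPolynomial.monomial m 1 := by
    conv_lhs => rw [← MvPolynomial.support_sum_monomial_coeff p]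
    rw [Finset.sum_subset hs]
    · exact Finset.sum_congr rfl fun m _ => by rw [MvPolynomial.C_mul_monomial, mul_one]
    · intro m _ hm
      rw [MvPolynomial.notMem_support_iff.1 hm, map_zero]
  conv_lhs => rw [h]
  simp only [map_sum, map_mul]

variable (A₀) in
/-- The inclusion of `A₀` into the function field. -/
noncomputable def inclK [Algebra ℂ A₀] : A₀ →ₐ[ℂ] A.FunctionField A₀ :=
  ((Algebra.ofId (MvPolynomial I A₀) (A.FunctionField A₀)).restrictScalars ℂ).comp
    ((Algebra.ofId A₀ (MvPolynomial I A₀)).restrictScalars ℂ)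

theorem inclK_apply [Algebra ℂ A₀] (f : A₀) : A.inclK A₀ f =
    algebraMap (MvPolynomial I A₀) (A.FunctionField A₀) (MvPolynomial.C f) := rfl

variable [IsDomain A₀] [Algebra ℂ A₀]

/-- The parameter `λ i / φ i`. -/
noncomputable def param (φ : I → A₀) (i : I) : A.FunctionField A₀ := A.lam A₀ i / A.phiK φ i

variable (P : PoissonBracket A₀) {φ : I → A₀} (hN : ∀ i, (P.ad (φ i)).IsLocallyNilpotent)

/-- The homomorphism `exp (λ i / φ i · {φ i, ·})` from `A₀[λ]` to the function field. -/
noncomputable def expK (i : I) : MvPolynomial I A₀ →+* A.FunctionField A₀ :=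
  MvPolynomial.eval₂Hom ((Polynomial.eval₂RingHom (A.inclK A₀ : A₀ →+* A.FunctionField A₀)
    (A.param φ i)).comp ((P.ad (φ i)).expHom (hN i) : A₀ →+* Polynomial A₀)) (A.lam A₀)

theorem expK_C (i : I) (f : A₀) : A.expK P hN i (MvPolynomial.C f) =
    ((P.ad (φ i)).expHom (hN i) f).eval₂ (A.inclK A₀ : A₀ →+* A.FunctionField A₀)
      (A.param φ i) := by
  rw [expK, MvPolynomial.eval₂Hom_C]
  rfl

theorem expK_X (i j : I) : A.expK P hN i (MvPolynomial.X j) = A.lam A₀ j := by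
  rw [expK, MvPolynomial.eval₂Hom_X']

theorem expK_monomial_one (i : I) (m : I →₀ ℕ) : A.expK P hN i (MvPolynomial.monomial m 1) =
    algebraMap (MvPolynomial I A₀) (A.FunctionField A₀) (MvPolynomial.monomial m 1) := by
  rw [MvPolynomial.monomial_eq, map_mul, map_mul, Finsupp.prod, map_prod, map_prod]
  simp only [map_one, map_pow, expK_X]
  rfl

/-- The terminating exponential series computes `expK`. -/
theorem expK_eq_sum (i : I) {N : ℕ} {p : MvPolynomial I A₀} (hp : (adPoly P (φ i))^[N] p = 0) :
    A.expK P hN i p = ∑ n ∈ Finset.range N, ((n.factorial : A.FunctionField A₀))⁻¹ *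
        (algebraMap (MvPolynomial I A₀) (A.FunctionField A₀) (MvPolynomial.X i) /
          A.phiK φ i) ^ n *
        algebraMap (MvPolynomial I A₀) (A.FunctionField A₀) ((adPoly P (φ i))^[n] p) := by
  have hsupp : ∀ n, ((adPoly P (φ i))^[n] p).support ⊆ p.support := by
    intro n m hm
    rw [MvPolynomial.mem_support_iff, coeff_iterate_adPoly] at hm
    rw [MvPolynomial.mem_support_iff]
    intro h
    rw [h, iterate_map_zero] at hm
    exact hm rfl
  rw [MvPolynomial.map_eq_sum (A.expK P hN i) p subset_rfl]
  simp only [MvPolynomial.map_eq_sum (algebraMap (MvPolynomial I A₀) (A.FunctionField A₀)) _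
    (hsupp _), Finset.mul_sum]
  rw [Finset.sum_comm]
  refine Finset.sum_congr rfl fun m _ => ?_
  have h0 : (P.ad (φ i))^[N] (p.coeff m) = 0 := by
    have := coeff_iterate_adPoly P (φ i) N p m
    rw [hp] at this
    exact this.symm
  rw [expK_C, expK_monomial_one, (P.ad (φ i)).eval₂_expHom (hN i) _ _ h0, Finset.sum_mul]
  refine Finset.sum_congr rfl fun n _ => ?_
  rw [coeff_iterate_adPoly, ← inclK_apply, RingHom.coe_coe, map_smul, Algebra.smul_def, map_inv₀,
    map_natCast]
  change _ * A.inclK A₀ ((P.bracket (φ i))^[n] (p.coeff m)) * _ ^ n * _ = _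
  rw [param, lam]
  ring

/-- Since `{φ i, ·}` is locally nilpotent, the terminating series in the definition of a birational
reflection is the homomorphism `expK`. -/
theorem isBirationalReflection_iff (s : I → (A.FunctionField A₀ ≃ₐ[ℂ] A.FunctionField A₀)) :
    A.IsBirationalReflection P φ s ↔ ∀ i p,
      s i (algebraMap (MvPolynomial I A₀) (A.FunctionField A₀) p) =
        A.expK P hN i (A.lambdaReflection A₀ i p) := by
  refine forall_congr' fun i => forall_congr' fun p => ⟨?_, fun h => ?_⟩
  · rintro ⟨N, h0, h⟩
    rw [h, A.expK_eq_sum P hN i h0]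
  · obtain ⟨N, hp⟩ := exists_iterate_adPoly_eq_zero P (hN i) (A.lambdaReflection A₀ i p)
    exact ⟨N, hp, by rw [h, A.expK_eq_sum P hN i hp]⟩

end GCM

/-! ### Existence and uniqueness of the birational reflections -/

namespace GCM

variable {I : Type u} (A : GCM I) {A₀ : Type v} [CommRing A₀]

theorem lambdaReflection_X (i j : I) : A.lambdaReflection A₀ i (MvPolynomial.X j) =
    MvPolynomial.X j - A.a j i • MvPolynomial.X i :=
  MvPolynomial.aeval_X _ _

theorem lambdaReflection_involutive (i : I) :
    Function.Involutive (A.lambdaReflection A₀ i) := by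
  intro p
  rw [← AlgHom.comp_apply]
  refine (DFunLike.congr_fun (?_ : _ = AlgHom.id A₀ _) p)
  ext1 j
  rw [AlgHom.comp_apply, lambdaReflection_X, map_sub, map_zsmul, lambdaReflection_X,
    lambdaReflection_X, A.diag, AlgHom.id_apply]
  module

variable [IsDomain A₀] [Algebra ℂ A₀]
variable (P : PoissonBracket A₀) {φ : I → A₀} (hN : ∀ i, (P.ad (φ i)).IsLocallyNilpotent)

/-- Clear the denominators of the exponential series and apply the highest power of `{φ i, ·}` that
does not kill the argument: only the leading term survives. -/
theorem expK_injective (hφ : ∀ i, φ i ≠ 0) (i : I) : Function.Injective (A.expK P hN i) := by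
  rw [injective_iff_map_eq_zero]
  intro p hp
  by_contra hp0
  classical
  have hex := exists_iterate_adPoly_eq_zero P (hN i) p
  obtain ⟨N, hN1⟩ : ∃ N, Nat.find hex = N + 1 := by
    refine Nat.exists_eq_succ_of_ne_zero fun h => hp0 ?_
    have := Nat.find_spec hex
    rwa [h, Function.iterate_zero_apply] at this
  have h1 : (adPoly P (φ i))^[N + 1] p = 0 := hN1 ▸ Nat.find_spec hex
  have h2 : (adPoly P (φ i))^[N] p ≠ 0 := Nat.find_min hex (by omega)
  set T : Module.End ℂ (MvPolynomial I A₀) := adPolyLinear P (φ i) with hT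
  have hTpow : ∀ n, (adPoly P (φ i))^[n] p = (T ^ n) p := fun n => by
    rw [Module.End.pow_apply]; rfl
  rw [hTpow] at h1 h2
  set x : MvPolynomial I A₀ := MvPolynomial.X i
  set y : MvPolynomial I A₀ := MvPolynomial.C (φ i) with hy
  have hxT : ∀ (n m : ℕ) (q : MvPolynomial I A₀), (T ^ m) (x ^ n * q) = x ^ n * (T ^ m) q := by
    intro n m q
    induction m generalizing q with
    | zero => rfl
    | succ m ih =>
      rw [pow_succ, Module.End.mul_apply, Module.End.mul_apply, ← ih]
      congr 1
      clear ih
      induction n with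
      | zero => simp
      | succ n ihn => rw [pow_succ', mul_assoc, hT, adPolyLinear_X_mul, ← hT, ihn, mul_assoc]
  have hyT : ∀ (n m : ℕ) (q : MvPolynomial I A₀), (T ^ m) (y ^ n * q) = y ^ n * (T ^ m) q := by
    intro n m q
    induction m generalizing q with
    | zero => rfl
    | succ m ih =>
      rw [pow_succ, Module.End.mul_apply, Module.End.mul_apply, ← ih]
      congr 1
      clear ih
      induction n with
      | zero => simp
      | succ n ihn =>
        rw [pow_succ', mul_assoc, hT, adPolyLinear_C_mul P (P.bracket_self _), ← hT, ihn, mul_assoc]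
  -- The sum below is `φ ^ N · exp (λ / φ · T) p`, a polynomial in `λ`.
  have hq : ∑ n ∈ Finset.range (N + 1), (n.factorial : ℂ)⁻¹ • (x ^ n * (y ^ (N - n) * (T ^ n) p))
      = 0 := by
    apply IsFractionRing.injective (MvPolynomial I A₀) (A.FunctionField A₀)
    rw [map_zero, ← mul_zero (A.phiK φ i ^ N), ← hp,
      A.expK_eq_sum P hN i (N := N + 1) (by rw [hTpow]; exact h1), map_sum, Finset.mul_sum]
    refine Finset.sum_congr rfl fun n hn => ?_
    obtain ⟨k, hk⟩ := Nat.exists_eq_add_of_le (Finset.mem_range_succ_iff.1 hn)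
    rw [hTpow, Algebra.smul_def, map_mul, map_mul, map_mul, map_pow, map_pow,
      ← IsScalarTower.algebraMap_apply, map_inv₀, map_natCast, hk, Nat.add_sub_cancel_left,
      show algebraMap _ _ y = A.phiK φ i from rfl]
    have := A.phiK_ne_zero hφ i
    change _ = _ * (_ * (algebraMap _ _ x / _) ^ n * _)
    rw [div_pow, pow_add]
    field_simp
  have hq' := congrArg (T ^ N) hq
  rw [map_zero, map_sum, Finset.sum_eq_single 0] at hq'
  · simp only [Nat.factorial_zero, Nat.cast_one, inv_one, one_smul, pow_zero, one_mul, Nat.sub_zero,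
      Module.End.one_apply, hyT] at hq'
    refine h2 ((mul_eq_zero.1 hq').resolve_left (pow_ne_zero _ ?_))
    rw [hy, Ne, MvPolynomial.C_eq_zero]
    exact hφ i
  · intro n _ hn
    obtain ⟨m, rfl⟩ := Nat.exists_eq_succ_of_ne_zero hn
    rw [map_smul, hxT, hyT, ← Module.End.mul_apply, ← pow_add,
      show N + m.succ = m + (N + 1) by omega, pow_add, Module.End.mul_apply, h1, map_zero, mul_zero,
      mul_zero, smul_zero]
  · simp

/-- The endomorphism of the function field that is given on `A₀[λ]` by
`exp (λ i / φ i · {φ i, ·}) ∘ r i`. -/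
noncomputable def reflHom (hφ : ∀ i, φ i ≠ 0) (i : I) :
    A.FunctionField A₀ →ₐ[ℂ] A.FunctionField A₀ :=
  IsFractionRing.liftAlgHom (A := MvPolynomial I A₀)
    (g := { ((A.expK P hN i).comp (A.lambdaReflection A₀ i :
        MvPolynomial I A₀ →+* MvPolynomial I A₀)) with
      commutes' := fun c => by
        change A.expK P hN i (A.lambdaReflection A₀ i (algebraMap ℂ _ c)) = _
        rw [IsScalarTower.algebraMap_apply ℂ A₀, AlgHom.commutes, MvPolynomial.algebraMap_eq,
          expK_C, AlgHom.commutes, Polynomial.algebraMap_apply, Polynomial.eval₂_C,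
          RingHom.coe_coe, AlgHom.commutes] })
    ((A.expK_injective P hN hφ i).comp (A.lambdaReflection_involutive i).injective)

theorem reflHom_algebraMap (hφ : ∀ i, φ i ≠ 0) (i : I) (p : MvPolynomial I A₀) :
    A.reflHom P hN hφ i (algebraMap _ _ p) = A.expK P hN i (A.lambdaReflection A₀ i p) :=
  IsFractionRing.lift_algebraMap
    (g := (A.expK P hN i).comp (A.lambdaReflection A₀ i : MvPolynomial I A₀ →+* MvPolynomial I A₀))
    ((A.expK_injective P hN hφ i).comp (A.lambdaReflection_involutive i).injective) p

/-- The endomorphism `s` of the function field is given on `A₀[λ]` by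
`exp (λ i / φ i · {φ i, ·}) ∘ r i`. -/
def IsReflectionHom (i : I) (s : A.FunctionField A₀ →ₐ[ℂ] A.FunctionField A₀) : Prop :=
  ∀ p, s (algebraMap (MvPolynomial I A₀) _ p) = A.expK P hN i (A.lambdaReflection A₀ i p)

variable {A P hN} {i : I} {s : A.FunctionField A₀ →ₐ[ℂ] A.FunctionField A₀}

namespace IsReflectionHom

theorem map_inclK (hs : A.IsReflectionHom P hN i s) (f : A₀) :
    s (A.inclK A₀ f) = ((P.ad (φ i)).expHom (hN i) f).eval₂
      (A.inclK A₀ : A₀ →+* A.FunctionField A₀) (A.param φ i) := by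
  rw [inclK_apply, hs, ← MvPolynomial.algebraMap_eq, AlgHom.commutes, MvPolynomial.algebraMap_eq,
    expK_C]

theorem map_lam (hs : A.IsReflectionHom P hN i s) (j : I) :
    s (A.lam A₀ j) = A.lam A₀ j - A.a j i * A.lam A₀ i := by
  rw [lam, hs, lambdaReflection_X, map_sub, map_zsmul, expK_X, expK_X, zsmul_eq_mul]
  rfl

theorem map_phiK (hs : A.IsReflectionHom P hN i s) : s (A.phiK φ i) = A.phiK φ i := by
  have h := hs.map_inclK (φ i)
  rw [(P.ad (φ i)).eval₂_expHom (hN i) _ _ (N := 1) (P.bracket_self _)] at h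
  rw [Finset.sum_range_one, pow_zero, mul_one, Function.iterate_zero_apply, Nat.factorial_zero,
    Nat.cast_one, inv_one, one_smul] at h
  exact h

theorem map_param (hs : A.IsReflectionHom P hN i s) : s (A.param φ i) = -A.param φ i := by
  rw [param, map_div₀, hs.map_phiK, hs.map_lam, A.diag]
  push_cast
  ring

/-- A birational reflection is an involution, because its parameter `λ i / φ i` changes sign. -/
theorem comp_self (hs : A.IsReflectionHom P hN i s) : s.comp s = AlgHom.id ℂ _ := by
  refine AlgHom.coe_ringHom_injective (IsLocalization.ringHom_ext
    (nonZeroDivisors (MvPolynomial I A₀)) (MvPolynomial.ringHom_ext (fun f => ?_) fun j => ?_))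
  · change s (s (A.inclK A₀ f)) = A.inclK A₀ f
    have : CharZero (A.FunctionField A₀) :=
      charZero_of_injective_algebraMap (algebraMap ℂ (A.FunctionField A₀)).injective
    have h0 : ∀ g, (s : A.FunctionField A₀ →+* A.FunctionField A₀) (A.inclK A₀ g) = _ :=
      fun g => hs.map_inclK g
    let w := fun l => wordPoly (fun _ : Unit => P.ad (φ i)) (fun _ => hN i) (A.inclK A₀) l f
    have h1 : s (A.inclK A₀ f) = (w [(A.param φ i, ())]).eval 1 := by
      have := map_eval_wordPoly (fun _ : Unit => P.ad (φ i)) (fun _ => hN i) (A.inclK A₀) (j := ())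
        h0 [] f
      rwa [wordPoly_nil, Polynomial.eval_C] at this
    have h2 := map_eval_wordPoly (fun _ : Unit => P.ad (φ i)) (fun _ => hN i) (A.inclK A₀) (j := ())
      h0 [(A.param φ i, ())] f
    rw [wordPoly_eq_C _ _ _ (l := List.map _ _ ++ _), Polynomial.eval_C] at h2
    · rw [h1]
      exact h2
    · simp only [List.map_cons, List.map_nil, List.cons_append, List.nil_append, List.prod_cons,
        List.prod_nil, mul_one, RingHom.coe_coe, hs.map_param]
      simpa using PowerSeries.expMul_mul_expMul_neg (-A.param φ i)
        ((P.ad (φ i)).precomp (A.FunctionField A₀))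
  · change s (s (A.lam A₀ j)) = A.lam A₀ j
    rw [hs.map_lam, map_sub, map_mul, map_intCast, hs.map_lam,
      hs.map_lam, A.diag]
    push_cast
    ring
end IsReflectionHom

variable (A P)

theorem existsUnique_isBirationalReflection (hN : ∀ i, (P.ad (φ i)).IsLocallyNilpotent)
    (hφ : ∀ i, φ i ≠ 0) :
    ∃! s, A.IsBirationalReflection P φ s := by
  refine ⟨fun i => AlgEquiv.ofAlgHom (A.reflHom P hN hφ i) (A.reflHom P hN hφ i)
    (IsReflectionHom.comp_self (A.reflHom_algebraMap P hN hφ i))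
    (IsReflectionHom.comp_self (A.reflHom_algebraMap P hN hφ i)), ?_, ?_⟩
  · exact (A.isBirationalReflection_iff P hN _).2 (A.reflHom_algebraMap P hN hφ)
  · intro s hs
    rw [A.isBirationalReflection_iff P hN] at hs
    funext i
    refine AlgEquiv.coe_toAlgHom_injective (AlgHom.coe_ringHom_injective (IsLocalization.ringHom_ext
      (nonZeroDivisors (MvPolynomial I A₀)) (RingHom.ext fun p => ?_)))
    exact (hs i p).trans (A.reflHom_algebraMap P hN hφ i p).symm

end GCM

/-! ### Braid relations on the function field -/

/-- Exponential series of commuting elements commute. -/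
theorem PowerSeries.expMul_commute {K B : Type*} [Field K] [Ring B] [Algebra K B] [CharZero K]
    {e f : B} (h : Commute e f) (u w : K) : Commute (expMul u e) (expMul w f) := by
  ext n
  rw [coeff_mul, coeff_mul, ← Finset.Nat.sum_antidiagonal_swap]
  refine Finset.sum_congr rfl fun p _ => ?_
  rw [coeff_expMul, coeff_expMul, coeff_expMul, coeff_expMul]
  exact ((h.pow_pow _ _).smul_left _).smul_right _

namespace GCM

variable {I : Type u} {A : GCM I} {A₀ : Type v} [CommRing A₀] [Algebra ℂ A₀]

theorem algEquiv_eq_one {g : A.FunctionField A₀ ≃ₐ[ℂ] A.FunctionField A₀}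
    (h1 : ∀ f, g (A.inclK A₀ f) = A.inclK A₀ f) (h2 : ∀ k, g (A.lam A₀ k) = A.lam A₀ k) :
    g = 1 :=
  AlgEquiv.coe_toAlgHom_injective (AlgHom.coe_ringHom_injective (IsLocalization.ringHom_ext
    (nonZeroDivisors (MvPolynomial I A₀)) (MvPolynomial.ringHom_ext h1 h2)))

variable [IsDomain A₀]

variable (A) in
theorem lam_linear_ne_zero {i j : I} (hij : i ≠ j) (a b : ℤ) (hab : a ≠ 0 ∨ b ≠ 0) :
    (a : A.FunctionField A₀) * A.lam A₀ i + b * A.lam A₀ j ≠ 0 := by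
  have : CharZero A₀ := charZero_of_injective_algebraMap (algebraMap ℂ A₀).injective
  classical
  have h : (a : A.FunctionField A₀) * A.lam A₀ i + b * A.lam A₀ j =
      algebraMap (MvPolynomial I A₀) _
        (MvPolynomial.C (a : A₀) * MvPolynomial.X i +
          MvPolynomial.C (b : A₀) * MvPolynomial.X j) := by
    simp [lam]
  rw [h, Ne, IsFractionRing.to_map_eq_zero_iff]
  intro h0
  have hi := congrArg (MvPolynomial.coeff (Finsupp.single i 1)) h0
  have hj := congrArg (MvPolynomial.coeff (Finsupp.single j 1)) h0
  simp only [MvPolynomial.coeff_add, MvPolynomial.coeff_C_mul, MvPolynomial.coeff_X,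
    Finsupp.single_left_inj one_ne_zero, hij, hij.symm, if_true, if_false, mul_one, mul_zero,
    add_zero, zero_add, MvPolynomial.coeff_zero, Int.cast_eq_zero] at hi hj
  tauto

variable {P : PoissonBracket A₀} {φ : I → A₀} {hN : ∀ i, (P.ad (φ i)).IsLocallyNilpotent}
  {s : I → (A.FunctionField A₀ ≃ₐ[ℂ] A.FunctionField A₀)}

namespace IsReflectionHom

theorem map_inclK_eq_sum {i : I} {s : A.FunctionField A₀ →ₐ[ℂ] A.FunctionField A₀}
    (hs : A.IsReflectionHom P hN i s) {N : ℕ} {f : A₀} (hf : (P.bracket (φ i))^[N] f = 0) :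
    s (A.inclK A₀ f) = ∑ n ∈ Finset.range N, A.param φ i ^ n / n.factorial *
      A.inclK A₀ ((P.bracket (φ i))^[n] f) := by
  rw [hs.map_inclK, (P.ad (φ i)).eval₂_expHom (hN i) _ _ hf]
  refine Finset.sum_congr rfl fun n _ => ?_
  rw [RingHom.coe_coe, map_smul, Algebra.smul_def, map_inv₀, map_natCast]
  change _ * A.inclK A₀ ((P.bracket (φ i))^[n] f) * _ = _
  ring

theorem map_inclK_of_bracket_eq_zero {i : I} {s : A.FunctionField A₀ →ₐ[ℂ] A.FunctionField A₀}
    (hs : A.IsReflectionHom P hN i s) {f : A₀} (hf : P.bracket (φ i) f = 0) :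
    s (A.inclK A₀ f) = A.inclK A₀ f := by
  rw [hs.map_inclK_eq_sum (N := 1) hf]
  simp

/-- Two of the automorphisms `s i`, for a short root `i` and a long root `j` joined by at most three
edges, form a rank two action. -/
theorem rankTwoAction (hs : ∀ i, A.IsReflectionHom P hN i (s i)) (hφ : ∀ i, φ i ≠ 0) {i j : I}
    {c : ℤ} (hji : A.a j i = -1) (hij : A.a i j = -c)
    (h2 : P.bracket (φ j) (P.bracket (φ j) (φ i)) = 0) (h4 : (P.bracket (φ i))^[4] (φ j) = 0) :
    let y₁ := P.bracket (φ i) (φ j)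
    let y₂ := P.bracket (φ i) y₁
    let y₃ := P.bracket (φ i) y₂
    RankTwoAction (fun b => bif b then s i else s j)
      (fun b => bif b then A.param φ i else A.param φ j) c (A.inclK A₀ (φ i))
      (A.inclK A₀ (φ j)) (A.inclK A₀ y₁) (A.inclK A₀ y₂) (A.inclK A₀ y₃)
      (A.inclK A₀ (P.bracket (φ j) y₃)) (A.lam A₀ i) (A.lam A₀ j) := by
  intro y₁ y₂ y₃
  have hne : i ≠ j := by
    rintro rfl
    rw [A.diag] at hji
    norm_num at hji
  obtain ⟨z1, z2, z3, z4⟩ := bracket_eq_zero_of_serre P.bracket P.skew P.leibniz_bracket h2 h4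
  have hsi := fun (N : ℕ) (f : A₀) (hf : (P.bracket (φ i))^[N] f = 0) => (hs i).map_inclK_eq_sum hf
  have hsj := fun (N : ℕ) (f : A₀) (hf : (P.bracket (φ j))^[N] f = 0) => (hs j).map_inclK_eq_sum hf
  refine
    { short_φs := (hs i).map_inclK_of_bracket_eq_zero (P.bracket_self _)
      short_φl := (hsi 4 _ h4).trans ?_
      short_y₁ := (hsi 3 _ h4).trans ?_
      short_y₂ := (hsi 2 _ h4).trans ?_
      short_y₃ := (hs i).map_inclK_of_bracket_eq_zero h4
      short_y₄ := (hs i).map_inclK_of_bracket_eq_zero z3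
      short_ls := ((hs i).map_lam _).trans ?_
      short_ll := ((hs i).map_lam _).trans ?_
      long_φs := (hsj 2 _ h2).trans ?_
      long_φl := (hs j).map_inclK_of_bracket_eq_zero (P.bracket_self _)
      long_y₁ := (hs j).map_inclK_of_bracket_eq_zero z1
      long_y₂ := (hs j).map_inclK_of_bracket_eq_zero z2
      long_y₃ := (hsj 2 _ z4).trans ?_
      long_y₄ := (hs j).map_inclK_of_bracket_eq_zero z4
      long_ls := ((hs j).map_lam _).trans ?_
      long_ll := ((hs j).map_lam _).trans ?_
      t_short := div_mul_cancel₀ _ (A.phiK_ne_zero hφ i)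
      t_long := div_mul_cancel₀ _ (A.phiK_ne_zero hφ j)
      ne_zero := A.lam_linear_ne_zero hne }
  · simp [Finset.sum_range_succ, y₁, y₂, y₃, Nat.factorial]
  · simp [Finset.sum_range_succ, y₁, y₂, y₃, Nat.factorial]
  · simp [Finset.sum_range_succ, y₁, y₂, y₃, Nat.factorial]
  · rw [A.diag]; push_cast; ring
  · rw [hji]; push_cast; ring
  · rw [Finset.sum_range_succ, Finset.sum_range_one, Function.iterate_one, P.skew (φ j) (φ i),
      map_neg]
    simp [y₁]
    ring
  · simp [Finset.sum_range_succ, y₁, y₂, y₃]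
  · rw [hij]; push_cast; ring
  · rw [A.diag]; push_cast; ring

theorem isSerrePair_precomp {i j : I} (h2 : P.bracket (φ j) (P.bracket (φ j) (φ i)) = 0)
    (h4 : (P.bracket (φ i))^[4] (φ j) = 0) : IsSerrePair (A.FunctionField A₀)
      ((P.ad (φ i)).precomp (A.FunctionField A₀)) ((P.ad (φ j)).precomp (A.FunctionField A₀)) := by
  simp only [IsSerrePair, P.commutator₂_precomp_ad, P.bracket_bracket_self]
  simp only [Function.iterate_succ_apply', Function.iterate_zero_apply] at h4
  rw [h2, h4, P.precomp_ad_zero]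
  exact ⟨rfl, rfl⟩

/-- On the parameters `λ k`, the reflections act by the Weyl group of rank two. -/
theorem pow_apply_lam (hs : ∀ i, A.IsReflectionHom P hN i (s i)) {i j : I} (k : I)
    {c : ℤ} (hji : A.a j i = -1) (hij : A.a i j = -c) {m : ℕ}
    (hm : (c = 1 ∧ m = 3) ∨ (c = 2 ∧ m = 4) ∨ (c = 3 ∧ m = 6)) :
    ((s j * s i) ^ m) (A.lam A₀ k) = A.lam A₀ k := by
  have step : ∀ a b : ℤ, (s j * s i) (A.lam A₀ k + a * A.lam A₀ i + b * A.lam A₀ j) =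
      A.lam A₀ k + ((-A.a k i - a + b : ℤ) : A.FunctionField A₀) * A.lam A₀ i +
        ((-A.a k j - c * A.a k i - c * a + (c - 1) * b : ℤ) : A.FunctionField A₀) * A.lam A₀ j := by
    intro a b
    have hi : ∀ l, s i (A.lam A₀ l) = _ := (hs i).map_lam
    have hj : ∀ l, s j (A.lam A₀ l) = _ := (hs j).map_lam
    simp only [AlgEquiv.mul_apply, map_add, map_mul, map_sub, map_intCast, hi, hj, A.diag, hij, hji]
    push_cast
    ring
  have step0 : A.lam A₀ k = A.lam A₀ k + ((0 : ℤ) : A.FunctionField A₀) * A.lam A₀ i +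
      ((0 : ℤ) : A.FunctionField A₀) * A.lam A₀ j := by simp
  rw [step0]
  rcases hm with ⟨rfl, rfl⟩ | ⟨rfl, rfl⟩ | ⟨rfl, rfl⟩ <;>
  · simp only [pow_succ, pow_zero, one_mul, AlgEquiv.mul_apply _ (s j * s i), step]
    push_cast
    ring

/-- The braid relations between a short reflection `s i` and a long reflection `s j`. -/
theorem pow_eq_one (hs : ∀ i, A.IsReflectionHom P hN i (s i)) (hφ : ∀ i, φ i ≠ 0) {i j : I}
    {c : ℤ} (hji : A.a j i = -1) (hij : A.a i j = -c)
    (h2 : P.bracket (φ j) (P.bracket (φ j) (φ i)) = 0)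
    (h4 : (P.bracket (φ i))^[(1 + c).toNat] (φ j) = 0) {m : ℕ}
    (hm : (c = 1 ∧ m = 3) ∨ (c = 2 ∧ m = 4) ∨ (c = 3 ∧ m = 6)) : (s j * s i) ^ m = 1 := by
  refine algEquiv_eq_one (fun f => ?_) fun k => pow_apply_lam hs k hji hij hm
  have h4' : (P.bracket (φ i))^[4] (φ j) = 0 := by
    refine (P.ad (φ i)).iterate_eq_zero h4 ?_
    rcases hm with ⟨rfl, _⟩ | ⟨rfl, _⟩ | ⟨rfl, _⟩ <;> norm_num
  have hR := rankTwoAction hs hφ hji hij h2 h4'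
  have hS := isSerrePair_precomp (A := A) h2 h4'
  have hσ : ∀ (b : Bool) (f : A₀), (bif b then s i else s j) (A.inclK A₀ f) =
      ((bif b then P.ad (φ i) else P.ad (φ j)).expHom (by cases b <;> exact hN _) f).eval₂
        (A.inclK A₀ : A₀ →+* A.FunctionField A₀) (bif b then A.param φ i else A.param φ j) := by
    rintro (_ | _) f
    · exact (hs j).map_inclK f
    · exact (hs i).map_inclK f
  simp only at hR
  rcases hm with ⟨rfl, rfl⟩ | ⟨rfl, rfl⟩ | ⟨rfl, rfl⟩
  · have h0 : P.bracket (φ i) (P.bracket (φ i) (φ j)) = 0 := h4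
    simp only [h0, map_zero] at hR
    exact A₂.pow_apply_eq_self hR hσ hS (by
      simp only [cond_true, cond_false, P.commutator₂_precomp_ad, P.bracket_bracket_self, h0]
      exact P.precomp_ad_zero _) f
  · have h0 : P.bracket (φ i) (P.bracket (φ i) (P.bracket (φ i) (φ j))) = 0 := h4
    simp only [h0, map_zero] at hR
    exact B₂.pow_apply_eq_self hR hσ hS (by
      simp only [cond_true, cond_false, P.commutator₂_precomp_ad, P.bracket_bracket_self]
      rw [P.skew, h0, neg_zero, P.precomp_ad_zero]) f
  · exact G₂.pow_apply_eq_self hR hσ hS f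

/-- Reflections that are not joined by an edge commute. -/
theorem pow_two_eq_one_of_orthogonal (hs : ∀ i, A.IsReflectionHom P hN i (s i)) {i j : I}
    (hij : A.a i j = 0) (hji : A.a j i = 0) (h : P.bracket (φ i) (φ j) = 0) :
    (s i * s j) ^ 2 = 1 := by
  have hprod : ([i, j, i, j].map s).prod = (s i * s j) ^ 2 := by
    simp only [List.map_cons, List.map_nil, List.prod_cons, List.prod_nil, mul_one, sq, mul_assoc]
  have hi : ∀ l, s i (A.lam A₀ l) = _ := (hs i).map_lam
  have hj : ∀ l, s j (A.lam A₀ l) = _ := (hs j).map_lam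
  refine algEquiv_eq_one (fun f => ?_) fun k => ?_
  · have hii : s i (A.param φ i) = _ := (hs i).map_param
    have hjj : s j (A.param φ j) = _ := (hs j).map_param
    have hij' : s i (A.param φ j) = A.param φ j := by
      have h1 : s i (A.phiK φ j) = A.phiK φ j := (hs i).map_inclK_of_bracket_eq_zero h
      rw [param, map_div₀, h1, hi, hji, Int.cast_zero, zero_mul, sub_zero]
    have hji' : s j (A.param φ i) = A.param φ i := by
      have h1 : s j (A.phiK φ i) = A.phiK φ i :=
        (hs j).map_inclK_of_bracket_eq_zero (by rw [P.skew, h, neg_zero])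
      rw [param, map_div₀, h1, hj, hij, Int.cast_zero, zero_mul, sub_zero]
    rw [← hprod]
    have : CharZero (A.FunctionField A₀) :=
      charZero_of_injective_algebraMap (algebraMap ℂ (A.FunctionField A₀)).injective
    refine prod_apply_eq_self (fun k => P.ad (φ k)) hN (A.inclK A₀) s (A.param φ)
      (fun k f => (hs k).map_inclK f) _ ?_ f
    have hcomm : Commute ((P.ad (φ i)).precomp (A.FunctionField A₀))
        ((P.ad (φ j)).precomp (A.FunctionField A₀)) := by
      refine sub_eq_zero.1 ?_
      have h0 := P.commutator₂_precomp_ad (A.FunctionField A₀) (φ i) (φ j)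
      rwa [P.skew, h, neg_zero, P.precomp_ad_zero, commutator₂_apply] at h0
    simp only [wordParams, List.map_cons, List.map_nil, List.nil_append, List.cons_append,
      hii, hjj, hij', hji', map_neg, List.prod_cons, List.prod_nil, mul_one]
    rw [← mul_assoc, (PowerSeries.expMul_commute hcomm.symm _ _).eq, mul_assoc, ← mul_assoc _ _
      (PowerSeries.expMul (A.param φ i) _)]
    have h1 : ∀ (u : A.FunctionField A₀) (k : I),
        PowerSeries.expMul (-u) ((P.ad (φ k)).precomp (A.FunctionField A₀)) *
          PowerSeries.expMul u ((P.ad (φ k)).precomp (A.FunctionField A₀)) = 1 := fun u k => by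
      simpa using PowerSeries.expMul_mul_expMul_neg (-u) ((P.ad (φ k)).precomp (A.FunctionField A₀))
    rw [h1, one_mul, h1]
  · simp only [sq, AlgEquiv.mul_apply, map_sub, map_mul, map_intCast, hi, hj, hij, hji, A.diag]
    push_cast
    ring

end IsReflectionHom

end GCM

/-! ### Extension to the Laurent polynomial ring -/

namespace GCM

open AddMonoidAlgebra

variable {I : Type u} (A : GCM I)

theorem simpleReflection_apply (i : I) (l : A.WeightLattice) :
    A.simpleReflection i l = l - l i • A.root i :=
  Module.reflection_apply _ _

theorem root_apply (i k : I) : A.root i k = A.a k i := rfl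

theorem simpleReflection_apply_self (i : I) (l : A.WeightLattice) :
    A.simpleReflection i l i = -l i := by
  rw [simpleReflection_apply, Finsupp.sub_apply, Finsupp.smul_apply, root_apply, A.diag,
    smul_eq_mul]
  ring

variable {A} {A₀ : Type v} [CommRing A₀] [IsDomain A₀]

theorem tauPow_eq_single (l : A.WeightLattice) :
    (A.tauPow A₀ l : A.LaurentRing A₀) = single l 1 := by
  have h : ∀ i n, ((A.tau A₀ i ^ n : (A.LaurentRing A₀)ˣ) : A.LaurentRing A₀) =
      single (Finsupp.single i n) 1 := by
    have hp : ∀ i (n : ℕ), ((A.tau A₀ i ^ n : (A.LaurentRing A₀)ˣ) : A.LaurentRing A₀) =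
      single (Finsupp.single i (n : ℤ)) 1 := by
      intro i n
      rw [Units.val_pow_eq_pow_val]
      change single (Finsupp.single i 1) 1 ^ n = _
      rw [single_pow, one_pow, Finsupp.smul_single, nsmul_eq_mul, mul_one]
    have hm : ∀ i (n : ℕ), (((A.tau A₀ i)⁻¹ ^ n : (A.LaurentRing A₀)ˣ) : A.LaurentRing A₀) =
      single (Finsupp.single i (-n : ℤ)) 1 := by
      intro i n
      rw [Units.val_pow_eq_pow_val]
      change single (Finsupp.single i (-1)) 1 ^ n = _
      rw [single_pow, one_pow, Finsupp.smul_single, nsmul_eq_mul, mul_neg_one]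
    intro i n
    obtain ⟨n, rfl | rfl⟩ := n.eq_nat_or_neg
    · rw [zpow_natCast, hp]
    · rw [zpow_neg, zpow_natCast, ← inv_pow, hm]
  rw [tauPow, Finsupp.prod, Units.coe_prod]
  simp only [h]
  conv_rhs => rw [← Finsupp.sum_single l, Finsupp.sum]
  induction l.support using Finset.cons_induction with
  | empty => rfl
  | cons i t hi ih => rw [Finset.prod_cons, Finset.sum_cons, ih, single_mul_single, one_mul]

theorem algebraMap_mul_single (x y : A.FunctionField A₀) (l : A.WeightLattice) :
    algebraMap (A.FunctionField A₀) (A.LaurentRing A₀) x * single l y = single l (x * y) := by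
  change single 0 x * single l y = _
  rw [single_mul_single, zero_add]

theorem algebraMap_mul_tauPow (x : A.FunctionField A₀) (l : A.WeightLattice) :
    algebraMap (A.FunctionField A₀) (A.LaurentRing A₀) x * A.tauPow A₀ l = single l x := by
  rw [tauPow_eq_single, algebraMap_mul_single, mul_one]

theorem single_eq_mul (x : A.FunctionField A₀) (l : A.WeightLattice) :
    (single l x : A.LaurentRing A₀) =
      algebraMap (A.FunctionField A₀) (A.LaurentRing A₀) x * single l 1 := by
  rw [algebraMap_mul_single, mul_one]

/-- Homomorphisms from the weight lattice to a multiplicative monoid agree if they agree on the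
fundamental weights. -/
theorem weightHom_ext {M : Type*} [Monoid M] {f g : Multiplicative A.WeightLattice →* M}
    (h : ∀ j, f (.ofAdd (Finsupp.single j 1)) = g (.ofAdd (Finsupp.single j 1))) : f = g := by
  apply MonoidHom.toAdditiveRight.injective
  ext j
  exact congrArg Additive.ofMul (h j)

theorem prod_tau_zpow (i : I) :
    (∏ k ∈ (A.column_finite i).toFinset, A.tau A₀ k ^ (-A.a k i) : (A.LaurentRing A₀)ˣ) =
      A.tauPow A₀ (-A.root i) := by
  have h : (-A.root i).support = (A.column_finite i).toFinset := by
    ext k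
    rw [Finsupp.support_neg, Finsupp.mem_support_iff, Set.Finite.mem_toFinset,
      Function.mem_support, root_apply]
  rw [tauPow, Finsupp.prod, h]
  rfl

variable [Algebra ℂ A₀] {φ : I → A₀}

/-- The endomorphism `T` extends the automorphism `s` of the function field and maps `τ^Λ` to
`φ i ^ ⟨h i, Λ⟩ τ^(r i Λ)`; exponentials are written as elements `single Λ 1`. -/
def IsMonomialReflection (φ : I → A₀) (i : I) (s : A.FunctionField A₀ ≃ₐ[ℂ] A.FunctionField A₀)
    (T : A.LaurentRing A₀ →ₐ[ℂ] A.LaurentRing A₀) : Prop :=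
  ∀ l x, T (single l x) = single (A.simpleReflection i l) (s x * A.phiK φ i ^ (l i))

/-- The values on `K` and on the variables `τ j` determine those on all monomials. -/
theorem isTauExtension_iff (hφ : ∀ i, φ i ≠ 0)
    (s : I → (A.FunctionField A₀ ≃ₐ[ℂ] A.FunctionField A₀))
    (S : I → (A.LaurentRing A₀ ≃ₐ[ℂ] A.LaurentRing A₀)) :
    A.IsTauExtension φ s S ↔ ∀ i, IsMonomialReflection φ i (s i) (S i : _ →ₐ[ℂ] _) := by
  have htau : ∀ j, (A.tau A₀ j : A.LaurentRing A₀) = single (Finsupp.single j 1) 1 := fun _ => rfl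
  have hsi : ∀ i, algebraMap (A.FunctionField A₀) (A.LaurentRing A₀) (A.phiK φ i) * A.tau A₀ i *
        ((∏ k ∈ (A.column_finite i).toFinset, A.tau A₀ k ^ (-A.a k i) : (A.LaurentRing A₀)ˣ) :
          A.LaurentRing A₀) = single (A.simpleReflection i (Finsupp.single i 1)) (A.phiK φ i) := by
    intro i
    rw [prod_tau_zpow, tauPow_eq_single, htau, algebraMap_mul_single, single_mul_single, mul_one,
      mul_one, simpleReflection_apply, Finsupp.single_eq_same, one_smul, sub_eq_add_neg]
  refine forall_congr' fun i => ⟨?_, fun h => ⟨fun x => ?_, fun j hj => ?_, ?_⟩⟩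
  · rintro ⟨h1, h2, h3⟩ l x
    have key : ((S i : A.LaurentRing A₀ →* A.LaurentRing A₀).comp
        (AddMonoidAlgebra.of (A.FunctionField A₀) A.WeightLattice)) =
        { toFun := fun l => single (A.simpleReflection i l.toAdd) (A.phiK φ i ^ (l.toAdd i))
          map_one' := by
            rw [toAdd_one, map_zero, Finsupp.zero_apply, zpow_zero]
            rfl
          map_mul' := fun l l' => by
            rw [single_mul_single, toAdd_mul, map_add, Finsupp.add_apply,
              zpow_add₀ (A.phiK_ne_zero hφ i)] } := by
      refine weightHom_ext fun j => ?_
      change S i (A.tau A₀ j) = single (A.simpleReflection i (Finsupp.single j 1))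
        (A.phiK φ i ^ (Finsupp.single j (1 : ℤ) i))
      rcases eq_or_ne j i with rfl | hj
      · rw [h3, hsi, Finsupp.single_eq_same, zpow_one]
      · rw [h2 j hj, htau, simpleReflection_apply, Finsupp.single_eq_of_ne hj.symm, zpow_zero,
          zero_smul, sub_zero]
    have hl := DFunLike.congr_fun key (.ofAdd l)
    change S i (single l 1) = single (A.simpleReflection i l) (A.phiK φ i ^ (l i)) at hl
    rw [single_eq_mul, map_mul]
    change S i _ * S i _ = _
    rw [h1, hl, algebraMap_mul_single]
  · have := h 0 x
    rw [map_zero, Finsupp.zero_apply, zpow_zero, mul_one] at this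
    exact this
  · refine (h (Finsupp.single j 1) 1).trans ?_
    rw [htau, simpleReflection_apply, Finsupp.single_eq_of_ne hj.symm, zpow_zero, zero_smul,
      sub_zero, map_one, mul_one]
  · rw [hsi]
    refine (h (Finsupp.single i 1) 1).trans ?_
    rw [Finsupp.single_eq_same, map_one, one_mul, zpow_one]

theorem laurent_algHom_ext {T T' : A.LaurentRing A₀ →ₐ[ℂ] A.LaurentRing A₀}
    (h : ∀ l x, T (single l x) = T' (single l x)) : T = T' :=
  AlgHom.coe_ringHom_injective (RingHom.coe_addMonoidHom_injective (addMonoidHom_ext h))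

theorem IsMonomialReflection.ext {i : I} {s : A.FunctionField A₀ ≃ₐ[ℂ] A.FunctionField A₀}
    {T T' : A.LaurentRing A₀ →ₐ[ℂ] A.LaurentRing A₀} (h : IsMonomialReflection φ i s T)
    (h' : IsMonomialReflection φ i s T') : T = T' :=
  laurent_algHom_ext fun l x => (h l x).trans (h' l x).symm

theorem exists_isMonomialReflection (hφ : ∀ i, φ i ≠ 0) (i : I)
    (s : A.FunctionField A₀ ≃ₐ[ℂ] A.FunctionField A₀) :
    ∃ T : A.LaurentRing A₀ →ₐ[ℂ] A.LaurentRing A₀, IsMonomialReflection φ i s T := by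
  let g : Multiplicative A.WeightLattice →* A.LaurentRing A₀ :=
    { toFun := fun l => single (A.simpleReflection i l.toAdd) (A.phiK φ i ^ (l.toAdd i))
      map_one' := by
        rw [toAdd_one, map_zero, Finsupp.zero_apply, zpow_zero]
        rfl
      map_mul' := fun l l' => by
        rw [single_mul_single, toAdd_mul, map_add, Finsupp.add_apply,
          zpow_add₀ (A.phiK_ne_zero hφ i)] }
  let f : A.FunctionField A₀ →+* A.LaurentRing A₀ :=
    (algebraMap (A.FunctionField A₀) (A.LaurentRing A₀)).comp (s : _ →+* _)
  have hT : ∀ l x, liftNCRingHom f g (fun _ _ => Commute.all _ _) (single l x) =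
      single (A.simpleReflection i l) (s x * A.phiK φ i ^ (l i)) := by
    intro l x
    rw [liftNCRingHom_single]
    exact algebraMap_mul_single _ _ _
  refine ⟨{ liftNCRingHom f g (fun _ _ => Commute.all _ _) with commutes' := fun c => ?_ }, hT⟩
  have := hT 0 (algebraMap ℂ _ c)
  rw [map_zero, Finsupp.zero_apply, zpow_zero, mul_one, AlgEquiv.commutes] at this
  exact this

theorem IsMonomialReflection.comp_self {i : I} {s : A.FunctionField A₀ ≃ₐ[ℂ] A.FunctionField A₀}
    {T : A.LaurentRing A₀ →ₐ[ℂ] A.LaurentRing A₀} (h : IsMonomialReflection φ i s T)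
    (hφ : ∀ i, φ i ≠ 0) (hs : ∀ x, s (s x) = x) (hsφ : s (A.phiK φ i) = A.phiK φ i) :
    T.comp T = AlgHom.id ℂ _ := by
  refine laurent_algHom_ext fun l x => ?_
  rw [AlgHom.comp_apply, h, h, simpleReflection_apply_self, map_mul, map_zpow₀, hs, hsφ, mul_assoc,
    ← zpow_add₀ (A.phiK_ne_zero hφ i), add_neg_cancel, zpow_zero, mul_one,
    show A.simpleReflection i (A.simpleReflection i l) = l from
      Module.involutive_reflection ((A.coroot_root i i).trans (A.diag i)) l]
  rfl

theorem existsUnique_isTauExtension (hφ : ∀ i, φ i ≠ 0)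
    {s : I → (A.FunctionField A₀ ≃ₐ[ℂ] A.FunctionField A₀)} (hs : ∀ i x, s i (s i x) = x)
    (hsφ : ∀ i, s i (A.phiK φ i) = A.phiK φ i) : ∃! S, A.IsTauExtension φ s S := by
  choose T hT using fun i => exists_isMonomialReflection (A := A) hφ i (s i)
  refine ⟨fun i => AlgEquiv.ofAlgHom (T i) (T i) ((hT i).comp_self hφ (hs i) (hsφ i))
    ((hT i).comp_self hφ (hs i) (hsφ i)), (isTauExtension_iff hφ _ _).2 hT, fun S hS => ?_⟩
  replace hS := (isTauExtension_iff hφ _ _).1 hS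
  exact funext fun i => AlgEquiv.coe_toAlgHom_injective ((hS i).ext (hT i))

end GCM

/-! ### Braid relations on the Laurent polynomial ring -/

section RankTwo

variable {k K : Type*} [Field k] [Field K] [Algebra k K]
variable {σ : Bool → K ≃ₐ[k] K} {t : Bool → K} {φs φl y₁ y₂ y₃ y₄ ls ll : K}

theorem map_eq_self_of_mul {s : K ≃ₐ[k] K} {x y z : K} (hxy : x * y = z) (hz : z ≠ 0)
    (hsx : s x = x) (hsz : s z = z) : s y = y := by
  have hx : x ≠ 0 := left_ne_zero_of_mul (hxy ▸ hz)
  rw [← hxy, map_mul, hsx] at hsz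
  exact mul_left_cancel₀ hx hsz

theorem RankTwoAction.ls_ne_zero {c : ℤ} (h : RankTwoAction σ t c φs φl y₁ y₂ y₃ y₄ ls ll) :
    ls ≠ 0 := by
  simpa using h.ne_zero 1 0 (Or.inl one_ne_zero)

theorem RankTwoAction.ll_ne_zero {c : ℤ} (h : RankTwoAction σ t c φs φl y₁ y₂ y₃ y₄ ls ll) :
    ll ≠ 0 := by
  simpa using h.ne_zero 0 1 (Or.inr one_ne_zero)

variable [CharZero k]

/-- The coefficient of `σ false (σ true τ)`, for the fundamental weight `τ` of the short root, is
invariant under `σ true`, which fixes the corresponding weight. -/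
theorem A₂.phi_invariant (h : RankTwoAction σ t 1 φs φl y₁ 0 0 0 ls ll) :
    σ true (σ false φs * φl) = σ false φs * φl := by
  refine map_eq_self_of_mul (x := σ false (t true) * t false) (z := σ false ls * ll) ?_ ?_
    (A₂.corner_invariant h) ?_
  · rw [← h.t_short, ← h.t_long, map_mul]
    ring
  · simp [h.ls_ne_zero, h.ll_ne_zero]
  · simp only [map_mul, map_add, map_intCast, h.long_ls, h.short_ls, h.short_ll]
    push_cast
    ring

/-- The coefficient of `σ true (σ false (σ true τ))`, for the fundamental weight `τ` of the short
root, is invariant under `σ false`, which fixes the corresponding weight. -/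
theorem B₂.phi_invariant (h : RankTwoAction σ t 2 φs φl y₁ y₂ 0 0 ls ll) :
    σ false (σ true (σ false φs) * σ true φl * φs) = σ true (σ false φs) * σ true φl * φs := by
  refine map_eq_self_of_mul (x := σ true (σ false (t true)) * σ true (t false) * t true)
    (z := σ true (σ false ls) * σ true ll * ls) ?_ ?_ (B₂.corner_invariant h) ?_
  · rw [← h.t_short, ← h.t_long]
    simp only [map_mul]
    ring
  · simp [h.ls_ne_zero, h.ll_ne_zero]
  · simp only [map_mul, map_add, map_neg, map_intCast, h.long_ls, h.short_ls, h.short_ll, h.long_ll]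
    push_cast
    ring

/-- The coefficient of `σ true (σ false (σ true (σ false (σ true τ))))`, for the fundamental weight
`τ` of the short root, is invariant under `σ false`, which fixes the corresponding weight. -/
theorem G₂.phi_invariant (h : RankTwoAction σ t 3 φs φl y₁ y₂ y₃ y₄ ls ll) :
    σ false (σ true (σ false (σ true (σ false φs))) * σ true (σ false (σ true φl)) *
        σ true (σ false φs) ^ 2 * σ true φl * φs) =
      σ true (σ false (σ true (σ false φs))) * σ true (σ false (σ true φl)) *
        σ true (σ false φs) ^ 2 * σ true φl * φs := by
  refine map_eq_self_of_mul (x := σ true (σ false (σ true (σ false (t true)))) *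
      σ true (σ false (σ true (t false))) * σ true (σ false (t true)) ^ 2 * σ true (t false) *
      t true)
    (z := σ true (σ false (σ true (σ false ls))) * σ true (σ false (σ true ll)) *
        σ true (σ false ls) ^ 2 * σ true ll * ls) ?_ ?_ (G₂.corner_invariant h) ?_
  · rw [← h.t_short, ← h.t_long]
    simp only [map_mul]
    ring
  · simp [h.ls_ne_zero, h.ll_ne_zero]
  · simp only [map_mul, map_add, map_neg, map_pow, map_intCast, h.long_ls, h.short_ls, h.short_ll,
      h.long_ll]
    push_cast
    ring

end RankTwo

namespace GCM

open AddMonoidAlgebra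

variable {I : Type u} {A : GCM I} {A₀ : Type v} [CommRing A₀] [IsDomain A₀] [Algebra ℂ A₀]

/-- An automorphism of the Laurent polynomial ring over `K` which fixes `K`, all `τ k` with `k ≠ j`,
and a monomial of degree one in `τ j`, is trivial. -/
theorem laurent_eq_one {R : A.LaurentRing A₀ ≃ₐ[ℂ] A.LaurentRing A₀} {j : I}
    (h0 : ∀ x, R (single 0 x) = single 0 x)
    (hR : ∀ k, k ≠ j → R (single (Finsupp.single k 1) 1) = single (Finsupp.single k 1) 1)
    {l : A.WeightLattice} (hlj : l j = 1) {y : A.FunctionField A₀} (hy : y ≠ 0)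
    (hl : R (single l y) = single l y) : R = 1 := by
  set g : Multiplicative A.WeightLattice →* A.LaurentRing A₀ :=
    AddMonoidAlgebra.of (A.FunctionField A₀) A.WeightLattice
  set f : Multiplicative A.WeightLattice →* A.LaurentRing A₀ :=
    (R : A.LaurentRing A₀ →* A.LaurentRing A₀).comp g
  have hmul : ∀ (l : A.WeightLattice) (x : A.FunctionField A₀),
      R (single l x) = single 0 x * f (.ofAdd l) := fun l x => by
    rw [single_eq_mul, map_mul]
    congr 1
    exact h0 x
  have hfl : f (.ofAdd l) = g (.ofAdd l) := by
    have h1 := hmul l y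
    rw [hl] at h1
    have h2 := congrArg (fun z => single 0 y⁻¹ * z) h1
    simp only [← mul_assoc, single_mul_single, zero_add, inv_mul_cancel₀ hy] at h2
    exact ((one_mul _).symm.trans h2.symm)
  have herase : f.comp (Finsupp.eraseAddHom j).toMultiplicative =
      g.comp (Finsupp.eraseAddHom j).toMultiplicative := by
    refine weightHom_ext (A := A) fun k => ?_
    change f (.ofAdd (Finsupp.erase j (Finsupp.single k 1))) =
      g (.ofAdd (Finsupp.erase j (Finsupp.single k 1)))
    rcases eq_or_ne k j with rfl | hk
    · rw [Finsupp.erase_single, ofAdd_zero, map_one, map_one]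
    · rw [Finsupp.erase_single_ne hk.symm]
      exact hR k hk
  have hfg : f = g := by
    refine weightHom_ext (A := A) fun k => ?_
    rcases eq_or_ne k j with rfl | hk
    · have h1 : l = Finsupp.erase k l + Finsupp.single k 1 := by
        rw [← hlj, Finsupp.erase_add_single]
      have h2 : f (.ofAdd (Finsupp.erase k l)) = g (.ofAdd (Finsupp.erase k l)) :=
        DFunLike.congr_fun herase (.ofAdd l)
      rw [h1, ofAdd_add, map_mul, map_mul, h2] at hfl
      have hu : IsUnit (g (.ofAdd (Finsupp.erase k l))) := (Group.isUnit _).map g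
      exact hu.mul_left_cancel hfl
    · exact hR k hk
  refine AlgEquiv.coe_toAlgHom_injective (laurent_algHom_ext fun l x => ?_)
  change R _ = single l x
  rw [hmul, hfg]
  exact (single_eq_mul x l).symm

variable {P : PoissonBracket A₀} {φ : I → A₀} {hN : ∀ i, (P.ad (φ i)).IsLocallyNilpotent}
  {s : I → (A.FunctionField A₀ ≃ₐ[ℂ] A.FunctionField A₀)}
  {S : I → (A.LaurentRing A₀ ≃ₐ[ℂ] A.LaurentRing A₀)}

namespace IsMonomialReflection

theorem map_single (hS : ∀ i, IsMonomialReflection φ i (s i) (S i : _ →ₐ[ℂ] _)) (i : I)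
    (l : A.WeightLattice) (x : A.FunctionField A₀) :
    S i (single l x) = single (A.simpleReflection i l) (s i x * A.phiK φ i ^ (l i)) :=
  hS i l x

theorem map_single_zero (hS : ∀ i, IsMonomialReflection φ i (s i) (S i : _ →ₐ[ℂ] _)) (i : I)
    (x : A.FunctionField A₀) : S i (single 0 x) = single 0 (s i x) := by
  rw [map_single hS, map_zero, Finsupp.zero_apply, zpow_zero, mul_one]

theorem map_single_of_apply_eq_zero (hS : ∀ i, IsMonomialReflection φ i (s i) (S i : _ →ₐ[ℂ] _))
    {i : I} {l : A.WeightLattice} (hl : l i = 0) (x : A.FunctionField A₀) :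
    S i (single l x) = single l (s i x) := by
  rw [map_single hS, simpleReflection_apply, hl, zpow_zero, mul_one, zero_smul, sub_zero]

theorem mul_pow_map_single_zero
    (hS : ∀ i, IsMonomialReflection φ i (s i) (S i : _ →ₐ[ℂ] _)) (i j : I) (m : ℕ)
    (x : A.FunctionField A₀) : ((S i * S j) ^ m) (single 0 x) = single 0 (((s i * s j) ^ m) x) := by
  induction m with
  | zero => rfl
  | succ m ih =>
    rw [pow_succ', pow_succ', AlgEquiv.mul_apply, ih, AlgEquiv.mul_apply, AlgEquiv.mul_apply,
      map_single_zero hS, map_single_zero hS, AlgEquiv.mul_apply]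

theorem involutive (hs : ∀ i, A.IsReflectionHom P hN i (s i)) (hφ : ∀ i, φ i ≠ 0)
    (hS : ∀ i, IsMonomialReflection φ i (s i) (S i : _ →ₐ[ℂ] _)) (i : I) (z : A.LaurentRing A₀) :
    S i (S i z) = z :=
  DFunLike.congr_fun ((hS i).comp_self hφ (DFunLike.congr_fun (hs i).comp_self) (hs i).map_phiK) z

/-- The weight `Λ i + p α i + q α j`. -/
noncomputable def weight (A : GCM I) (i j : I) (p q : ℤ) : A.WeightLattice :=
  Finsupp.single i 1 + p • A.root i + q • A.root j

theorem map_weight_left (hS : ∀ i, IsMonomialReflection φ i (s i) (S i : _ →ₐ[ℂ] _)) {i j : I}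
    {c : ℤ} (hij : A.a i j = -c) (p q : ℤ) (x : A.FunctionField A₀) :
    S i (single (weight A i j p q) x) = single (weight A i j (c * q - p - 1) q)
      (s i x * A.phiK φ i ^ (1 + 2 * p - c * q)) := by
  have h : weight A i j p q i = 1 + 2 * p - c * q := by
    rw [weight, Finsupp.add_apply, Finsupp.add_apply, Finsupp.smul_apply, Finsupp.smul_apply,
      root_apply, root_apply, A.diag, hij, Finsupp.single_eq_same, smul_eq_mul, smul_eq_mul]
    ring
  rw [map_single hS, simpleReflection_apply, h, weight, weight]
  congr 1
  module

theorem map_weight_right (hS : ∀ i, IsMonomialReflection φ i (s i) (S i : _ →ₐ[ℂ] _)) {i j : I}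
    (hji : A.a j i = -1) (hne : i ≠ j) (p q : ℤ) (x : A.FunctionField A₀) :
    S j (single (weight A i j p q) x) = single (weight A i j p (p - q))
      (s j x * A.phiK φ j ^ (2 * q - p)) := by
  have h : weight A i j p q j = 2 * q - p := by
    rw [weight, Finsupp.add_apply, Finsupp.add_apply, Finsupp.smul_apply, Finsupp.smul_apply,
      root_apply, root_apply, A.diag, hji, Finsupp.single_eq_of_ne hne.symm, smul_eq_mul,
      smul_eq_mul]
    ring
  rw [map_single hS, simpleReflection_apply, h, weight, weight]
  congr 1
  module

/-- The braid relations for the extended reflections, for a short root `i` and a long root `j`. -/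
theorem pow_eq_one (hs : ∀ i, A.IsReflectionHom P hN i (s i)) (hφ : ∀ i, φ i ≠ 0)
    (hS : ∀ i, IsMonomialReflection φ i (s i) (S i : _ →ₐ[ℂ] _)) {i j : I}
    {c : ℤ} (hji : A.a j i = -1) (hij : A.a i j = -c)
    (h2 : P.bracket (φ j) (P.bracket (φ j) (φ i)) = 0)
    (h4 : (P.bracket (φ i))^[(1 + c).toNat] (φ j) = 0) {m : ℕ}
    (hm : (c = 1 ∧ m = 3) ∨ (c = 2 ∧ m = 4) ∨ (c = 3 ∧ m = 6)) : (S j * S i) ^ m = 1 := by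
  have hne : i ≠ j := by
    rintro rfl
    rw [A.diag] at hji
    norm_num at hji
  have h4' : (P.bracket (φ i))^[4] (φ j) = 0 := by
    refine (P.ad (φ i)).iterate_eq_zero h4 ?_
    rcases hm with ⟨rfl, _⟩ | ⟨rfl, _⟩ | ⟨rfl, _⟩ <;> norm_num
  have hR := IsReflectionHom.rankTwoAction hs hφ hji hij h2 h4'
  simp only at hR
  set τ : A.LaurentRing A₀ := single (weight A i j 0 0) 1 with hτ
  have hφK : ∀ l, A.inclK A₀ (φ l) = A.phiK φ l := fun _ => rfl
  have hi := involutive hs hφ hS i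
  have hj := involutive hs hφ hS j
  have hjτ : S j τ = τ := by
    rw [hτ, map_weight_right hS hji hne]
    simp
  have hiτ : S i τ = single (weight A i j (-1) 0) (A.phiK φ i) := by
    rw [hτ, map_weight_left hS hij]
    simp
  -- Half of the braid relation, applied to `τ`, says that a monomial is invariant under one of the
  -- reflections (`hY` below); the braid relation follows because `S j` fixes `τ`.
  have key : ((S j * S i) ^ m) τ = τ ∧ ((S j * S i) ^ m) (S i τ) = S i τ := by
    rcases hm with ⟨rfl, rfl⟩ | ⟨rfl, rfl⟩ | ⟨rfl, rfl⟩
    · have h0 : P.bracket (φ i) (P.bracket (φ i) (φ j)) = 0 := h4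
      simp only [h0, map_zero] at hR
      have hY : S i (S j (S i τ)) = S j (S i τ) := by
        have := A₂.phi_invariant hR
        simp only [cond_true, cond_false, hφK, map_mul] at this
        rw [hiτ]
        simp only [map_weight_right hS hji hne, map_weight_left hS hij]
        norm_num
        linear_combination this
      simp only [pow_succ, pow_zero, one_mul, AlgEquiv.mul_apply, hY, hi, hj, hjτ, and_self]
    · have h0 : P.bracket (φ i) (P.bracket (φ i) (P.bracket (φ i) (φ j))) = 0 := h4
      simp only [h0, map_zero] at hR
      have hY : S j (S i (S j (S i τ))) = S i (S j (S i τ)) := by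
        have := B₂.phi_invariant hR
        simp only [cond_true, cond_false, hφK, map_mul] at this
        rw [hiτ]
        simp only [map_weight_right hS hji hne, map_weight_left hS hij]
        norm_num
        linear_combination this
      simp only [pow_succ, pow_zero, one_mul, AlgEquiv.mul_apply, hY, hi, hj, hjτ, and_self]
    · have hY : S j (S i (S j (S i (S j (S i τ))))) = S i (S j (S i (S j (S i τ)))) := by
        have := G₂.phi_invariant hR
        simp only [cond_true, cond_false, hφK, map_mul, map_pow] at this
        rw [hiτ]
        simp only [map_weight_right hS hji hne, map_weight_left hS hij]
        norm_num
        linear_combination this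
      simp only [pow_succ, pow_zero, one_mul, AlgEquiv.mul_apply, hY, hi, hj, hjτ, and_self]
  -- Since `a j i = -1`, the monomial `S i τ` has degree one in `τ j`.
  refine laurent_eq_one (j := j) (l := weight A i j (-1) 0) (fun x => ?_) (fun k hk => ?_) ?_
    (A.phiK_ne_zero hφ i) (hiτ ▸ key.2)
  · rw [mul_pow_map_single_zero hS, IsReflectionHom.pow_eq_one hs hφ hji hij h2 h4 hm]
    rfl
  · rcases eq_or_ne k i with rfl | hki
    · have h0 : τ = single (Finsupp.single k 1) 1 := by
        rw [hτ, weight, zero_smul, zero_smul, add_zero, add_zero]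
      rw [← h0]
      exact key.1
    · have h1 : (S j * S i) (single (Finsupp.single k 1) 1) = single (Finsupp.single k 1) 1 := by
        rw [AlgEquiv.mul_apply, map_single_of_apply_eq_zero hS (Finsupp.single_eq_of_ne hki.symm),
          map_one, map_single_of_apply_eq_zero hS (Finsupp.single_eq_of_ne hk.symm), map_one]
      clear hm h4 key
      induction m with
      | zero => rfl
      | succ m ih => rw [pow_succ, AlgEquiv.mul_apply, h1, ih]
  · rw [weight, Finsupp.add_apply, Finsupp.add_apply, Finsupp.smul_apply, Finsupp.smul_apply,
      root_apply, hji, Finsupp.single_eq_of_ne hne.symm]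
    simp

end IsMonomialReflection

end GCM

/-! ### The action of the Weyl group and the cocycle -/

namespace GCM

open AddMonoidAlgebra

variable {I : Type u} {A : GCM I}

theorem eq_neg_one_or_of_mul_eq {i j : I} (hij : i ≠ j) {c : ℤ} (h : A.a i j * A.a j i = c)
    (hc : c = 1 ∨ c = 2 ∨ c = 3) :
    A.a j i = -1 ∧ A.a i j = -c ∨ A.a i j = -1 ∧ A.a j i = -c := by
  have h1 := A.off_diag i j hij
  have h2 := A.off_diag j i hij.symm
  have h3 : -3 ≤ A.a i j := by
    have : A.a i j ∣ c := ⟨_, h.symm⟩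
    have := Int.le_of_dvd (by omega) ((neg_dvd (α := ℤ)).2 this)
    omega
  generalize A.a i j = x at *
  generalize A.a j i = y at *
  interval_cases x <;> omega

variable {A₀ : Type v} [CommRing A₀] [IsDomain A₀] [Algebra ℂ A₀]
  {P : PoissonBracket A₀} {φ : I → A₀} {hN : ∀ i, (P.ad (φ i)).IsLocallyNilpotent}
  {s : I → (A.FunctionField A₀ ≃ₐ[ℂ] A.FunctionField A₀)}
  {S : I → (A.LaurentRing A₀ ≃ₐ[ℂ] A.LaurentRing A₀)}

namespace IsMonomialReflection

/-- Extended reflections that are not joined by an edge commute. -/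
theorem pow_two_eq_one_of_orthogonal (hs : ∀ i, A.IsReflectionHom P hN i (s i))
    (hφ : ∀ i, φ i ≠ 0) (hS : ∀ i, IsMonomialReflection φ i (s i) (S i : _ →ₐ[ℂ] _)) {i j : I}
    (hne : i ≠ j) (hij : A.a i j = 0) (hji : A.a j i = 0) (h : P.bracket (φ i) (φ j) = 0) :
    (S i * S j) ^ 2 = 1 := by
  have hinv := involutive hs hφ hS
  have hfix : ∀ {k l : I}, k ≠ l → A.a l k = 0 → P.bracket (φ l) (φ k) = 0 →
      S l (single (Finsupp.single k 1) 1) = single (Finsupp.single k 1) 1 ∧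
      S l (S k (single (Finsupp.single k 1) 1)) = S k (single (Finsupp.single k 1) 1) := by
    intro k l hkl hlk hb
    have hφ' : s l (A.phiK φ k) = A.phiK φ k := (hs l).map_inclK_of_bracket_eq_zero hb
    refine ⟨by rw [map_single_of_apply_eq_zero hS (Finsupp.single_eq_of_ne hkl.symm), map_one], ?_⟩
    rw [map_single hS k, map_one, one_mul, Finsupp.single_eq_same, zpow_one,
      map_single_of_apply_eq_zero hS, hφ']
    rw [simpleReflection_apply, Finsupp.sub_apply, Finsupp.smul_apply, root_apply, hlk,
      Finsupp.single_eq_of_ne hkl.symm, smul_zero, sub_zero]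
  obtain ⟨hi1, hi2⟩ := hfix hne.symm hij h
  obtain ⟨hj1, hj2⟩ := hfix hne hji (by rw [P.skew, h, neg_zero])
  refine laurent_eq_one (j := j) (l := Finsupp.single j 1) (y := 1) (fun x => ?_) (fun k hk => ?_)
    Finsupp.single_eq_same one_ne_zero ?_
  · rw [mul_pow_map_single_zero hS, IsReflectionHom.pow_two_eq_one_of_orthogonal hs hij hji h]
    rfl
  · rcases eq_or_ne k i with rfl | hki
    · simp only [sq, AlgEquiv.mul_apply, hj1, hj2, hinv]
    · have hk1 : ∀ l, l ≠ k → S l (single (Finsupp.single k 1) 1) = single (Finsupp.single k 1) 1 :=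
        fun l hl => by rw [map_single_of_apply_eq_zero hS (Finsupp.single_eq_of_ne hl), map_one]
      simp only [sq, AlgEquiv.mul_apply, hk1 _ hki.symm, hk1 _ hk.symm]
  · simp only [sq, AlgEquiv.mul_apply, hi2, hinv, hi1]

/-- The fundamental relations of the Weyl group. -/
theorem mul_pow_coxeterMatrix (hs : ∀ i, A.IsReflectionHom P hN i (s i))
    (hφ : ∀ i, φ i ≠ 0) (hS : ∀ i, IsMonomialReflection φ i (s i) (S i : _ →ₐ[ℂ] _))
    (hserre : ∀ i j, i ≠ j → (P.bracket (φ i))^[(1 - A.a i j).toNat] (φ j) = 0) {i j : I}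
    (hij : i ≠ j) : (S i * S j) ^ A.coxeterMatrix i j = 1 := by
  have hinv : ∀ i, S i * S i = 1 := fun i => AlgEquiv.ext (involutive hs hφ hS i)
  have hedge : ∀ {c : ℤ} {m : ℕ}, A.a i j * A.a j i = c →
      (c = 1 ∧ m = 3) ∨ (c = 2 ∧ m = 4) ∨ (c = 3 ∧ m = 6) → (S i * S j) ^ m = 1 := by
    intro c m h hm
    have hc : c = 1 ∨ c = 2 ∨ c = 3 := by tauto
    rcases eq_neg_one_or_of_mul_eq hij h hc with ⟨h1, h2⟩ | ⟨h1, h2⟩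
    · have h3 := hserre j i hij.symm
      have h4 := hserre i j hij
      rw [h1] at h3
      rw [h2, sub_neg_eq_add] at h4
      have := pow_eq_one hs hφ hS h1 h2 h3 h4 hm
      rw [← inv_inj, ← inv_pow, mul_inv_rev, inv_eq_of_mul_eq_one_right (hinv i),
        inv_eq_of_mul_eq_one_right (hinv j), this, inv_one]
    · have h3 := hserre i j hij
      have h4 := hserre j i hij.symm
      rw [h1] at h3
      rw [h2, sub_neg_eq_add] at h4
      exact pow_eq_one hs hφ hS h1 h2 h3 h4 hm
  change (S i * S j) ^ (A.coxeterMatrix.M i j) = 1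
  simp only [coxeterMatrix, Matrix.of_apply, if_neg hij]
  split_ifs with h0 h1 h2 h3
  · have hx : A.a i j = 0 := by
      rcases mul_eq_zero.1 h0 with h | h
      · exact h
      · exact (A.zero_iff i j).2 h
    have h := hserre i j hij
    rw [hx] at h
    exact pow_two_eq_one_of_orthogonal hs hφ hS hij hx ((A.zero_iff i j).1 hx) h
  · exact hedge h1 (by tauto)
  · exact hedge h2 (by tauto)
  · exact hedge h3 (by tauto)
  · rw [pow_zero]

end IsMonomialReflection

/-- The Weyl group acts on the Laurent polynomial ring and on the function field, and the
coefficients of its action on the exponentials are the unique `τ`-cocycle. -/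
theorem exists_weylGroup_action (hS : ∀ i, IsMonomialReflection φ i (s i) (S i : _ →ₐ[ℂ] _))
    (hSl : A.coxeterMatrix.IsLiftable S) :
    ∃ (ρ : A.WeylGroup →* (A.LaurentRing A₀ ≃ₐ[ℂ] A.LaurentRing A₀))
        (σ : A.WeylGroup →* (A.FunctionField A₀ ≃ₐ[ℂ] A.FunctionField A₀)),
      (∀ i, ρ (A.r i) = S i) ∧ (∀ i, σ (A.r i) = s i) ∧
      (∀ w x, ρ w (algebraMap (A.FunctionField A₀) (A.LaurentRing A₀) x) =
        algebraMap (A.FunctionField A₀) (A.LaurentRing A₀) (σ w x)) ∧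
      (∀ w l, ∃! x : A.FunctionField A₀, ρ w (A.tauPow A₀ l) =
        algebraMap (A.FunctionField A₀) (A.LaurentRing A₀) x * A.tauPow A₀ (A.weylAction w l)) ∧
      (∀ c : A.WeylGroup → A.WeightLattice → A.FunctionField A₀,
        (∀ w l, ρ w (A.tauPow A₀ l) =
          algebraMap (A.FunctionField A₀) (A.LaurentRing A₀) (c w l) *
            A.tauPow A₀ (A.weylAction w l)) ↔ A.IsTauCocycle φ σ c) := by
  have hsl : A.coxeterMatrix.IsLiftable s := by
    intro i j
    ext x
    apply (single_right_injective (M := A.WeightLattice) (m := 0))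
    rw [← IsMonomialReflection.mul_pow_map_single_zero hS, hSl]
    rfl
  set cs := A.coxeterMatrix.toCoxeterSystem with hcs
  set ρ := cs.lift ⟨S, hSl⟩ with hρ
  set σ := cs.lift ⟨s, hsl⟩ with hσ
  have hρr : ∀ i, ρ (A.r i) = S i := fun i => cs.lift_apply_simple hSl i
  have hσr : ∀ i, σ (A.r i) = s i := fun i => cs.lift_apply_simple hsl i
  have hρσ : ∀ w x, ρ w (single 0 x) = single 0 (σ w x) := by
    intro w
    induction w using cs.simple_induction_left with
    | one =>
      intro x
      rw [map_one, map_one]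
      rfl
    | mul_simple_left w i ih =>
    intro x
    change ρ (A.r i * w) _ = single 0 (σ (A.r i * w) x)
    rw [map_mul, map_mul, hρr, hσr, AlgEquiv.mul_apply, ih,
      IsMonomialReflection.map_single_zero hS, AlgEquiv.mul_apply]
  have hsimple : ∀ i l x, ρ (A.r i) (single l x) =
      single (A.weylAction (A.r i) l) (s i x * A.phiK φ i ^ (l i)) := by
    intro i l x
    rw [hρr, IsMonomialReflection.map_single hS, A.weylAction_r, simpleReflection_apply]
  have hmul : ∀ w l x, ρ w (single l x) = single 0 (σ w x) * ρ w (single l 1) := by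
    intro w l x
    rw [← hρσ, ← map_mul, single_mul_single, zero_add, mul_one]
  have hex : ∀ w l, ∃ x, ρ w (single l 1) = single (A.weylAction w l) x := by
    intro w
    induction w using cs.simple_induction_left with
    | one =>
      intro l
      refine ⟨1, ?_⟩
      rw [map_one, map_one]
      rfl
    | mul_simple_left w i ih =>
    intro l
    obtain ⟨x, hx⟩ := ih l
    refine ⟨s i x * A.phiK φ i ^ (A.weylAction w l i), ?_⟩
    change ρ (A.r i * w) _ = single (A.weylAction (A.r i * w) l) _
    rw [map_mul, map_mul, AlgEquiv.mul_apply, hx, hsimple]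
    rfl
  refine ⟨ρ, σ, hρr, hσr, hρσ, ?_, ?_⟩
  · intro w l
    simp only [algebraMap_mul_tauPow]
    simp only [tauPow_eq_single]
    obtain ⟨x, hx⟩ := hex w l
    exact ⟨x, hx, fun y hy => single_right_injective (hy.symm.trans hx)⟩
  · intro c
    simp only [algebraMap_mul_tauPow]
    simp only [tauPow_eq_single]
    constructor
    · intro hc
      refine ⟨fun w l h0 => ?_, fun w l l' => ?_, fun l => ?_, fun i l => ?_, fun w w' l => ?_⟩
      · have h1 := hc w l
        rw [h0, single_zero] at h1
        have h2 := (map_eq_zero_iff (ρ w) (ρ w).injective).1 h1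
        exact one_ne_zero (single_eq_zero.1 h2)
      · have h1 := hc w (l + l')
        have h2 : (single (l + l') 1 : A.LaurentRing A₀) = single l 1 * single l' 1 := by
          rw [single_mul_single, mul_one]
        rw [h2, map_mul, hc, hc, single_mul_single, map_add] at h1
        exact single_right_injective h1.symm
      · have h1 := hc 1 l
        rw [map_one, map_one] at h1
        exact single_right_injective h1.symm
      · have h1 := hc (A.r i) l
        rw [hsimple, map_one, one_mul] at h1
        exact single_right_injective h1.symm
      · have h1 := hc (w * w') l
        rw [map_mul, AlgEquiv.mul_apply, hc, hmul, hc, single_mul_single, zero_add, map_mul] at h1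
        exact single_right_injective h1.symm
    · intro hc w
      induction w using cs.simple_induction_left with
      | one =>
        intro l
        rw [hc.one, map_one, map_one]
        rfl
      | mul_simple_left w i ih =>
        intro l
        change ρ (A.r i * w) _ = single (A.weylAction (A.r i * w) l) (c (A.r i * w) l)
        rw [hc.mul, hc.simple, map_mul, map_mul, AlgEquiv.mul_apply, ih, hsimple, hσr]
        rfl

end GCM

theorem theorem2 {I : Type u} (A : GCM I) {A₀ : Type v} [CommRing A₀] [IsDomain A₀] [Algebra ℂ A₀]
    (P : PoissonBracket A₀) (φ : I → A₀) (hφ : ∀ i, φ i ≠ 0)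
    (hgen : P.IsGeneratedBy (Set.range φ))
    (hserre : ∀ i j, i ≠ j → (P.bracket (φ i))^[(1 - A.a i j).toNat] (φ j) = 0) :
    -- the automorphisms `s i` of the function field exist and are unique
    (∃! s, A.IsBirationalReflection P φ s) ∧
    ∀ s, A.IsBirationalReflection P φ s →
      -- they extend uniquely to automorphisms of the Laurent polynomial ring
      (∃! S, A.IsTauExtension φ s S) ∧
      ∀ S, A.IsTauExtension φ s S →
        -- the extended automorphisms satisfy the fundamental relations of the Weyl group
        (∀ i, S i ^ 2 = 1) ∧
        (∀ i j, i ≠ j → (S i * S j) ^ A.coxeterMatrix i j = 1) ∧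
        -- so that the Weyl group acts on the Laurent polynomial ring and on the function field
        ∃ (ρ : A.WeylGroup →* (A.LaurentRing A₀ ≃ₐ[ℂ] A.LaurentRing A₀))
          (σ : A.WeylGroup →* (A.FunctionField A₀ ≃ₐ[ℂ] A.FunctionField A₀)),
          (∀ i, ρ (A.r i) = S i) ∧ (∀ i, σ (A.r i) = s i) ∧
          (∀ w x, ρ w (algebraMap (A.FunctionField A₀) (A.LaurentRing A₀) x) =
            algebraMap (A.FunctionField A₀) (A.LaurentRing A₀) (σ w x)) ∧
          -- every `w (τ^Λ)` is a unique multiple of `τ^(w.Λ)`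
          (∀ w l, ∃! x : A.FunctionField A₀, ρ w (A.tauPow A₀ l) =
            algebraMap (A.FunctionField A₀) (A.LaurentRing A₀) x *
              A.tauPow A₀ (A.weylAction w l)) ∧
          -- and these multiples are the one and only `τ`-cocycle
          (∀ c : A.WeylGroup → A.WeightLattice → A.FunctionField A₀,
            (∀ w l, ρ w (A.tauPow A₀ l) =
              algebraMap (A.FunctionField A₀) (A.LaurentRing A₀) (c w l) *
                A.tauPow A₀ (A.weylAction w l)) ↔ A.IsTauCocycle φ σ c) := by
  have hN : ∀ i, (P.ad (φ i)).IsLocallyNilpotent := by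
    refine fun i => P.ad_isLocallyNilpotent hgen (φ i) ?_
    rintro _ ⟨j, rfl⟩
    rcases eq_or_ne i j with rfl | hij
    · exact ⟨1, P.bracket_self _⟩
    · exact ⟨_, hserre i j hij⟩
  refine ⟨A.existsUnique_isBirationalReflection P hN hφ, fun s hs => ?_⟩
  have hs' : ∀ i, A.IsReflectionHom P hN i (s i) := (A.isBirationalReflection_iff P hN s).1 hs
  refine ⟨GCM.existsUnique_isTauExtension hφ (fun i => DFunLike.congr_fun (hs' i).comp_self)
    fun i => (hs' i).map_phiK, fun S hS => ?_⟩
  replace hS := (GCM.isTauExtension_iff hφ s S).1 hS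
  have hS2 : ∀ i, S i * S i = 1 := fun i =>
    AlgEquiv.ext (GCM.IsMonomialReflection.involutive hs' hφ hS i)
  have hbraid : ∀ i j, i ≠ j → (S i * S j) ^ A.coxeterMatrix i j = 1 := fun i j hij =>
    GCM.IsMonomialReflection.mul_pow_coxeterMatrix hs' hφ hS hserre hij
  have hSl : A.coxeterMatrix.IsLiftable S := by
    intro i j
    rcases eq_or_ne i j with rfl | hij
    · rw [A.coxeterMatrix.diagonal, pow_one, hS2]
    · exact hbraid i j hij
  exact ⟨fun i => by rw [sq, hS2], hbraid, GCM.exists_weylGroup_action hS hSl⟩
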